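/- Semi-random graph process. For $n\ge 1$ start from the empty graph $G_0$ on $[n]=\{1,\dots,n\}$. In each step $t\ge 1$ a vertex $u_t\in[n]$ is chosen uniformly at random, independently of the past; a strategy $\mathcal S$ then chooses $v_t\in[n]$ at random from a distribution that may depend on $u_t$ and on the whole history $u_1,v_1,\dots,u_{t-1},v_{t-1}$, and the edge $u_tv_t$ is added to $G_{t-1}$ to form $G_t=G_t^{\mathcal S}(n)$. For $0<q<1$ let $\tau_{\mathtt{HAM}}(\mathcal S,q,n)$ be the minimum $t\ge 0$ for which $\mathbb P[G_t^{\mathcal S}(n)\text{ has a Hamiltonian cycle}]\ge q$ (and $\infty$ if there is no such $t$), let $\tau_{\mathtt{HAM}}(q,n)=\inf_{\mathcal S}\tau_{\mathtt{HAM}}(\mathcal S,q,n)$ be the infimum over all strategies on $[n]$, and $$\tau_{\mathtt{HAM}}=\lim_{q\to1^-}\ \limsup_{n\to\infty}\frac{\tau_{\mathtt{HAM}}(q,n)}{n}.$$ Consider the system of differential equations for $x=x(s)$, $\ell_1=\ell_1(s)$, $\ell_2=\ell_2(s)$ $$x' = 1-x+2(\ell_1+\ell_2),$$ $$\ell_1'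 = x-5(\ell_1+\ell_2)+2\ell_1\Bigl(\frac{2\ell_2-\ell_1}{1-x}-1\Bigr)+2\ell_2\Bigl(1+\frac{2\ell_2-\ell_1}{1-x}\Bigr)-\ell_1+2\ell_2-\ell_1,$$ $$\ell_2' = \ell_1-2\ell_2-2\ell_1\,\frac{2\ell_2}{1-x}-2\ell_2\Bigl(1+\frac{2\ell_2}{1-x}\Bigr),$$ with $x(0)=\ell_1(0)=\ell_2(0)=0$. For $\varepsilon>0$ let $$\mathcal D_\varepsilon=\{(s,x,\ell_1,\ell_2): -1<s<3,\ -1<x<1-\varepsilon,\ |\ell_1|<2,\ |\ell_2|<2\},$$ let $\sigma(\varepsilon)$ be the supremum of the times $s\ge 0$ to which the solution can be extended before reaching the boundary of $\mathcal D_\varepsilon$, and let $\hat\alpha=\lim_{\varepsilon\to0^+}\sigma(\varepsilon)$ (this limit exists, since $\sigma(\varepsilon)$ is bounded by $3$ and does not decrease as $\varepsilon$ decreases to $0$). **Theorem.** $\tau_{\mathtt{HAM}}\le\hat\alpha\le 2.07721$. -/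

import Mathlib

open Filter Topology
open scoped ENNReal

namespace SemiRandom

/-! ## The semi-random graph process -/

section Game

variable {V : Type*}

/-- A (randomised, adaptive) strategy on the vertex set `V`. A history is the list of the arcs
`(u, v)` added so far, most recent first (so its length is the number of elapsed steps). Given the
history and the presented vertex `u` (the square), the strategy returns the distribution of the
vertex `v` (the circle) to be joined to `u`. -/
abbrev Strategy (V : Type*) := List (V × V) → V → PMF V

/-- The law of the history after `t` steps: in each step `u` is uniform on `V`, independently of
the past, and then `v` is drawn from the distribution that the strategy prescribes. -/
noncomputable def law [Fintype V] [Nonempty V] (S : Strategy V) : ℕ → PMF (List (V × V))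
  | 0 => PMF.pure []
  | t + 1 => (law S t).bind fun h =>
      (PMF.uniformOfFintype V).bind fun u => (S h u).map fun v => (u, v) :: h

/-- The graph on `V` whose edges are the pairs joined by some arc of the history. Loops and
multiplicities play no role for Hamiltonian cycles on at least three vertices. -/
def graphOf (h : List (V × V)) : SimpleGraph V :=
  SimpleGraph.fromRel fun a b => (a, b) ∈ h

/-- The probability that the graph built in `t` steps has the property `P`. -/
noncomputable def prob [Fintype V] [Nonempty V] (P : SimpleGraph V → Prop) (S : Strategy V)
    (t : ℕ) : ℝ≥0∞ :=
  (law S t).toOuterMeasure {h | P (graphOf h)}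

/-- The least `t` such that the graph after `t` steps has property `P` with probability at
least `q`; it is `∞` if there is no such `t`. -/
noncomputable def tauStrategy [Fintype V] [Nonempty V] (P : SimpleGraph V → Prop)
    (S : Strategy V) (q : ℝ≥0∞) : ℝ≥0∞ :=
  ⨅ (t : ℕ) (_ : q ≤ prob P S t), (t : ℝ≥0∞)

/-- The infimum of `tauStrategy` over all strategies on `V`. -/
noncomputable def tauFinite [Fintype V] [Nonempty V] (P : SimpleGraph V → Prop)
    (q : ℝ≥0∞) : ℝ≥0∞ :=
  ⨅ S : Strategy V, tauStrategy P S q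

end Game

/-- The upper limit, as the number of vertices `n = m + 1 ≥ 1` tends to infinity, of
`τ(q, n) / n` for the property of having a Hamiltonian cycle. -/
noncomputable def limsupTauHam (q : ℝ≥0∞) : ℝ≥0∞ :=
  limsup (fun m : ℕ =>
    tauFinite (V := Fin (m + 1)) (fun G => G.IsHamiltonian) q / ((m + 1 : ℕ) : ℝ≥0∞)) atTop

/-- The threshold constant of Hamiltonicity: the limit of `limsupTauHam q` as `q → 1⁻`. -/
noncomputable def tauHam : ℝ≥0∞ :=
  limUnder (𝓝[<] (1 : ℝ≥0∞)) limsupTauHam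

theorem limsupTauHam_mono : Monotone limsupTauHam := by
  intro q q' hq
  refine limsup_le_limsup (Eventually.of_forall fun m => ?_)
  refine ENNReal.div_le_div_right (iInf_mono fun S => iInf_mono fun t => ?_) _
  exact iInf_mono' fun h => ⟨hq.trans h, le_rfl⟩

/-- The limit that defines `tauHam` exists. -/
theorem tendsto_tauHam : Tendsto limsupTauHam (𝓝[<] (1 : ℝ≥0∞)) (𝓝 tauHam) :=
  tendsto_nhds_limUnder ⟨_, limsupTauHam_mono.tendsto_nhdsLT 1⟩

/-! ## The system of differential equations -/

/-- Right-hand side of the equation for `x`. -/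
noncomputable def rhsX (x l₁ l₂ : ℝ) : ℝ :=
  1 - x + 2 * (l₁ + l₂)

/-- Right-hand side of the equation for `ℓ₁`. -/
noncomputable def rhsL₁ (x l₁ l₂ : ℝ) : ℝ :=
  x - 5 * (l₁ + l₂) + 2 * l₁ * ((2 * l₂ - l₁) / (1 - x) - 1)
    + 2 * l₂ * (1 + (2 * l₂ - l₁) / (1 - x)) - l₁ + 2 * l₂ - l₁

/-- Right-hand side of the equation for `ℓ₂`. -/
noncomputable def rhsL₂ (x l₁ l₂ : ℝ) : ℝ :=
  l₁ - 2 * l₂ - 2 * l₁ * (2 * l₂ / (1 - x)) - 2 * l₂ * (1 + 2 * l₂ / (1 - x))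

/-- The bounded domain `D_ε` of points `(s, x, ℓ₁, ℓ₂)`. -/
def InDomain (ε s x l₁ l₂ : ℝ) : Prop :=
  (-1 < s ∧ s < 3) ∧ (-1 < x ∧ x < 1 - ε) ∧ |l₁| < 2 ∧ |l₂| < 2

/-- `(x, ℓ₁, ℓ₂)` solves the system on `[0, T)`, starts at zero, and stays inside `D_ε`
on `[0, T)`. -/
structure IsSolution (ε T : ℝ) (x l₁ l₂ : ℝ → ℝ) : Prop where
  x_zero : x 0 = 0
  l₁_zero : l₁ 0 = 0
  l₂_zero : l₂ 0 = 0
  deriv_x : ∀ s ∈ Set.Ico 0 T,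
    HasDerivWithinAt x (rhsX (x s) (l₁ s) (l₂ s)) (Set.Ico 0 T) s
  deriv_l₁ : ∀ s ∈ Set.Ico 0 T,
    HasDerivWithinAt l₁ (rhsL₁ (x s) (l₁ s) (l₂ s)) (Set.Ico 0 T) s
  deriv_l₂ : ∀ s ∈ Set.Ico 0 T,
    HasDerivWithinAt l₂ (rhsL₂ (x s) (l₁ s) (l₂ s)) (Set.Ico 0 T) s
  mem_domain : ∀ s ∈ Set.Ico 0 T, InDomain ε s (x s) (l₁ s) (l₂ s)

/-- The times up to which the solution started at zero can be extended inside `D_ε`. -/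
def solutionTimes (ε : ℝ) : Set ℝ :=
  {T | 0 ≤ T ∧ ∃ x l₁ l₂ : ℝ → ℝ, IsSolution ε T x l₁ l₂}

/-- `σ(ε)`: the supremum of the times to which the solution started at zero can be extended
before it reaches the boundary of `D_ε`. -/
noncomputable def sigma (ε : ℝ) : ℝ := sSup (solutionTimes ε)

/-- The constant `α̂ = lim_{ε → 0+} σ(ε)`. -/
noncomputable def alphaHat : ℝ := limUnder (𝓝[>] (0 : ℝ)) sigma

theorem solutionTimes_nonempty (ε : ℝ) : (solutionTimes ε).Nonempty :=
  ⟨0, le_rfl, fun _ => 0, fun _ => 0, fun _ => 0,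
    ⟨rfl, rfl, rfl, by simp, by simp, by simp, by simp⟩⟩

theorem solutionTimes_bddAbove (ε : ℝ) : BddAbove (solutionTimes ε) := by
  refine ⟨3, fun T hT => ?_⟩
  obtain ⟨_, x, l₁, l₂, h⟩ := hT
  by_contra! hT
  have := (h.mem_domain 3 ⟨by norm_num, hT⟩).1.2
  exact lt_irrefl _ this

theorem sigma_antitone : Antitone sigma := by
  intro ε ε' hε
  refine csSup_le_csSup (solutionTimes_bddAbove ε) (solutionTimes_nonempty ε') ?_
  rintro T ⟨hT, x, l₁, l₂, h⟩
  refine ⟨hT, x, l₁, l₂, { h with mem_domain := fun s hs => ?_ }⟩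
  obtain ⟨h1, h2, h3⟩ := h.mem_domain s hs
  exact ⟨h1, ⟨h2.1, by linarith [h2.2]⟩, h3⟩

/-- The limit that defines `alphaHat` exists. -/
theorem tendsto_alphaHat : Tendsto sigma (𝓝[>] (0 : ℝ)) (𝓝 alphaHat) := by
  refine tendsto_nhds_limUnder ⟨-sInf ((fun ε => -sigma ε) '' Set.Ioi 0), ?_⟩
  have hm : MonotoneOn (fun ε => -sigma ε) (Set.Ioi 0) :=
    fun a _ b _ hab => neg_le_neg (sigma_antitone hab)
  have hb : BddBelow ((fun ε => -sigma ε) '' Set.Ioi 0) := by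
    refine ⟨-3, ?_⟩
    rintro _ ⟨ε, _, rfl⟩
    refine neg_le_neg (csSup_le (solutionTimes_nonempty ε) fun T hT => ?_)
    obtain ⟨_, x, l₁, l₂, h⟩ := hT
    by_contra! hT
    exact lt_irrefl _ (h.mem_domain 3 ⟨by norm_num, hT⟩).1.2
  simpa using (hm.tendsto_nhdsGT hb).neg

end SemiRandom

namespace SemiRandom

set_option linter.unusedSectionVars false

/-! ## Optimal play -/

section Value

variable {V : Type*}

theorem graphOf_cons (u v : V) (h : List (V × V)) :
    graphOf ((u, v) :: h) = graphOf h ⊔ SimpleGraph.edge u v := by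
  ext a b
  simp only [graphOf, SimpleGraph.fromRel_adj, SimpleGraph.sup_adj, SimpleGraph.edge_adj,
    List.mem_cons, Prod.mk.injEq]
  tauto

theorem graphOf_nil : graphOf ([] : List (V × V)) = ⊥ := by
  ext a b
  simp [graphOf]

variable [Fintype V]

open Classical in
/-- The probability that an optimal player, starting from the graph `G`, fails to achieve the
property `P` in `t` steps. -/
noncomputable def failProb (P : SimpleGraph V → Prop) : ℕ → SimpleGraph V → ℝ
  | 0, G => if P G then 0 else 1
  | t + 1, G => (∑ u, ⨅ v, failProb P t (G ⊔ SimpleGraph.edge u v)) / Fintype.card V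

variable [Nonempty V] {P : SimpleGraph V → Prop}

theorem failProb_nonneg (t : ℕ) (G : SimpleGraph V) : 0 ≤ failProb P t G := by
  induction t generalizing G with
  | zero => simp only [failProb]; split_ifs <;> norm_num
  | succ t ih =>
    exact div_nonneg (Finset.sum_nonneg fun u _ => le_ciInf fun v => ih _) (Nat.cast_nonneg _)

theorem iInf_failProb_le (t : ℕ) (G : SimpleGraph V) (u v : V) :
    ⨅ v, failProb P t (G ⊔ SimpleGraph.edge u v) ≤ failProb P t (G ⊔ SimpleGraph.edge u v) :=
  ciInf_le (Set.finite_range _).bddBelow v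

theorem failProb_succ_le (t : ℕ) (G : SimpleGraph V) (v : V → V) :
    failProb P (t + 1) G ≤
      (∑ u, failProb P t (G ⊔ SimpleGraph.edge u (v u))) / Fintype.card V := by
  rw [failProb]
  gcongr with u
  exact iInf_failProb_le t G u (v u)

theorem card_pos_real : (0 : ℝ) < Fintype.card V := by exact_mod_cast Fintype.card_pos

theorem failProb_le_one (t : ℕ) (G : SimpleGraph V) : failProb P t G ≤ 1 := by
  induction t generalizing G with
  | zero => simp only [failProb]; split_ifs <;> norm_num
  | succ t ih =>
    refine (failProb_succ_le t G id).trans ?_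
    rw [div_le_one card_pos_real]
    calc _ ≤ ∑ u : V, (1 : ℝ) := Finset.sum_le_sum fun u _ => ih _
      _ = _ := by simp

/-- Properties that are preserved when edges are added. -/
abbrev IsIncreasing (P : SimpleGraph V → Prop) : Prop := ∀ ⦃G H⦄, G ≤ H → P G → P H

theorem failProb_anti (hP : IsIncreasing P) (t : ℕ) {G H : SimpleGraph V} (h : G ≤ H) :
    failProb P t H ≤ failProb P t G := by
  induction t generalizing G H with
  | zero =>
    simp only [failProb]
    by_cases hG : P G
    · simp [hG, hP h hG]
    · rw [if_neg hG]; split_ifs <;> norm_num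
  | succ t ih =>
    rw [failProb, failProb]
    refine div_le_div_of_nonneg_right (Finset.sum_le_sum fun u _ => ?_) (Nat.cast_nonneg _)
    refine le_ciInf fun v => (iInf_failProb_le t H u v).trans (ih (sup_le_sup_right h _))

theorem failProb_succ_le_self (hP : IsIncreasing P) (t : ℕ) (G : SimpleGraph V) :
    failProb P (t + 1) G ≤ failProb P t G := by
  refine (failProb_succ_le t G id).trans ?_
  rw [div_le_iff₀ card_pos_real]
  calc _ ≤ ∑ u : V, failProb P t G := Finset.sum_le_sum fun u _ => failProb_anti hP t le_sup_left
    _ = _ := by simp [mul_comm]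

theorem failProb_antitone (hP : IsIncreasing P) (G : SimpleGraph V) :
    Antitone fun t => failProb P t G :=
  antitone_nat_of_succ_le fun t => failProb_succ_le_self hP t G

theorem exists_best (P : SimpleGraph V → Prop) (t : ℕ) (G : SimpleGraph V) (u : V) :
    ∃ v, failProb P t (G ⊔ SimpleGraph.edge u v) =
      ⨅ v, failProb P t (G ⊔ SimpleGraph.edge u v) :=
  exists_eq_ciInf_of_finite

/-- An optimal strategy for the time horizon `T`. -/
noncomputable def bestStrategy (P : SimpleGraph V → Prop) (T : ℕ) : Strategy V :=
  fun h u => PMF.pure (exists_best P (T - (h.length + 1)) (graphOf h) u).choose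

theorem length_of_mem_support_law (S : Strategy V) (t : ℕ) (h : List (V × V))
    (hh : h ∈ (law S t).support) : h.length = t := by
  induction t generalizing h with
  | zero => simp [law] at hh; simp [hh]
  | succ t ih =>
    simp only [law, PMF.mem_support_bind_iff, PMF.mem_support_map_iff] at hh
    obtain ⟨h', hh', u, -, v, -, rfl⟩ := hh
    simp [ih h' hh']

theorem tsum_bind_mul {α β : Type*} (p : PMF α) (f : α → PMF β) (g : β → ℝ≥0∞) :
    ∑' b, (p.bind f) b * g b = ∑' a, p a * ∑' b, f a b * g b := by
  simp only [PMF.bind_apply, ← ENNReal.tsum_mul_right, ← ENNReal.tsum_mul_left]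
  rw [ENNReal.tsum_comm]
  simp only [mul_assoc]

theorem tsum_pure_mul {α : Type*} (a : α) (g : α → ℝ≥0∞) :
    ∑' b, (PMF.pure a) b * g b = g a := by
  rw [tsum_eq_single a]
  · simp
  · intro b hb; simp [hb]

theorem tsum_law_bestStrategy (T t : ℕ) (ht : t ≤ T) :
    ∑' h, law (bestStrategy P T) t h * ENNReal.ofReal (failProb P (T - t) (graphOf h)) =
      ENNReal.ofReal (failProb P T ⊥) := by
  induction t with
  | zero => rw [law, tsum_pure_mul, graphOf_nil, Nat.sub_zero]
  | succ t ih =>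
    rw [← ih (by lia), law, tsum_bind_mul]
    refine tsum_congr fun h => ?_
    by_cases hh : h ∈ (law (bestStrategy P T) t).support
    · congr 1
      obtain rfl := length_of_mem_support_law _ _ _ hh
      rw [tsum_bind_mul, tsum_fintype]
      have hT : T - h.length = (T - (h.length + 1)) + 1 := by lia
      rw [hT, failProb, ENNReal.ofReal_div_of_pos card_pos_real,
        ENNReal.ofReal_sum_of_nonneg fun u _ => le_ciInf fun v => failProb_nonneg _ _,
        div_eq_mul_inv, Finset.sum_mul]
      refine Finset.sum_congr rfl fun u _ => ?_
      rw [PMF.uniformOfFintype_apply, mul_comm, ENNReal.ofReal_natCast, bestStrategy, PMF.pure_map,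
        tsum_pure_mul, graphOf_cons]
      congr 2
      exact (exists_best P _ (graphOf h) u).choose_spec
    · rw [PMF.mem_support_iff, not_not] at hh
      simp [hh]

theorem prob_bestStrategy (T : ℕ) :
    prob P (bestStrategy P T) T = 1 - ENNReal.ofReal (failProb P T ⊥) := by
  classical
  have h := tsum_law_bestStrategy (P := P) T T le_rfl
  have hp : prob P (bestStrategy P T) T =
      ∑' h, law (bestStrategy P T) T h * (if P (graphOf h) then 1 else 0) := by
    rw [prob, PMF.toOuterMeasure_apply]
    refine tsum_congr fun h => ?_
    by_cases hh : P (graphOf h) <;> simp [hh]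
  have hs : prob P (bestStrategy P T) T + ENNReal.ofReal (failProb P T ⊥) = 1 := by
    rw [← h, hp, ← ENNReal.tsum_add, ← (law (bestStrategy P T) T).tsum_coe]
    refine tsum_congr fun h => ?_
    simp only [Nat.sub_self, failProb]
    by_cases hh : P (graphOf h) <;> simp [hh]
  exact ENNReal.eq_sub_of_add_eq ENNReal.ofReal_ne_top hs

theorem tauFinite_le {T : ℕ} {q : ℝ≥0∞} (h : ENNReal.ofReal (failProb P T ⊥) ≤ 1 - q)
    (hq : q ≤ 1) : tauFinite P q ≤ T := by
  refine (iInf_le _ (bestStrategy P T)).trans (iInf₂_le T ?_)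
  rw [prob_bestStrategy]
  calc q = 1 - (1 - q) := (ENNReal.sub_sub_cancel ENNReal.one_ne_top hq).symm
    _ ≤ _ := tsub_le_tsub_left h 1

/-! ## Bounds on hitting times -/

/-- From every graph in `Q`, the player achieves `P` in expected time at most `c`, in the form
of the resulting Markov inequality. -/
def HitBound (P Q : SimpleGraph V → Prop) (c : ℝ) : Prop :=
  ∀ G, Q G → ∀ t : ℕ, t * failProb P t G ≤ c

theorem HitBound.mono {Q Q' : SimpleGraph V → Prop} {c c' : ℝ} (h : HitBound P Q' c')
    (hQ : ∀ G, Q G → Q' G) (hc : c' ≤ c) : HitBound P Q c :=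
  fun G hG t => (h G (hQ G hG) t).trans hc

theorem hitBound_self (hP : IsIncreasing P) : HitBound P P 0 := by
  classical
  intro G hG t
  refine mul_nonpos_of_nonneg_of_nonpos (Nat.cast_nonneg _) ?_
  refine (failProb_antitone hP G (Nat.zero_le t)).trans ?_
  simp [failProb, hG]

/-- If in each step the class `S'` is entered from the class `S` with probability at least `p`,
then the expected time to `P` from `S` exceeds that from `S'` by at most `1 / p`. -/
theorem HitBound.progress {S S' : SimpleGraph V → Prop}
    (hS : IsIncreasing S) {c p : ℝ} (hp : 0 < p) (hc : 0 ≤ c) (h : HitBound P S' c)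
    (hstep : ∀ G, S G → ∃ (good : Finset V) (v : V → V), p * Fintype.card V ≤ good.card ∧
      ∀ u ∈ good, S' (G ⊔ SimpleGraph.edge u (v u))) :
    HitBound P S (c + 1 / p) := by
  classical
  intro G hG t
  induction t generalizing G with
  | zero => simp only [Nat.cast_zero, zero_mul]; positivity
  | succ t ih =>
    obtain ⟨good, v, hgood, hv⟩ := hstep G hG
    have hn := card_pos_real (V := V)
    have h1 : (t : ℝ) * failProb P (t + 1) G ≤ c + 1 / p - 1 := by
      calc (t : ℝ) * failProb P (t + 1) G
          ≤ t * ((∑ u, failProb P t (G ⊔ SimpleGraph.edge u (v u))) / Fintype.card V) := by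
            gcongr; exact failProb_succ_le t G v
        _ = (∑ u, t * failProb P t (G ⊔ SimpleGraph.edge u (v u))) / Fintype.card V := by
            rw [mul_div_assoc', Finset.mul_sum]
        _ ≤ (∑ u, (c + 1 / p - if u ∈ good then 1 / p else 0)) / Fintype.card V := by
            gcongr with u
            split_ifs with hu
            · simpa using h _ (hv u hu) t
            · simpa using ih _ (hS le_sup_left hG)
        _ ≤ _ := by
            rw [div_le_iff₀ hn, Finset.sum_sub_distrib, Finset.sum_ite_mem, Finset.univ_inter]
            simp only [Finset.sum_const, Finset.card_univ, nsmul_eq_mul]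
            have : (Fintype.card V : ℝ) ≤ good.card * (1 / p) := by
              rw [mul_one_div, le_div_iff₀ hp]; linarith
            nlinarith
    have h2 := failProb_le_one (P := P) (t + 1) G
    push_cast
    linarith

end Value

end SemiRandom
namespace SemiRandom

set_option linter.unusedSectionVars false

/-! ## Paths with marked vertices -/

section Paths

variable {V : Type*} [DecidableEq V]

/-- The marked vertices `R` are internal vertices of the path `l`, at pairwise distance at least
three. -/
def Spaced (l : List V) (R : Finset V) : Prop :=
  (∀ p ∈ R, 1 ≤ l.idxOf p ∧ l.idxOf p + 1 < l.length) ∧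
    ∀ p ∈ R, ∀ q ∈ R, p ≠ q → l.idxOf p + 3 ≤ l.idxOf q ∨ l.idxOf q + 3 ≤ l.idxOf p

theorem Spaced.subset {l : List V} {R R' : Finset V} (h : Spaced l R) (hR : R' ⊆ R) :
    Spaced l R' :=
  ⟨fun p hp => h.1 p (hR hp), fun p hp q hq => h.2 p (hR hp) q (hR hq)⟩

theorem spaced_empty (l : List V) : Spaced l ∅ := ⟨by simp, by simp⟩

theorem Spaced.mem {l : List V} {R : Finset V} (h : Spaced l R) {p : V} (hp : p ∈ R) : p ∈ l :=
  List.idxOf_lt_length_iff.1 (by have := (h.1 p hp).2; lia)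

/-- The vertices next to `p` on the path `l`. -/
def pathNbrs (l : List V) (p : V) : Finset V :=
  l.toFinset.filter fun u => l.idxOf u = l.idxOf p + 1 ∨ l.idxOf u + 1 = l.idxOf p

/-- The vertices of the path `l` that may be marked in addition to those in `R`. -/
def permissible (l : List V) (R : Finset V) : Finset V :=
  l.toFinset.filter fun v => (1 ≤ l.idxOf v ∧ l.idxOf v + 1 < l.length) ∧
    ∀ p ∈ R, l.idxOf p + 3 ≤ l.idxOf v ∨ l.idxOf v + 3 ≤ l.idxOf p

theorem permissible_subset (l : List V) (R : Finset V) : permissible l R ⊆ l.toFinset :=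
  Finset.filter_subset _ _

theorem Spaced.insert {l : List V} {R : Finset V} (h : Spaced l R) {v : V}
    (hv : v ∈ permissible l R) : Spaced l (insert v R) := by
  simp only [permissible, Finset.mem_filter] at hv
  refine ⟨?_, ?_⟩
  · intro p hp
    rcases Finset.mem_insert.1 hp with rfl | hp
    · exact hv.2.1
    · exact h.1 p hp
  · intro p hp q hq hpq
    rcases Finset.mem_insert.1 hp with rfl | hp' <;> rcases Finset.mem_insert.1 hq with rfl | hq'
    · exact absurd rfl hpq
    · exact (hv.2.2 q hq').symm
    · exact hv.2.2 p hp'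
    · exact h.2 p hp' q hq' hpq

theorem not_mem_of_mem_permissible {l : List V} {R : Finset V} {v : V}
    (hv : v ∈ permissible l R) : v ∉ R := by
  intro h
  simp only [permissible, Finset.mem_filter] at hv
  have := hv.2.2 v h
  lia

theorem length_le_card_permissible {l : List V} (hl : l.Nodup) (R : Finset V) :
    l.length ≤ (permissible l R).card + 5 * R.card + 2 := by
  have hinj : Set.InjOn l.idxOf (l.toFinset : Set V) := by
    intro a ha b hb hab
    exact (List.idxOf_inj (by simpa using ha)).1 hab
  have hsub : (l.toFinset \ permissible l R).image l.idxOf ⊆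
      {0, l.length - 1} ∪ R.biUnion fun p => Finset.Icc (l.idxOf p - 2) (l.idxOf p + 2) := by
    intro i hi
    simp only [Finset.mem_image, Finset.mem_sdiff, permissible, Finset.mem_filter, not_and,
      List.mem_toFinset] at hi
    obtain ⟨v, ⟨hv, hv'⟩, rfl⟩ := hi
    have hlt := List.idxOf_lt_length_iff.2 hv
    by_cases h1 : 1 ≤ l.idxOf v ∧ l.idxOf v + 1 < l.length
    · have := hv' hv h1
      push Not at this
      obtain ⟨p, hp, hp'⟩ := this
      refine Finset.mem_union_right _ (Finset.mem_biUnion.2 ⟨p, hp, Finset.mem_Icc.2 ?_⟩)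
      lia
    · refine Finset.mem_union_left _ ?_
      simp only [Finset.mem_insert, Finset.mem_singleton]
      lia
  have hcard := Finset.card_le_card hsub
  rw [Finset.card_image_of_injOn (hinj.mono (by simp))] at hcard
  have h2 : (R.biUnion fun p => Finset.Icc (l.idxOf p - 2) (l.idxOf p + 2)).card ≤ R.card * 5 := by
    refine Finset.card_biUnion_le_card_mul _ _ _ fun p _ => ?_
    rw [Nat.card_Icc]
    lia
  have h3 : ({0, l.length - 1} : Finset ℕ).card ≤ 2 := Finset.card_le_two
  have h4 := Finset.card_union_le {0, l.length - 1}
    (R.biUnion fun p => Finset.Icc (l.idxOf p - 2) (l.idxOf p + 2))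
  have h5 : l.toFinset.card ≤ (l.toFinset \ permissible l R).card + (permissible l R).card := by
    have := Finset.le_card_sdiff (permissible l R) l.toFinset
    lia
  rw [List.toFinset_card_of_nodup hl] at h5
  lia

theorem card_pathNbrs {l : List V} (hl : l.Nodup) {R : Finset V} (h : Spaced l R) {p : V}
    (hp : p ∈ R) : (pathNbrs l p).card = 2 := by
  obtain ⟨h1, h2⟩ := h.1 p hp
  have : pathNbrs l p = {l[l.idxOf p + 1], l[l.idxOf p - 1]} := by
    ext v
    simp only [pathNbrs, Finset.mem_filter, List.mem_toFinset, Finset.mem_insert,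
      Finset.mem_singleton]
    constructor
    · rintro ⟨hv, h | h⟩
      · left; simp [← h]
      · right; simp [← h]
    · rintro (rfl | rfl)
      · exact ⟨List.getElem_mem _, Or.inl (hl.idxOf_getElem _ _)⟩
      · refine ⟨List.getElem_mem _, Or.inr ?_⟩
        rw [hl.idxOf_getElem]; lia
  rw [this, Finset.card_pair]
  rw [Ne, hl.getElem_inj_iff]
  lia

theorem Spaced.pairwiseDisjoint {l : List V} {R : Finset V} (h : Spaced l R) :
    (R : Set V).PairwiseDisjoint (pathNbrs l) := by
  intro p hp q hq hpq
  rw [Function.onFun, Finset.disjoint_left]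
  intro u hu hu'
  simp only [pathNbrs, Finset.mem_filter] at hu hu'
  have := h.2 p hp q hq hpq
  lia

theorem Spaced.not_mem_of_mem_pathNbrs {l : List V} {R : Finset V} (h : Spaced l R) {p u : V}
    (hp : p ∈ R) (hu : u ∈ pathNbrs l p) : u ∉ R := by
  intro hR
  simp only [pathNbrs, Finset.mem_filter] at hu
  by_cases hpu : p = u
  · subst hpu; lia
  · have := h.2 p hp u hR hpu
    lia

theorem not_mem_permissible_of_mem_pathNbrs {l : List V} {R : Finset V} {p u : V} (hp : p ∈ R)
    (hu : u ∈ pathNbrs l p) : u ∉ permissible l R := by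
  intro h
  simp only [pathNbrs, permissible, Finset.mem_filter] at hu h
  have := h.2.2 p hp
  lia

/-- The path `l'` arises from `l` by the addition of the vertex `r`, and marked vertices stay
spaced. -/
structure IsExtension (l l' : List V) (r : V) : Prop where
  nodup : l'.Nodup
  length : l'.length = l.length + 1
  mem_iff : ∀ v, v ∈ l' ↔ v = r ∨ v ∈ l
  spaced : ∀ R, Spaced l R → Spaced l' R

theorem isExtension_append_cons {a b : List V} {r : V} (hl : (a ++ b).Nodup) (hr : r ∉ a ++ b) :
    IsExtension (a ++ b) (a ++ r :: b) r := by
  have hidx : ∀ q ∈ a ++ b, (a ++ r :: b).idxOf q =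
      if q ∈ a then (a ++ b).idxOf q else (a ++ b).idxOf q + 1 := by
    intro q hq
    split_ifs with h
    · rw [List.idxOf_append_of_mem h, List.idxOf_append_of_mem h]
    · rw [List.idxOf_append_of_notMem h, List.idxOf_append_of_notMem h,
        List.idxOf_cons_ne _ (by rintro rfl; exact hr hq)]
      rfl
  have hlt : ∀ q ∈ a, (a ++ b).idxOf q < a.length := fun q hq => by
    rw [List.idxOf_append_of_mem hq]; exact List.idxOf_lt_length_iff.2 hq
  have hge : ∀ q ∉ a, a.length ≤ (a ++ b).idxOf q := fun q hq => by
    rw [List.idxOf_append_of_notMem hq]; lia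
  have hlen : (a ++ r :: b).length = (a ++ b).length + 1 := by simp; lia
  refine ⟨?_, hlen, by intro v; simp; tauto, fun R h => ⟨?_, ?_⟩⟩
  · rw [List.nodup_middle]; exact List.nodup_cons.2 ⟨hr, hl⟩
  · intro p hp
    have := h.1 p hp
    rw [hidx p (h.mem hp), hlen]
    split_ifs <;> lia
  · intro p hp q hq hpq
    have := h.2 p hp q hq hpq
    rw [hidx p (h.mem hp), hidx q (h.mem hq)]
    by_cases h1 : p ∈ a <;> by_cases h2 : q ∈ a <;> simp only [h1, h2, if_true, if_false]
    · exact this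
    · have := hlt p h1; have := hge q h2; lia
    · have := hlt q h2; have := hge p h1; lia
    · lia

theorem edge_adj_self {u v : V} (h : u ≠ v) : (SimpleGraph.edge u v).Adj u v := by
  simp [SimpleGraph.edge_adj, h]

/-- A vertex `r` outside the path can be inserted next to a vertex `p` joined to `r` when a
path neighbour `u` of `p` gets joined to `r` as well. -/
theorem exists_insertion {l : List V} (hl : l.Nodup) {p u r : V} (hp : p ∈ l)
    (hu : u ∈ pathNbrs l p) (hr : r ∉ l) :
    ∃ l', IsExtension l l' r ∧ ∀ G : SimpleGraph V, l.IsChain G.Adj → G.Adj p r →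
      l'.IsChain (G ⊔ SimpleGraph.edge u r).Adj := by
  simp only [pathNbrs, Finset.mem_filter, List.mem_toFinset] at hu
  have key : ∀ x y : V, x ∈ l → y ∈ l → l.idxOf y = l.idxOf x + 1 →
      ∃ l', IsExtension l l' r ∧ ∀ G : SimpleGraph V, l.IsChain G.Adj → G.Adj x r → G.Adj r y →
      l'.IsChain G.Adj := by
    intro x y hx hy hxy
    have hi : l.idxOf x < l.length := List.idxOf_lt_length_iff.2 hx
    have hj : l.idxOf y < l.length := List.idxOf_lt_length_iff.2 hy
    have hsplit : l = l.take (l.idxOf x + 1) ++ l.drop (l.idxOf x + 1) :=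
      (List.take_append_drop _ _).symm
    refine ⟨l.take (l.idxOf x + 1) ++ r :: l.drop (l.idxOf x + 1), ?_, ?_⟩
    · have := isExtension_append_cons (a := l.take (l.idxOf x + 1)) (b := l.drop (l.idxOf x + 1))
        (r := r) (by rwa [← hsplit]) (by rwa [← hsplit])
      rwa [← hsplit] at this
    · intro G hG hxr hry
      have hd : l.drop (l.idxOf x + 1) = y :: l.drop (l.idxOf x + 1 + 1) := by
        rw [List.drop_eq_getElem_cons (by lia)]
        congr 1
        simp [← hxy]
      have ht : l.take (l.idxOf x + 1) = l.take (l.idxOf x) ++ [x] := by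
        rw [List.take_add_one, List.getElem?_eq_getElem hi]
        simp
      rw [hsplit] at hG
      rw [hd, ht] at hG ⊢
      rw [List.isChain_append] at hG ⊢
      refine ⟨hG.1, ?_, ?_⟩
      · rw [List.isChain_cons_cons]
        exact ⟨hry, hG.2.1⟩
      · simpa using hxr
  have hur : u ≠ r := by rintro rfl; exact hr hu.1
  have hadj : ∀ G : SimpleGraph V, (G ⊔ SimpleGraph.edge u r).Adj u r := fun G =>
    Or.inr (edge_adj_self hur)
  have hmono : ∀ G : SimpleGraph V, l.IsChain G.Adj →
      l.IsChain (G ⊔ SimpleGraph.edge u r).Adj := fun G h => h.imp fun _ _ h => Or.inl h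
  rcases hu.2 with h | h
  · obtain ⟨l', h1, h2⟩ := key p u hp hu.1 h
    exact ⟨l', h1, fun G hG hpr => h2 _ (hmono G hG) (Or.inl hpr) (hadj G).symm⟩
  · obtain ⟨l', h1, h2⟩ := key u p hu.1 hp h.symm
    exact ⟨l', h1, fun G hG hpr => h2 _ (hmono G hG) (hadj G) (Or.inl hpr.symm)⟩

/-- A vertex outside the path can be appended to it. -/
theorem exists_append {l : List V} (hl : l.Nodup) {u : V} (hu : u ∉ l) :
    ∃ l' v, IsExtension l l' u ∧ ∀ G : SimpleGraph V, l.IsChain G.Adj →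
      l'.IsChain (G ⊔ SimpleGraph.edge u v).Adj := by
  have hext := isExtension_append_cons (a := l) (b := []) (r := u) (by simpa) (by simpa)
  rw [List.append_nil] at hext
  rcases List.eq_nil_or_concat l with rfl | ⟨a, x, rfl⟩
  · exact ⟨[u], u, hext, fun G _ => List.isChain_singleton u⟩
  · refine ⟨_, x, hext, fun G hG => ?_⟩
    rw [List.isChain_append]
    refine ⟨hG.imp fun _ _ h => Or.inl h, List.isChain_singleton u, ?_⟩
    have : u ≠ x := by rintro rfl; simp at hu
    simpa using Or.inr (edge_adj_self this).symm

end Paths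

end SemiRandom
namespace SemiRandom

set_option linter.unusedSectionVars false

/-! ## From an almost spanning path to a Hamiltonian cycle -/

section Cleanup

variable {V : Type*} [DecidableEq V] [Fintype V]

theorem isHamiltonian_of_isChain {G : SimpleGraph V} {l : List V} (hne : l ≠ []) (hl : l.Nodup)
    (hc : l.IsChain G.Adj) (hcard : l.length = Fintype.card V) (h3 : 3 ≤ Fintype.card V)
    (hadj : G.Adj (l.getLast hne) (l.head hne)) : G.IsHamiltonian := by
  intro _
  let q := SimpleGraph.Walk.ofSupport l hne hc
  have hqs : q.support = l := SimpleGraph.Walk.support_ofSupport hne hc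
  have hql : q.length + 1 = l.length := by
    have := q.length_support
    rw [hqs] at this
    exact this.symm
  have hq : q.IsPath := by rw [SimpleGraph.Walk.isPath_def, hqs]; exact hl
  refine ⟨_, SimpleGraph.Walk.cons hadj q, ?_⟩
  rw [SimpleGraph.Walk.isHamiltonianCycle_iff_isCycle_and_length_eq,
    SimpleGraph.Walk.isCycle_iff_isPath_tail_and_le_length, SimpleGraph.Walk.length_cons]
  refine ⟨⟨?_, by lia⟩, by lia⟩
  simpa using hq

/-- There is a path that misses exactly `k` vertices. -/
def HasPath (k : ℕ) (G : SimpleGraph V) : Prop :=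
  ∃ l : List V, l.Nodup ∧ l.IsChain G.Adj ∧ l.length + k = Fintype.card V

theorem isChain_mono {G H : SimpleGraph V} (h : G ≤ H) {l : List V} (hl : l.IsChain G.Adj) :
    l.IsChain H.Adj := hl.imp fun _ _ hab => h hab

theorem isHamiltonian_mono : IsIncreasing (fun G : SimpleGraph V => G.IsHamiltonian) :=
  fun _ _ h hG => hG.mono h

/-- A spanning path whose first vertex is joined to (at least) `j` further vertices. -/
def Chorded (j : ℕ) (G : SimpleGraph V) : Prop :=
  ∃ (a : V) (l : List V) (J : Finset V), (a :: l).Nodup ∧ (a :: l).IsChain G.Adj ∧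
    (a :: l).length = Fintype.card V ∧ J.card = j ∧ a ∉ J ∧ ∀ v ∈ J, G.Adj a v

theorem chorded_mono (j : ℕ) : IsIncreasing (Chorded (V := V) j) :=
  fun _ _ h ⟨a, l, J, h1, h2, h3, h4, h5, h6⟩ =>
    ⟨a, l, J, h1, isChain_mono h h2, h3, h4, h5, fun v hv => h (h6 v hv)⟩

theorem mem_of_length_eq_card {l : List V} (hl : l.Nodup) (h : l.length = Fintype.card V) (v : V) :
    v ∈ l := by
  rw [← List.toFinset_card_of_nodup hl, Finset.card_eq_iff_eq_univ] at h
  rw [← List.mem_toFinset, h]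
  exact Finset.mem_univ v

variable [Nonempty V]

theorem hitBound_chorded {m : ℕ} (hm : 1 ≤ m) (h3 : 3 ≤ Fintype.card V) :
    HitBound (fun G : SimpleGraph V => G.IsHamiltonian) (Chorded m)
      ((Fintype.card V : ℝ) / m) := by
  have hm' : (0 : ℝ) < m := by exact_mod_cast hm
  have hn := card_pos_real (V := V)
  have := (hitBound_self (isHamiltonian_mono (V := V))).progress (S := Chorded m)
    (p := m / Fintype.card V) (chorded_mono m) (by positivity) le_rfl ?_
  · simpa using this
  rintro G ⟨a, l, J, hl, hc, hlen, rfl, ha, hJ⟩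
  have hsplit : ∀ v ∈ J, ∃ (s : List V) (x : V) (t : List V), a :: l = s ++ x :: v :: t := by
    intro v hv
    obtain ⟨s, t, hst⟩ := List.append_of_mem (mem_of_length_eq_card hl hlen v)
    rcases List.eq_nil_or_concat s with rfl | ⟨s, x, rfl⟩
    · simp only [List.nil_append, List.cons.injEq] at hst
      exact absurd (hst.1 ▸ hv) ha
    · exact ⟨s, x, t, by simpa using hst⟩
  choose! s x t hst using hsplit
  have hne : a :: l ≠ [] := List.cons_ne_nil _ _
  have hidx : ∀ v ∈ J, (a :: l).idxOf v = (a :: l).idxOf (x v) + 1 := by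
    intro v hv
    have h := hl
    rw [hst v hv] at h ⊢
    simp only [List.nodup_append, List.nodup_cons, List.mem_cons, not_or] at h
    rw [List.idxOf_append_of_notMem (fun h' => h.2.2 v h' v (by simp) rfl),
      List.idxOf_append_of_notMem (fun h' => h.2.2 _ h' _ (by simp) rfl)]
    rw [List.idxOf_cons_ne _ h.2.1.1.1]
    simp
  refine ⟨J.image x, fun _ => (a :: l).getLast hne, ?_, ?_⟩
  · rw [div_mul_cancel₀ _ hn.ne', Finset.card_image_of_injOn]
    intro v hv w hw hvw
    have h1 := hidx v hv
    have h2 := hidx w hw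
    rw [hvw, ← h2] at h1
    exact (List.idxOf_inj (mem_of_length_eq_card hl hlen v)).1 h1
  · intro u hu
    obtain ⟨v, hv, rfl⟩ := Finset.mem_image.1 hu
    have h := hst v hv
    obtain ⟨t', b, ht⟩ : ∃ t' b, v :: t v = t' ++ [b] := by
      rcases List.eq_nil_or_concat (v :: t v) with h' | ⟨t', b, h'⟩
      · simp at h'
      · exact ⟨t', b, by simpa using h'⟩
    have hlast : (a :: l).getLast hne = b := by
      have : a :: l = (s v ++ [x v] ++ t') ++ [b] := by rw [h, ht]; simp
      simp [this]
    have hxb : x v ≠ b := by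
      have h' := hl
      rw [h, ht] at h'
      simp only [List.nodup_append, List.nodup_cons, List.mem_cons] at h'
      rintro rfl
      exact h'.2.1.1 (by simp)
    rw [hlast]
    have hc' := hc
    rw [h, List.isChain_append, List.isChain_cons] at hc'
    have hperm : (a :: l).Perm (s v ++ x v :: (v :: t v).reverse) := by
      rw [h]
      exact ((List.reverse_perm _).symm.cons _).append_left _
    have hne' : s v ++ x v :: (v :: t v).reverse ≠ [] := by simp
    refine isHamiltonian_of_isChain hne' (hperm.nodup_iff.1 hl) ?_
      (by rw [← hperm.length_eq, hlen]) h3 ?_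
    · rw [List.isChain_append, List.isChain_cons]
      refine ⟨isChain_mono le_sup_left hc'.1, ⟨?_, ?_⟩, ?_⟩
      · rw [ht]
        simpa using Or.inr (edge_adj_self hxb)
      · rw [List.isChain_reverse]
        exact hc'.2.1.2.imp fun _ _ hab => Or.inl hab.symm
      · intro y hy z hz
        exact Or.inl (hc'.2.2 y hy z (by simpa using hz))
    · have h1 : (s v ++ x v :: (v :: t v).reverse).getLast hne' = v := by simp
      have h2 : (s v ++ x v :: (v :: t v).reverse).head hne' = a := by
        have h' : (s v ++ x v :: (v :: t v).reverse).head? = (a :: l).head? := by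
          rw [h]; cases s v <;> simp
        rw [List.head_eq_iff_head?_eq_some, h', List.head?_cons]
      rw [h1, h2]
      exact Or.inl (hJ v hv).symm

theorem hitBound_chorded_sub {m : ℕ} (hm : 1 ≤ m) (h3 : 3 ≤ Fintype.card V)
    (h2 : 2 * m + 2 ≤ Fintype.card V) (i : ℕ) (hi : i ≤ m) :
    HitBound (fun G : SimpleGraph V => G.IsHamiltonian) (Chorded (m - i))
      ((Fintype.card V : ℝ) / m + 2 * i) := by
  induction i with
  | zero => simpa using hitBound_chorded hm h3
  | succ i ih =>
    have h := (ih (by lia)).progress (S := Chorded (m - (i + 1))) (p := 1 / 2) (chorded_mono _)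
      (by norm_num) (by positivity) ?_
    · refine h.mono (fun _ h => h) (le_of_eq ?_)
      push_cast; ring
    rintro G ⟨a, l, J, hl, hc, hlen, hJc, ha, hJ⟩
    refine ⟨(insert a J)ᶜ, fun _ => a, ?_, fun u hu => ?_⟩
    · rw [Finset.card_compl, Finset.card_insert_of_notMem ha, hJc]
      rw [div_mul_eq_mul_div, one_mul, div_le_iff₀ two_pos]
      have : Fintype.card V ≤ (Fintype.card V - (m - (i + 1) + 1)) * 2 := by lia
      exact_mod_cast this
    · simp only [Finset.mem_compl, Finset.mem_insert, not_or] at hu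
      refine ⟨a, l, insert u J, hl, isChain_mono le_sup_left hc, hlen, ?_, ?_, ?_⟩
      · rw [Finset.card_insert_of_notMem hu.2, hJc]; lia
      · simpa [ha] using Ne.symm hu.1
      · intro v hv
        rcases Finset.mem_insert.1 hv with rfl | hv
        · exact Or.inr (edge_adj_self hu.1).symm
        · exact Or.inl (hJ v hv)

theorem hitBound_hasPath_zero {m : ℕ} (hm : 1 ≤ m) (h3 : 3 ≤ Fintype.card V)
    (h2 : 2 * m + 2 ≤ Fintype.card V) :
    HitBound (fun G : SimpleGraph V => G.IsHamiltonian) (HasPath 0)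
      ((Fintype.card V : ℝ) / m + 2 * m) := by
  refine (hitBound_chorded_sub hm h3 h2 m le_rfl).mono ?_ le_rfl
  rintro G ⟨l, hl, hc, hlen⟩
  rcases l with _ | ⟨a, l⟩
  · simp at hlen; lia
  · exact ⟨a, l, ∅, hl, hc, by simpa using hlen, by simp, by simp, by simp⟩

/-- A path that misses exactly `k` vertices, with spaced marked vertices `R`, each joined to a
vertex outside the path. -/
def MarkedPath (G : SimpleGraph V) (k : ℕ) (l : List V) (R : Finset V) (α : V → V) : Prop :=
  l.Nodup ∧ l.IsChain G.Adj ∧ l.length + k = Fintype.card V ∧ Spaced l R ∧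
    ∀ p ∈ R, α p ∉ l ∧ G.Adj p (α p)

theorem MarkedPath.mono {G H : SimpleGraph V} (h : G ≤ H) {k : ℕ} {l : List V} {R : Finset V}
    {α : V → V} (hm : MarkedPath G k l R α) : MarkedPath H k l R α :=
  ⟨hm.1, isChain_mono h hm.2.1, hm.2.2.1, hm.2.2.2.1, fun p hp =>
    ⟨(hm.2.2.2.2 p hp).1, h (hm.2.2.2.2 p hp).2⟩⟩

/-- There are `j` marked vertices, at most `d` for each vertex outside the path. -/
def Seeded (k d j : ℕ) (G : SimpleGraph V) : Prop :=
  ∃ l R α, MarkedPath G k l R α ∧ R.card = j ∧ ∀ r ∉ l, (R.filter (α · = r)).card ≤ d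

/-- There are at least `d` marked vertices for each vertex outside the path. -/
def Loaded (d k : ℕ) (G : SimpleGraph V) : Prop :=
  ∃ l R α, MarkedPath G k l R α ∧ ∀ r ∉ l, d ≤ (R.filter (α · = r)).card

theorem seeded_mono (k d j : ℕ) : IsIncreasing (Seeded (V := V) k d j) :=
  fun _ _ h ⟨l, R, α, h1, h2⟩ => ⟨l, R, α, h1.mono h, h2⟩

theorem loaded_mono (d k : ℕ) : IsIncreasing (Loaded (V := V) d k) :=
  fun _ _ h ⟨l, R, α, h1, h2⟩ => ⟨l, R, α, h1.mono h, h2⟩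

theorem card_compl_toFinset {l : List V} (hl : l.Nodup) {k : ℕ}
    (h : l.length + k = Fintype.card V) : (l.toFinsetᶜ).card = k := by
  rw [Finset.card_compl, List.toFinset_card_of_nodup hl]; lia

theorem MarkedPath.card_eq_sum {G : SimpleGraph V} {k : ℕ} {l : List V} {R : Finset V}
    {α : V → V} (hm : MarkedPath G k l R α) :
    R.card = ∑ r ∈ l.toFinsetᶜ, (R.filter (α · = r)).card :=
  Finset.card_eq_sum_card_fiberwise fun p hp => by simpa using (hm.2.2.2.2 p hp).1

theorem Seeded.loaded {k d : ℕ} {G : SimpleGraph V} (h : Seeded k d (k * d) G) :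
    Loaded d k G := by
  obtain ⟨l, R, α, hm, hR, hd⟩ := h
  refine ⟨l, R, α, hm, fun r hr => ?_⟩
  by_contra! hlt
  have h1 : R.card < ∑ r ∈ l.toFinsetᶜ, d := by
    rw [hm.card_eq_sum]
    exact Finset.sum_lt_sum (fun r hr => hd r (by simpa using hr)) ⟨r, by simpa using hr, hlt⟩
  rw [Finset.sum_const, card_compl_toFinset hm.1 hm.2.2.1, hR, smul_eq_mul] at h1
  exact lt_irrefl _ h1

theorem hitBound_seeded {P : SimpleGraph V → Prop} {k d : ℕ} {c : ℝ} (hc : 0 ≤ c)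
    (h : HitBound P (Loaded d k) c) (hk : 2 * k + 10 * (k * d) + 4 ≤ Fintype.card V) (i : ℕ)
    (hi : i ≤ k * d) : HitBound P (Seeded k d (k * d - i)) (c + 2 * i) := by
  induction i with
  | zero => exact h.mono (fun G hG => hG.loaded) (by simp)
  | succ i ih =>
    have h := (ih (by lia)).progress (S := Seeded k d (k * d - (i + 1))) (p := 1 / 2)
      (seeded_mono _ _ _) (by norm_num) (by positivity) ?_
    · refine h.mono (fun _ h => h) (le_of_eq ?_)
      push_cast; ring
    rintro G ⟨l, R, α, hm, hR, hd⟩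
    obtain ⟨hl, hch, hlen, hsp, hα⟩ := id hm
    obtain ⟨r, hr, hrd⟩ : ∃ r ∉ l, (R.filter (α · = r)).card < d := by
      by_contra! hcon
      have h1 : ∑ r ∈ l.toFinsetᶜ, d ≤ R.card := by
        rw [hm.card_eq_sum]
        exact Finset.sum_le_sum fun r hr => hcon r (by simpa using hr)
      rw [Finset.sum_const, card_compl_toFinset hl hlen, smul_eq_mul] at h1
      lia
    refine ⟨permissible l R, fun _ => r, ?_, fun u hu => ?_⟩
    · have := length_le_card_permissible hl R
      rw [div_mul_eq_mul_div, one_mul, div_le_iff₀ two_pos]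
      have : Fintype.card V ≤ (permissible l R).card * 2 := by lia
      exact_mod_cast this
    · have huR := not_mem_of_mem_permissible hu
      have hur : u ≠ r := by
        rintro rfl
        simp only [permissible, Finset.mem_filter, List.mem_toFinset] at hu
        exact hr hu.1
      have hne : ∀ p ∈ R, p ≠ u := fun p hp => by rintro rfl; exact huR hp
      refine ⟨l, insert u R, Function.update α u r,
        ⟨hl, isChain_mono le_sup_left hch, hlen, hsp.insert hu, ?_⟩, ?_, ?_⟩
      · intro p hp
        rcases Finset.mem_insert.1 hp with rfl | hp
        · rw [Function.update_self]; exact ⟨hr, Or.inr (edge_adj_self hur)⟩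
        · rw [Function.update_of_ne (hne p hp)]
          exact ⟨(hα p hp).1, Or.inl (hα p hp).2⟩
      · rw [Finset.card_insert_of_notMem huR, hR]; lia
      · intro r' hr'
        have hfil : R.filter (Function.update α u r · = r') = R.filter (α · = r') :=
          Finset.filter_congr fun p hp => by rw [Function.update_of_ne (hne p hp)]
        rw [Finset.filter_insert, hfil, Function.update_self]
        split_ifs with hrr
        · subst hrr
          exact (Finset.card_insert_le _ _).trans hrd
        · exact hd r' hr'

theorem MarkedPath.absorb {G : SimpleGraph V} {k : ℕ} {l : List V} {R : Finset V}
    {α : V → V} (hm : MarkedPath G (k + 1) l R α) {p u : V} (hp : p ∈ R)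
    (hu : u ∈ pathNbrs l p) : ∃ l', (∀ v, v ∈ l' ↔ v = α p ∨ v ∈ l) ∧
      MarkedPath (G ⊔ SimpleGraph.edge u (α p)) k l' (R.filter (α · ≠ α p)) α := by
  obtain ⟨hl, hch, hlen, hsp, hα⟩ := hm
  obtain ⟨l', hext, hl'⟩ := exists_insertion hl (hsp.mem hp) hu (hα p hp).1
  refine ⟨l', hext.mem_iff, hext.nodup, hl' G hch (hα p hp).2, ?_,
    (hext.spaced R hsp).subset (Finset.filter_subset _ _), fun q hq => ?_⟩
  · rw [hext.length]; lia
  · simp only [Finset.mem_filter] at hq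
    exact ⟨by rw [hext.mem_iff]; exact not_or.2 ⟨hq.2, (hα q hq.1).1⟩, Or.inl (hα q hq.1).2⟩

theorem hitBound_loaded_succ {P : SimpleGraph V → Prop} {k d : ℕ} {c : ℝ} (hc : 0 ≤ c)
    (hd : 1 ≤ d) (h : HitBound P (Loaded d k) c) :
    HitBound P (Loaded d (k + 1)) (c + Fintype.card V / (2 * (d * (k + 1)))) := by
  have hn := card_pos_real (V := V)
  have hd' : (0 : ℝ) < d := by exact_mod_cast hd
  have h := h.progress (S := Loaded d (k + 1)) (p := 2 * (d * (k + 1)) / Fintype.card V)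
    (loaded_mono _ _) (by positivity) hc ?_
  · rwa [one_div_div] at h
  rintro G ⟨l, R, α, hm, hload⟩
  have hsp := hm.2.2.2.1
  have hcard : (R.biUnion (pathNbrs l)).card = 2 * R.card := by
    rw [Finset.card_biUnion hsp.pairwiseDisjoint,
      Finset.sum_congr rfl fun p hp => card_pathNbrs hm.1 hsp hp]
    simp [mul_comm]
  have hR : d * (k + 1) ≤ R.card := by
    rw [hm.card_eq_sum]
    calc d * (k + 1) = ∑ r ∈ l.toFinsetᶜ, d := by
          rw [Finset.sum_const, card_compl_toFinset hm.1 hm.2.2.1, smul_eq_mul, mul_comm]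
      _ ≤ _ := Finset.sum_le_sum fun r hr => hload r (by simpa using hr)
  have hex : ∀ u ∈ R.biUnion (pathNbrs l), ∃ v, Loaded d k (G ⊔ SimpleGraph.edge u v) := by
    intro u hu
    obtain ⟨p, hp, hup⟩ := Finset.mem_biUnion.1 hu
    obtain ⟨l', hl', hm'⟩ := hm.absorb hp hup
    refine ⟨α p, l', _, α, hm', fun r hr => ?_⟩
    rw [hl', not_or] at hr
    refine (hload r hr.2).trans (Finset.card_le_card fun q hq => ?_)
    simp only [Finset.mem_filter] at hq ⊢
    exact ⟨⟨hq.1, by rw [hq.2]; exact hr.1⟩, hq.2⟩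
  choose! v hv using hex
  refine ⟨_, v, ?_, hv⟩
  rw [div_mul_cancel₀ _ hn.ne', hcard]
  have : 2 * (d * (k + 1)) ≤ 2 * R.card := by lia
  exact_mod_cast this

theorem hitBound_loaded_add {P : SimpleGraph V → Prop} {k d : ℕ} {c : ℝ} (hc : 0 ≤ c)
    (hd : 1 ≤ d) (h : HitBound P (HasPath k) c) (i : ℕ) :
    HitBound P (Loaded d (k + i)) (c + i * (Fintype.card V / (2 * (d * (k + 1))))) := by
  induction i with
  | zero =>
    refine h.mono ?_ (by simp)
    rintro G ⟨l, R, α, hm, -⟩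
    exact ⟨l, hm.1, hm.2.1, hm.2.2.1⟩
  | succ i ih =>
    have hd' : (0 : ℝ) < d := by exact_mod_cast hd
    refine (hitBound_loaded_succ (by positivity) hd ih).mono (fun _ h => h) ?_
    have : (Fintype.card V : ℝ) / (2 * (d * ((k + i : ℕ) + 1))) ≤
        Fintype.card V / (2 * (d * (k + 1))) := by
      gcongr; simp
    push_cast at this ⊢
    linarith

theorem hitBound_hasPath_halve {P : SimpleGraph V → Prop} {k d : ℕ} {c : ℝ} (hc : 0 ≤ c)
    (hd : 1 ≤ d) (hk : 2 * k + 10 * (k * d) + 4 ≤ Fintype.card V)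
    (h : HitBound P (HasPath (k / 2)) c) :
    HitBound P (HasPath k) (c + Fintype.card V / d + 2 * (k * d)) := by
  have hd' : (0 : ℝ) < d := by exact_mod_cast hd
  have h1 := hitBound_loaded_add hc hd h (k - k / 2)
  rw [Nat.add_sub_cancel' (Nat.div_le_self k 2)] at h1
  have h2 := hitBound_seeded (by positivity) h1 hk (k * d) le_rfl
  refine h2.mono ?_ ?_
  · rintro G ⟨l, hl, hch, hlen⟩
    exact ⟨l, ∅, id, ⟨hl, hch, hlen, spaced_empty l, by simp⟩, by simp, by simp⟩
  · have h3 : ((k - k / 2 : ℕ) : ℝ) * (Fintype.card V / (2 * (d * ((k / 2 : ℕ) + 1)))) ≤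
        Fintype.card V / d := by
      have h4 : ((k - k / 2 : ℕ) : ℝ) ≤ 2 * ((k / 2 : ℕ) + 1) := by
        have : k - k / 2 ≤ 2 * (k / 2 + 1) := by lia
        exact_mod_cast this
      have h5 : (0 : ℝ) < (k / 2 : ℕ) + 1 := by positivity
      rw [mul_div_assoc', div_le_div_iff₀ (by positivity) hd']
      nlinarith [mul_nonneg (mul_nonneg hd'.le (card_pos_real (V := V)).le) (sub_nonneg.2 h4)]
    push_cast
    linarith

theorem hitBound_hasPath (h3 : 400 ≤ Fintype.card V) (k : ℕ) (hk : 400 * k ≤ Fintype.card V) :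
    HitBound (fun G : SimpleGraph V => G.IsHamiltonian) (HasPath k)
      (6 * √(Fintype.card V) + 14 * √(k * Fintype.card V)) := by
  induction k using Nat.strong_induction_on with
  | _ k ih =>
  set n := Fintype.card V with hn
  rcases Nat.eq_zero_or_pos k with rfl | hk0
  · have hs1 : n.sqrt * n.sqrt ≤ n := Nat.sqrt_le n
    have hs2 : n < (n.sqrt + 1) * (n.sqrt + 1) := Nat.lt_succ_sqrt n
    have hs3 : 20 ≤ n.sqrt := Nat.le_sqrt.2 (by lia)
    refine (hitBound_hasPath_zero (m := n.sqrt) (by lia) (by lia) (by nlinarith)).mono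
      (fun _ h => h) ?_
    have e1 : (n.sqrt : ℝ) ≤ √n := Real.nat_sqrt_le_real_sqrt
    have e2 : √(n : ℝ) ≤ n.sqrt + 1 := Real.real_sqrt_le_nat_sqrt_succ
    have e3 : (20 : ℝ) ≤ n.sqrt := by exact_mod_cast hs3
    have e4 : √(n : ℝ) * √n = n := Real.mul_self_sqrt (Nat.cast_nonneg _)
    have : (n : ℝ) / n.sqrt ≤ 2 * √n := by
      rw [div_le_iff₀ (by linarith)]
      nlinarith
    rw [← hn]
    simp only [Nat.cast_zero, zero_mul, Real.sqrt_zero]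
    nlinarith
  · have hq : 400 ≤ n / k := (Nat.le_div_iff_mul_le hk0).2 hk
    have hs1 : (n / k).sqrt * (n / k).sqrt ≤ n / k := Nat.sqrt_le _
    have hs2 : n / k < ((n / k).sqrt + 1) * ((n / k).sqrt + 1) := Nat.lt_succ_sqrt _
    have hs3 : 20 ≤ (n / k).sqrt := Nat.le_sqrt.2 (by lia)
    set d := (n / k).sqrt with hd
    have hkq : k * (n / k) ≤ n := Nat.mul_div_le n k
    have hkd : k * d * 20 ≤ n := by
      calc k * d * 20 ≤ k * d * d := by gcongr
        _ = k * (d * d) := by ring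
        _ ≤ k * (n / k) := by gcongr
        _ ≤ n := hkq
    have h := hitBound_hasPath_halve (d := d) (k := k) (by positivity) (by lia) (by lia)
      (ih (k / 2) (by lia) (by lia))
    refine h.mono (fun _ h => h) ?_
    rw [← hn]
    have hkR : (0 : ℝ) < k := by exact_mod_cast hk0
    have hdR : (20 : ℝ) ≤ d := by exact_mod_cast hs3
    have hsk : √((k : ℝ) * n) = √k * √n := Real.sqrt_mul hkR.le _
    have e1 : √(k : ℝ) * √k = k := Real.mul_self_sqrt hkR.le
    have e2 : √(n : ℝ) * √n = n := Real.mul_self_sqrt (Nat.cast_nonneg _)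
    have hk1 : (0 : ℝ) < √k := Real.sqrt_pos.2 hkR
    have hn1 : (0 : ℝ) ≤ √n := Real.sqrt_nonneg _
    have hdk : (d : ℝ) * √k ≤ √n := by
      refine Real.le_sqrt_of_sq_le ?_
      have : ((k * (d * d) : ℕ) : ℝ) ≤ n := by
        exact_mod_cast (Nat.mul_le_mul_left k hs1).trans hkq
      push_cast at this
      nlinarith
    have hdk2 : √n ≤ 2 * (d * √k) := by
      refine Real.sqrt_le_iff.2 ⟨by positivity, ?_⟩
      have h1 : n < k * (n / k + 1) := by
        have := Nat.lt_mul_div_succ n hk0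
        exact this
      have h2 : (n / k + 1) ≤ 4 * (d * d) := by nlinarith
      have : (n : ℝ) ≤ k * (4 * (d * d)) := by
        exact_mod_cast h1.le.trans (Nat.mul_le_mul_left k h2)
      nlinarith
    have t1 : (n : ℝ) / d ≤ 2 * √(k * n) := by
      rw [div_le_iff₀ (by linarith), hsk]
      nlinarith [mul_le_mul_of_nonneg_right hdk2 hn1]
    have t2 : (k : ℝ) * d ≤ √(k * n) := by
      rw [hsk]
      nlinarith [mul_le_mul_of_nonneg_left hdk hk1.le]
    have t3 : √(((k / 2 : ℕ) : ℝ) * n) ≤ 5 / 7 * √(k * n) := by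
      refine Real.sqrt_le_iff.2 ⟨by positivity, ?_⟩
      rw [mul_pow, Real.sq_sqrt (by positivity)]
      have : ((k / 2 : ℕ) : ℝ) ≤ k / 2 := Nat.cast_div_le
      nlinarith [mul_nonneg hkR.le (Nat.cast_nonneg (α := ℝ) n), mul_le_mul_of_nonneg_right this (Nat.cast_nonneg (α := ℝ) n)]
    linarith

end Cleanup

end SemiRandom
namespace SemiRandom

set_option linter.unusedSectionVars false

/-! ## Products of finite sets -/

section PiSums

variable {ι : Type*} [Fintype ι] [DecidableEq ι] {W : Type*} [DecidableEq W]

theorem mem_piFinset_update {T : ι → Finset W} {i : ι} {F : Finset W} {φ : ι → W} :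
    φ ∈ Fintype.piFinset (Function.update T i F) ↔ φ i ∈ F ∧ ∀ j ≠ i, φ j ∈ T j := by
  rw [Fintype.mem_piFinset]
  constructor
  · intro h
    refine ⟨by simpa using h i, fun j hj => by simpa [hj] using h j⟩
  · rintro ⟨h1, h2⟩ j
    by_cases hj : j = i
    · subst hj; simpa using h1
    · simpa [hj] using h2 j hj

theorem sum_piFinset_update (T : ι → Finset W) (i : ι) (F : Finset W) (H : (ι → W) → ℝ) :
    ∑ φ ∈ Fintype.piFinset (Function.update T i F), H φ =
      ∑ r ∈ F, ∑ φ ∈ Fintype.piFinset (Function.update T i {r}), H φ := by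
  rw [← Finset.sum_fiberwise_of_maps_to (t := F) (g := fun φ => φ i)
    (fun φ hφ => (mem_piFinset_update.1 hφ).1)]
  refine Finset.sum_congr rfl fun r hr => Finset.sum_congr ?_ fun _ _ => rfl
  ext φ
  simp only [Finset.mem_filter, mem_piFinset_update, Finset.mem_singleton]
  constructor
  · rintro ⟨⟨-, h⟩, h'⟩; exact ⟨h', h⟩
  · rintro ⟨rfl, h⟩; exact ⟨⟨hr, h⟩, rfl⟩

theorem sum_piFinset_split (T : ι → Finset W) (i : ι) (H : (ι → W) → ℝ) :
    ∑ φ ∈ Fintype.piFinset T, H φ =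
      ∑ r ∈ T i, ∑ φ ∈ Fintype.piFinset (Function.update T i {r}), H φ := by
  rw [← sum_piFinset_update, Function.update_eq_self]

theorem card_piFinset_update (T : ι → Finset W) (i : ι) (F : Finset W) :
    (T i).card * (Fintype.piFinset (Function.update T i F)).card =
      F.card * (Fintype.piFinset T).card := by
  simp only [Fintype.card_piFinset]
  rw [← Finset.mul_prod_erase _ _ (Finset.mem_univ i),
    ← Finset.mul_prod_erase (f := fun j => (T j).card) _ (Finset.mem_univ i)]
  rw [Function.update_self, Finset.prod_congr rfl (g := fun j => (T j).card)]
  · ring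
  · intro j hj
    rw [Function.update_of_ne (Finset.ne_of_mem_erase hj)]

theorem sum_piFinset_update_singleton {T : ι → Finset W} {i : ι} (hT : (T i).card = 1) (v : W)
    (H : (ι → W) → ℝ) :
    ∑ φ ∈ Fintype.piFinset (Function.update T i {v}), H φ =
      ∑ φ ∈ Fintype.piFinset T, H (Function.update φ i v) := by
  obtain ⟨d, hd⟩ := Finset.card_eq_one.1 hT
  refine Finset.sum_nbij' (fun φ => Function.update φ i d) (fun φ => Function.update φ i v)
    ?_ ?_ ?_ ?_ ?_
  · intro φ hφ
    rw [mem_piFinset_update] at hφ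
    refine Fintype.mem_piFinset.2 fun j => ?_
    by_cases hj : j = i
    · subst hj; simp [hd]
    · simpa [hj] using hφ.2 j hj
  · intro φ hφ
    rw [mem_piFinset_update]
    exact ⟨by simp, fun j hj => by simpa [hj] using Fintype.mem_piFinset.1 hφ j⟩
  · intro φ hφ
    rw [mem_piFinset_update, Finset.mem_singleton] at hφ
    simp [← hφ.1]
  · intro φ hφ
    have := Fintype.mem_piFinset.1 hφ i
    rw [hd, Finset.mem_singleton] at this
    simp [← this]
  · intro φ hφ
    rw [mem_piFinset_update, Finset.mem_singleton] at hφ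
    simp [← hφ.1]

end PiSums

/-! ## The path-building strategy -/

section States

variable {V : Type*} [DecidableEq V]

/-- The vertices of which exactly one slot is in use. -/
def ones (A : Finset (V × Bool)) : Finset V :=
  (A.image Prod.fst).filter fun p => ¬((p, false) ∈ A ∧ (p, true) ∈ A)

/-- The vertices of which both slots are in use. -/
def twos (A : Finset (V × Bool)) : Finset V :=
  (A.image Prod.fst).filter fun p => (p, false) ∈ A ∧ (p, true) ∈ A

theorem mem_image_fst {A : Finset (V × Bool)} {p : V} :
    p ∈ A.image Prod.fst ↔ (p, false) ∈ A ∨ (p, true) ∈ A := by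
  simp

theorem mem_ones {A : Finset (V × Bool)} {p : V} : p ∈ ones A ↔
    ((p, false) ∈ A ∧ (p, true) ∉ A) ∨ ((p, false) ∉ A ∧ (p, true) ∈ A) := by
  rw [ones, Finset.mem_filter, mem_image_fst]; tauto

theorem mem_twos {A : Finset (V × Bool)} {p : V} :
    p ∈ twos A ↔ (p, false) ∈ A ∧ (p, true) ∈ A := by
  rw [twos, Finset.mem_filter, mem_image_fst]; tauto

theorem disjoint_ones_twos (A : Finset (V × Bool)) : Disjoint (ones A) (twos A) :=
  (Finset.disjoint_filter_filter_not _ _ _).symm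

theorem ones_union_twos (A : Finset (V × Bool)) : ones A ∪ twos A = A.image Prod.fst := by
  rw [Finset.union_comm]; exact Finset.filter_union_filter_not_eq _ _

theorem card_ones_add_card_twos (A : Finset (V × Bool)) :
    (ones A).card + (twos A).card = (A.image Prod.fst).card := by
  rw [← Finset.card_union_of_disjoint (disjoint_ones_twos A), ones_union_twos]

/-- A slot of `p` that is in use. -/
def slot (A : Finset (V × Bool)) (p : V) : V × Bool := (p, decide ((p, false) ∉ A))

theorem slot_mem {A : Finset (V × Bool)} {p : V} (hp : p ∈ A.image Prod.fst) : slot A p ∈ A := by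
  rw [mem_image_fst] at hp
  by_cases h : (p, false) ∈ A
  · simp [slot, h]
  · simpa [slot, h] using hp

theorem ones_insert_new {A : Finset (V × Bool)} {u : V} (hu : u ∉ A.image Prod.fst) :
    ones (insert (u, false) A) = insert u (ones A) := by
  ext p
  rw [mem_image_fst] at hu
  simp only [mem_ones, Finset.mem_insert, Prod.mk.injEq]
  by_cases h : p = u
  · subst h; simp; tauto
  · simp [h]

theorem twos_insert_new {A : Finset (V × Bool)} {u : V} (hu : u ∉ A.image Prod.fst) :
    twos (insert (u, false) A) = twos A := by
  ext p
  rw [mem_image_fst] at hu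
  simp only [mem_twos, Finset.mem_insert, Prod.mk.injEq]
  by_cases h : p = u
  · subst h; simp; tauto
  · simp [h]

/-- The slot of `u` other than `slot A u`. -/
def otherSlot (A : Finset (V × Bool)) (u : V) : V × Bool := (u, decide ((u, false) ∈ A))

theorem otherSlot_notMem {A : Finset (V × Bool)} {u : V} (hu : u ∈ ones A) :
    otherSlot A u ∉ A := by
  rw [mem_ones] at hu
  rcases hu with ⟨h1, h2⟩ | ⟨h1, h2⟩ <;> simp [otherSlot, h1, h2]

theorem ones_insert_other {A : Finset (V × Bool)} {u : V} (hu : u ∈ ones A) :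
    ones (insert (otherSlot A u) A) = (ones A).erase u := by
  ext p
  rw [mem_ones] at hu
  simp only [mem_ones, Finset.mem_insert, Finset.mem_erase, otherSlot, Prod.mk.injEq]
  by_cases h : p = u
  · subst h; rcases hu with ⟨h1, h2⟩ | ⟨h1, h2⟩ <;> simp [h1, h2]
  · simp [h]

theorem twos_insert_other {A : Finset (V × Bool)} {u : V} (hu : u ∈ ones A) :
    twos (insert (otherSlot A u) A) = insert u (twos A) := by
  ext p
  rw [mem_ones] at hu
  simp only [mem_twos, Finset.mem_insert, otherSlot, Prod.mk.injEq]
  by_cases h : p = u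
  · subst h; rcases hu with ⟨h1, h2⟩ | ⟨h1, h2⟩ <;> simp [h1, h2]
  · simp [h]

theorem image_fst_insert_other {A : Finset (V × Bool)} {u : V} (hu : u ∈ ones A) :
    (insert (otherSlot A u) A).image Prod.fst = A.image Prod.fst := by
  rw [Finset.image_insert, Finset.insert_eq_of_mem]
  exact (Finset.mem_filter.1 hu).1

open Classical in
/-- A set of permissible vertices whose size depends only on the length of the path and the
number of marked vertices. -/
noncomputable def freshSet (l : List V) (R : Finset V) : Finset V :=
  if h : l.length - (5 * R.card + 2) ≤ (permissible l R).card then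
    (Finset.exists_subset_card_eq h).choose else ∅

theorem freshSet_spec {l : List V} (hl : l.Nodup) (R : Finset V) :
    freshSet l R ⊆ permissible l R ∧ (freshSet l R).card = l.length - (5 * R.card + 2) := by
  have h : l.length - (5 * R.card + 2) ≤ (permissible l R).card := by
    have := length_le_card_permissible hl R
    lia
  rw [freshSet, dif_pos h]
  exact (Finset.exists_subset_card_eq h).choose_spec

variable [Fintype V]

/-- A state of the path-building strategy: `l` is the path and `A` the set of slots in use. The
far ends of the slots in use are independent and uniform on the vertices outside the path;
`T` is the set of possible far ends. -/
structure IsState (l : List V) (A : Finset (V × Bool)) (T : V × Bool → Finset V) : Prop where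
  nodup : l.Nodup
  spaced : Spaced l (A.image Prod.fst)
  active : ∀ s ∈ A, T s = l.toFinsetᶜ
  inactive : ∀ s ∉ A, (T s).card = 1
  card_le : 5 * (A.image Prod.fst).card ≤ l.length + 2

/-- The graph `G` contains the path `l` and the edges from the slots in `A` to their far ends. -/
def Realizes (G : SimpleGraph V) (l : List V) (A : Finset (V × Bool)) (φ : V × Bool → V) : Prop :=
  l.IsChain G.Adj ∧ ∀ s ∈ A, G.Adj s.1 (φ s)

theorem Realizes.mono {G H : SimpleGraph V} (h : G ≤ H) {l : List V} {A : Finset (V × Bool)}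
    {φ : V × Bool → V} (hG : Realizes G l A φ) : Realizes H l A φ :=
  ⟨isChain_mono h hG.1, fun s hs => h (hG.2 s hs)⟩

/-- From every state, the average over the far ends of the failure probability is bounded in terms
of the length of the path and the numbers of vertices with one and with two slots in use. -/
def AvgBound (P : SimpleGraph V → Prop) (t : ℕ) (g : ℕ → ℕ → ℕ → ℝ) : Prop :=
  ∀ l A T (𝒢 : (V × Bool → V) → SimpleGraph V), IsState l A T →
    (∀ φ ∈ Fintype.piFinset T, Realizes (𝒢 φ) l A φ) →
    ∑ φ ∈ Fintype.piFinset T, failProb P t (𝒢 φ) ≤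
      (Fintype.piFinset T).card * g l.length (ones A).card (twos A).card

variable {P : SimpleGraph V → Prop} {t : ℕ} {g : ℕ → ℕ → ℕ → ℝ}

/-- The value of `g` after the vertex `r` has been added to the path. -/
def afterAbsorb (g : ℕ → ℕ → ℕ → ℝ) (l : List V) (A : Finset (V × Bool)) (r : V)
    (φ : V × Bool → V) : ℝ :=
  g (l.length + 1) (ones (A.filter (φ · ≠ r))).card (twos (A.filter (φ · ≠ r))).card

theorem AvgBound.absorb (h : AvgBound P t g) {l l' : List V} {A : Finset (V × Bool)}
    {T : V × Bool → Finset V} {r : V} (hsp : Spaced l (A.image Prod.fst))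
    (hin : ∀ s ∉ A, (T s).card = 1) (hcard : 5 * (A.image Prod.fst).card ≤ l.length + 2)
    (hr : r ∉ l) (hT : ∀ s ∈ A, T s = l.toFinsetᶜ ∨ T s = {r}) (hext : IsExtension l l' r)
    (𝒢 : (V × Bool → V) → SimpleGraph V)
    (h𝒢 : ∀ φ ∈ Fintype.piFinset T, Realizes (𝒢 φ) l' (A.filter (φ · ≠ r)) φ) :
    ∑ φ ∈ Fintype.piFinset T, failProb P t (𝒢 φ) ≤
      ∑ φ ∈ Fintype.piFinset T, afterAbsorb g l A r φ := by
  have hmaps : ∀ φ ∈ Fintype.piFinset T, A.filter (φ · ≠ r) ∈ A.powerset := by simp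
  rw [← Finset.sum_fiberwise_of_maps_to hmaps, ← Finset.sum_fiberwise_of_maps_to hmaps]
  refine Finset.sum_le_sum fun B hB => ?_
  rw [Finset.mem_powerset] at hB
  rcases Finset.eq_empty_or_nonempty
    ((Fintype.piFinset T).filter fun φ => A.filter (φ · ≠ r) = B) with he | ⟨ψ, hψ⟩
  · rw [he]; simp
  rw [Finset.mem_filter, Fintype.mem_piFinset] at hψ
  have hU : ∀ v, v ∈ l'.toFinsetᶜ ↔ v ∈ l.toFinsetᶜ ∧ v ≠ r := by
    intro v; simp [hext.mem_iff]; tauto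
  have hTB : ∀ s ∈ B, T s = l.toFinsetᶜ := by
    intro s hs
    refine (hT s (hB hs)).resolve_right fun hs' => ?_
    rw [← hψ.2, Finset.mem_filter] at hs
    have := hψ.1 s
    rw [hs', Finset.mem_singleton] at this
    exact hs.2 this
  let TB : V × Bool → Finset V := fun s =>
    if s ∈ B then l'.toFinsetᶜ else if s ∈ A then {r} else T s
  have hfib : (Fintype.piFinset T).filter (fun φ => A.filter (φ · ≠ r) = B) =
      Fintype.piFinset TB := by
    ext φ
    simp only [Finset.mem_filter, Fintype.mem_piFinset, TB]
    constructor
    · rintro ⟨h1, hφB⟩ s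
      have hsB : s ∈ B ↔ s ∈ A ∧ φ s ≠ r := by rw [← hφB, Finset.mem_filter]
      by_cases hs : s ∈ A <;> by_cases hs' : φ s = r
      · simp [hsB, hs, hs']
      · rw [if_pos (hsB.2 ⟨hs, hs'⟩), hU]
        exact ⟨hTB s (hsB.2 ⟨hs, hs'⟩) ▸ h1 s, hs'⟩
      · simpa [hsB, hs] using h1 s
      · simpa [hsB, hs] using h1 s
    · intro hφ
      refine ⟨fun s => ?_, ?_⟩
      · have := hφ s
        by_cases hsB : s ∈ B
        · rw [if_pos hsB, hU] at this
          rw [hTB s hsB]; exact this.1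
        · rw [if_neg hsB] at this
          by_cases hsA : s ∈ A
          · rw [if_pos hsA, Finset.mem_singleton] at this
            rw [this]
            rcases hT s hsA with h' | h' <;> rw [h']
            · simpa using hr
            · simp
          · rwa [if_neg hsA] at this
      · ext s
        rw [Finset.mem_filter]
        have := hφ s
        constructor
        · rintro ⟨hsA, hsr⟩
          by_contra hsB
          rw [if_neg hsB, if_pos hsA, Finset.mem_singleton] at this
          exact hsr this
        · intro hsB
          rw [if_pos hsB, hU] at this
          exact ⟨hB hsB, this.2⟩
  have hB' := Finset.image_subset_image (f := Prod.fst) hB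
  have hst : IsState l' B TB := by
    refine ⟨hext.nodup, (hext.spaced _ hsp).subset hB', fun s hs => if_pos hs, fun s hs => ?_, ?_⟩
    · simp only [TB, if_neg hs]
      split_ifs with hsA
      · exact Finset.card_singleton r
      · exact hin s hsA
    · have := Finset.card_le_card hB'
      rw [hext.length]; lia
  calc _ ≤ (Fintype.piFinset TB).card * g l'.length (ones B).card (twos B).card := by
        rw [hfib]
        refine h l' B TB 𝒢 hst fun φ hφ => ?_
        rw [← hfib, Finset.mem_filter] at hφ
        have := h𝒢 φ hφ.1
        rwa [hφ.2] at this
    _ = _ := by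
        rw [← hfib, ← nsmul_eq_mul, ← Finset.sum_const]
        refine Finset.sum_congr rfl fun φ hφ => ?_
        rw [afterAbsorb, (Finset.mem_filter.1 hφ).2, hext.length]

variable [Nonempty V] {l : List V} {A : Finset (V × Bool)} {T : V × Bool → Finset V}
  {𝒢 : (V × Bool → V) → SimpleGraph V}

theorem AvgBound.idle (h : AvgBound P t g) (hs : IsState l A T)
    (h𝒢 : ∀ φ ∈ Fintype.piFinset T, Realizes (𝒢 φ) l A φ) (u : V) :
    ∑ φ ∈ Fintype.piFinset T, ⨅ v, failProb P t (𝒢 φ ⊔ SimpleGraph.edge u v) ≤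
      (Fintype.piFinset T).card * g l.length (ones A).card (twos A).card :=
  (Finset.sum_le_sum fun φ _ => iInf_failProb_le t (𝒢 φ) u u).trans
    (h l A T _ hs fun φ hφ => (h𝒢 φ hφ).mono le_sup_left)

theorem AvgBound.extend (h : AvgBound P t g) (hs : IsState l A T)
    (h𝒢 : ∀ φ ∈ Fintype.piFinset T, Realizes (𝒢 φ) l A φ) {u : V} (hu : u ∉ l) :
    ∑ φ ∈ Fintype.piFinset T, ⨅ v, failProb P t (𝒢 φ ⊔ SimpleGraph.edge u v) ≤
      ∑ φ ∈ Fintype.piFinset T, afterAbsorb g l A u φ := by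
  obtain ⟨l', v, hext, hl'⟩ := exists_append hs.nodup hu
  refine (Finset.sum_le_sum fun φ _ => iInf_failProb_le t (𝒢 φ) u v).trans ?_
  refine h.absorb hs.spaced hs.inactive hs.card_le hu (fun s hs' => Or.inl (hs.active s hs')) hext
    _ fun φ hφ => ⟨hl' _ (h𝒢 φ hφ).1, fun s hs' => ?_⟩
  exact Or.inl ((h𝒢 φ hφ).2 s (Finset.mem_filter.1 hs').1)

theorem AvgBound.augment (h : AvgBound P t g) (hs : IsState l A T)
    (h𝒢 : ∀ φ ∈ Fintype.piFinset T, Realizes (𝒢 φ) l A φ) {p u : V}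
    (hp : p ∈ A.image Prod.fst) (hu : u ∈ pathNbrs l p) :
    ∑ φ ∈ Fintype.piFinset T, ⨅ v, failProb P t (𝒢 φ ⊔ SimpleGraph.edge u v) ≤
      ∑ φ ∈ Fintype.piFinset T, afterAbsorb g l A (φ (slot A p)) φ := by
  have hslot := slot_mem hp
  rw [sum_piFinset_split T (slot A p), sum_piFinset_split T (slot A p), hs.active _ hslot]
  refine Finset.sum_le_sum fun r hr => ?_
  have hr' : r ∉ l := by simpa using hr
  obtain ⟨l', hext, hl'⟩ := exists_insertion hs.nodup (hs.spaced.mem hp) hu hr'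
  have hsub : ∀ φ ∈ Fintype.piFinset (Function.update T (slot A p) {r}),
      φ (slot A p) = r ∧ φ ∈ Fintype.piFinset T := by
    intro φ hφ
    rw [mem_piFinset_update, Finset.mem_singleton] at hφ
    refine ⟨hφ.1, Fintype.mem_piFinset.2 fun s => ?_⟩
    by_cases hsp : s = slot A p
    · rw [hsp, hφ.1, hs.active _ hslot]; exact hr
    · exact hφ.2 s hsp
  calc _ ≤ ∑ φ ∈ Fintype.piFinset (Function.update T (slot A p) {r}), afterAbsorb g l A r φ := by
        refine (Finset.sum_le_sum fun φ _ => iInf_failProb_le t (𝒢 φ) u r).trans ?_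
        refine h.absorb hs.spaced (fun s hsA => ?_) hs.card_le hr' (fun s hsA => ?_) hext _
          fun φ hφ => ⟨hl' _ (h𝒢 φ (hsub φ hφ).2).1 ?_, fun s hs' => ?_⟩
        · rw [Function.update_of_ne (by rintro rfl; exact hsA hslot)]
          exact hs.inactive s hsA
        · by_cases hsp : s = slot A p
          · right; rw [hsp, Function.update_self]
          · left; rw [Function.update_of_ne hsp]; exact hs.active s hsA
        · have := (h𝒢 φ (hsub φ hφ).2).2 _ hslot
          rwa [(hsub φ hφ).1] at this
        · exact Or.inl ((h𝒢 φ (hsub φ hφ).2).2 s (Finset.mem_filter.1 hs').1)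
    _ = _ := Finset.sum_congr rfl fun φ hφ => by rw [(hsub φ hφ).1]

theorem AvgBound.mark (h : AvgBound P t g) (hs : IsState l A T)
    (h𝒢 : ∀ φ ∈ Fintype.piFinset T, Realizes (𝒢 φ) l A φ) {s : V × Bool} (hsA : s ∉ A)
    (hsl : s.1 ∈ l) (hsp : Spaced l ((insert s A).image Prod.fst))
    (hcard : 5 * ((insert s A).image Prod.fst).card ≤ l.length + 2)
    (hU : l.toFinsetᶜ.Nonempty) :
    ∑ φ ∈ Fintype.piFinset T, ⨅ v, failProb P t (𝒢 φ ⊔ SimpleGraph.edge s.1 v) ≤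
      (Fintype.piFinset T).card *
        g l.length (ones (insert s A)).card (twos (insert s A)).card := by
  obtain ⟨d, hd⟩ := Finset.card_eq_one.1 (hs.inactive s hsA)
  have hk : (0 : ℝ) < (l.toFinsetᶜ).card := by exact_mod_cast hU.card_pos
  let T' := Function.update T s l.toFinsetᶜ
  have hst : IsState l (insert s A) T' := by
    refine ⟨hs.nodup, hsp, fun s' hs' => ?_, fun s' hs' => ?_, hcard⟩
    · by_cases h' : s' = s
      · rw [h']; simp [T']
      · simp only [T', Function.update_of_ne h']
        exact hs.active s' (Finset.mem_of_mem_insert_of_ne hs' h')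
    · rw [Finset.mem_insert, not_or] at hs'
      simp only [T', Function.update_of_ne hs'.1]
      exact hs.inactive s' hs'.2
  have hreal : ∀ φ ∈ Fintype.piFinset T', Realizes
      (𝒢 (Function.update φ s d) ⊔ SimpleGraph.edge s.1 (φ s)) l (insert s A) φ := by
    intro φ hφ
    rw [mem_piFinset_update] at hφ
    have hφ' : Function.update φ s d ∈ Fintype.piFinset T := by
      refine Fintype.mem_piFinset.2 fun j => ?_
      by_cases hj : j = s
      · rw [hj, hd]; simp
      · simpa [hj] using hφ.2 j hj
    refine ⟨isChain_mono le_sup_left (h𝒢 _ hφ').1, fun s' hs' => ?_⟩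
    by_cases h' : s' = s
    · rw [h']
      refine Or.inr (edge_adj_self ?_)
      rintro heq
      rw [← heq] at hφ
      simp [hsl] at hφ
    · have := (h𝒢 _ hφ').2 s' (Finset.mem_of_mem_insert_of_ne hs' h')
      rw [Function.update_of_ne h'] at this
      exact Or.inl this
  have key := h l (insert s A) T' _ hst hreal
  have hcardT : ((Fintype.piFinset T').card : ℝ) =
      (l.toFinsetᶜ).card * (Fintype.piFinset T).card := by
    have := card_piFinset_update T s l.toFinsetᶜ
    rw [hs.inactive s hsA, one_mul] at this
    exact_mod_cast this
  rw [hcardT, sum_piFinset_update, mul_assoc] at key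
  refine le_of_mul_le_mul_left (le_trans ?_ key) hk
  rw [← nsmul_eq_mul, ← Finset.sum_const]
  refine Finset.sum_le_sum fun v hv => ?_
  rw [sum_piFinset_update_singleton (hs.inactive s hsA)]
  refine Finset.sum_le_sum fun φ hφ => ?_
  have : Function.update (Function.update φ s v) s d = φ := by
    have := Fintype.mem_piFinset.1 hφ s
    rw [hd, Finset.mem_singleton] at this
    simp [← this]
  rw [this, Function.update_self]
  exact iInf_failProb_le t (𝒢 φ) s.1 v

/-- One step of the strategy. -/
theorem AvgBound.step (h : AvgBound P t g) (hs : IsState l A T)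
    (h𝒢 : ∀ φ ∈ Fintype.piFinset T, Realizes (𝒢 φ) l A φ) (hU : l.toFinsetᶜ.Nonempty) :
    Fintype.card V * ∑ φ ∈ Fintype.piFinset T, failProb P (t + 1) (𝒢 φ) ≤
      ∑ u ∈ l.toFinsetᶜ, ∑ φ ∈ Fintype.piFinset T, afterAbsorb g l A u φ +
      2 * ∑ p ∈ A.image Prod.fst, ∑ φ ∈ Fintype.piFinset T, afterAbsorb g l A (φ (slot A p)) φ +
      (Fintype.piFinset T).card *
        ((l.length - (5 * (A.image Prod.fst).card + 2) : ℕ) *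
            g l.length ((ones A).card + 1) (twos A).card +
          (ones A).card * g l.length ((ones A).card - 1) ((twos A).card + 1) +
          (l.length - 2 * (A.image Prod.fst).card -
            (l.length - (5 * (A.image Prod.fst).card + 2) : ℕ) - (ones A).card) *
            g l.length (ones A).card (twos A).card) := by
  set R := A.image Prod.fst with hR
  set H : V → ℝ := fun u =>
    ∑ φ ∈ Fintype.piFinset T, ⨅ v, failProb P t (𝒢 φ ⊔ SimpleGraph.edge u v) with hH
  have hsum : Fintype.card V * ∑ φ ∈ Fintype.piFinset T, failProb P (t + 1) (𝒢 φ) = ∑ u, H u := by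
    simp only [failProb, ← Finset.sum_div, hH]
    rw [mul_div_cancel₀ _ (card_pos_real (V := V)).ne', Finset.sum_comm]
  obtain ⟨hQ, hQc⟩ := freshSet_spec hs.nodup R
  set Q := freshSet l R with hQdef
  set N := R.biUnion (pathNbrs l) with hN
  have hNl : N ⊆ l.toFinset := Finset.biUnion_subset.2 fun p _ => Finset.filter_subset _ _
  have hQl : Q ⊆ l.toFinset := hQ.trans (permissible_subset l R)
  have hOR : ones A ⊆ R := Finset.filter_subset _ _
  have hOl : ones A ⊆ l.toFinset := fun p hp => List.mem_toFinset.2 (hs.spaced.mem (hOR hp))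
  have hNQ : Disjoint N Q := by
    rw [Finset.disjoint_left]
    intro u hu hu'
    obtain ⟨p, hp, hup⟩ := Finset.mem_biUnion.1 hu
    exact not_mem_permissible_of_mem_pathNbrs hp hup (hQ hu')
  have hNO : Disjoint (N ∪ Q) (ones A) := by
    rw [Finset.disjoint_left]
    intro u hu hu'
    rcases Finset.mem_union.1 hu with hu | hu
    · obtain ⟨p, hp, hup⟩ := Finset.mem_biUnion.1 hu
      exact hs.spaced.not_mem_of_mem_pathNbrs hp hup (hOR hu')
    · exact not_mem_of_mem_permissible (hQ hu) (hOR hu')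
  have hNc : N.card = 2 * R.card := by
    rw [hN, Finset.card_biUnion hs.spaced.pairwiseDisjoint,
      Finset.sum_congr rfl fun p hp => card_pathNbrs hs.nodup hs.spaced hp]
    rw [Finset.sum_const, smul_eq_mul, mul_comm]
  set Z := l.toFinset \ (N ∪ Q ∪ ones A) with hZ
  have hsubl : N ∪ Q ∪ ones A ⊆ l.toFinset :=
    Finset.union_subset (Finset.union_subset hNl hQl) hOl
  have hsplit : ∑ u, H u = ∑ u ∈ l.toFinsetᶜ, H u +
      (∑ u ∈ Z, H u + (∑ u ∈ N, H u + ∑ u ∈ Q, H u + ∑ u ∈ ones A, H u)) := by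
    rw [← Finset.sum_compl_add_sum l.toFinset, ← Finset.sum_sdiff hsubl,
      Finset.sum_union hNO, Finset.sum_union hNQ]
  have hZc : (Z.card : ℝ) = l.length - 2 * R.card -
      (l.length - (5 * R.card + 2) : ℕ) - (ones A).card := by
    have h1 := Finset.card_sdiff_add_card_eq_card hsubl
    rw [Finset.card_union_of_disjoint hNO, Finset.card_union_of_disjoint hNQ, hNc, hQc,
      List.toFinset_card_of_nodup hs.nodup] at h1
    have h2 : (Z.card : ℝ) + (2 * R.card + (l.length - (5 * R.card + 2) : ℕ) + (ones A).card) =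
        l.length := by exact_mod_cast h1
    linarith
  have b1 : ∑ u ∈ l.toFinsetᶜ, H u ≤
      ∑ u ∈ l.toFinsetᶜ, ∑ φ ∈ Fintype.piFinset T, afterAbsorb g l A u φ :=
    Finset.sum_le_sum fun u hu => h.extend hs h𝒢 (by simpa using hu)
  have b2 : ∑ u ∈ N, H u ≤
      2 * ∑ p ∈ R, ∑ φ ∈ Fintype.piFinset T, afterAbsorb g l A (φ (slot A p)) φ := by
    rw [hN, Finset.sum_biUnion hs.spaced.pairwiseDisjoint, Finset.mul_sum]
    refine Finset.sum_le_sum fun p hp => ?_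
    refine (Finset.sum_le_sum fun u hu => h.augment hs h𝒢 hp hu).trans ?_
    rw [Finset.sum_const, card_pathNbrs hs.nodup hs.spaced hp, nsmul_eq_mul]
    norm_num
  have b3 : ∑ u ∈ Q, H u ≤ Q.card * ((Fintype.piFinset T).card *
      g l.length ((ones A).card + 1) (twos A).card) := by
    rw [← nsmul_eq_mul, ← Finset.sum_const]
    refine Finset.sum_le_sum fun u hu => ?_
    have huR := not_mem_of_mem_permissible (hQ hu)
    have hspi := hs.spaced.insert (hQ hu)
    have hpos : 0 < Q.card := Finset.card_pos.2 ⟨u, hu⟩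
    have := h.mark hs h𝒢 (s := (u, false))
      (fun h' => huR (Finset.mem_image.2 ⟨_, h', rfl⟩)) (List.mem_toFinset.1 (hQl hu))
      (by rwa [Finset.image_insert]) ?_ hU
    · rw [ones_insert_new huR, twos_insert_new huR, Finset.card_insert_of_notMem] at this
      · exact this
      · exact fun h' => huR (hOR h')
    · rw [Finset.image_insert, ← hR, Finset.card_insert_of_notMem huR]
      lia
  have b4 : ∑ u ∈ ones A, H u ≤ (ones A).card * ((Fintype.piFinset T).card *
      g l.length ((ones A).card - 1) ((twos A).card + 1)) := by
    rw [← nsmul_eq_mul, ← Finset.sum_const]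
    refine Finset.sum_le_sum fun u hu => ?_
    have := h.mark hs h𝒢 (otherSlot_notMem hu) (List.mem_toFinset.1 (hOl hu))
      (by rw [image_fst_insert_other hu]; exact hs.spaced)
      (by rw [image_fst_insert_other hu]; exact hs.card_le) hU
    rw [ones_insert_other hu, twos_insert_other hu, Finset.card_erase_of_mem hu,
      Finset.card_insert_of_notMem (Finset.disjoint_left.1 (disjoint_ones_twos A) hu)] at this
    exact this
  have b5 : ∑ u ∈ Z, H u ≤ Z.card * ((Fintype.piFinset T).card *
      g l.length (ones A).card (twos A).card) := by
    rw [← nsmul_eq_mul, ← Finset.sum_const]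
    exact Finset.sum_le_sum fun u _ => h.idle hs h𝒢 u
  rw [hsum, hsplit]
  rw [hQc] at b3
  rw [hZc] at b5
  linarith

end States

end SemiRandom
namespace SemiRandom

set_option linter.unusedSectionVars false

/-! ## Moments of the changes in one step -/

section Moments

variable {V : Type*} [DecidableEq V]

theorem slot_of_mem_twos {A : Finset (V × Bool)} {p : V} (hp : p ∈ twos A) :
    slot A p = (p, false) := by
  rw [mem_twos] at hp; simp [slot, hp.1]

theorem slot_mem_of_mem_ones {A : Finset (V × Bool)} {p : V} (hp : p ∈ ones A) : slot A p ∈ A :=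
  slot_mem (Finset.mem_filter.1 hp).1

theorem sum_slots (A : Finset (V × Bool)) (F : V × Bool → ℝ) :
    ∑ s ∈ A, F s = ∑ p ∈ ones A, F (slot A p) + ∑ p ∈ twos A, (F (p, false) + F (p, true)) := by
  rw [← Finset.sum_fiberwise_of_maps_to (t := A.image Prod.fst) (g := Prod.fst)
    (fun s hs => Finset.mem_image_of_mem _ hs), ← ones_union_twos,
    Finset.sum_union (disjoint_ones_twos A)]
  congr 1
  · refine Finset.sum_congr rfl fun p hp => ?_
    rw [mem_ones] at hp
    have : A.filter (fun s => s.1 = p) = {slot A p} := by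
      ext ⟨q, b⟩
      simp only [Finset.mem_filter, Finset.mem_singleton, slot, Prod.mk.injEq]
      rcases hp with ⟨h1, h2⟩ | ⟨h1, h2⟩
      · constructor
        · rintro ⟨h, rfl⟩; cases b <;> simp_all
        · rintro ⟨rfl, rfl⟩; simp [h1]
      · constructor
        · rintro ⟨h, rfl⟩; cases b <;> simp_all
        · rintro ⟨rfl, rfl⟩; simpa [h1]
    rw [this, Finset.sum_singleton]
  · refine Finset.sum_congr rfl fun p hp => ?_
    rw [mem_twos] at hp
    have : A.filter (fun s => s.1 = p) = {(p, false), (p, true)} := by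
      ext ⟨q, b⟩
      simp only [Finset.mem_filter, Finset.mem_insert, Finset.mem_singleton, Prod.mk.injEq]
      constructor
      · rintro ⟨h, rfl⟩; cases b <;> simp
      · rintro (⟨rfl, rfl⟩ | ⟨rfl, rfl⟩) <;> simp [hp]
    rw [this, Finset.sum_pair (by simp)]

/-- The indicator that the slot `s` has far end `r`. -/
def hit (r : V) (φ : V × Bool → V) (s : V × Bool) : ℝ := if φ s = r then 1 else 0

theorem hit_nonneg (r : V) (φ : V × Bool → V) (s : V × Bool) : 0 ≤ hit r φ s := by
  unfold hit; split_ifs <;> norm_num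

theorem hit_le_one (r : V) (φ : V × Bool → V) (s : V × Bool) : hit r φ s ≤ 1 := by
  unfold hit; split_ifs <;> norm_num

theorem hit_mul_self (r : V) (φ : V × Bool → V) (s : V × Bool) :
    hit r φ s * hit r φ s = hit r φ s := by
  unfold hit; split_ifs <;> norm_num

theorem card_ones_filter (A : Finset (V × Bool)) (r : V) (φ : V × Bool → V) :
    ((ones (A.filter (φ · ≠ r))).card : ℝ) - (ones A).card =
      -∑ p ∈ ones A, hit r φ (slot A p) + ∑ p ∈ twos A,
        (hit r φ (p, false) + hit r φ (p, true) - 2 * (hit r φ (p, false) * hit r φ (p, true))) := by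
  have hsub : ones (A.filter (φ · ≠ r)) ⊆ A.image Prod.fst :=
    (Finset.filter_subset _ _).trans (Finset.image_subset_image (Finset.filter_subset _ _))
  have h1 : ((ones (A.filter (φ · ≠ r))).card : ℝ) =
      ∑ p ∈ A.image Prod.fst, if p ∈ ones (A.filter (φ · ≠ r)) then 1 else 0 := by
    rw [Finset.sum_boole, Finset.filter_mem_eq_inter, Finset.inter_eq_right.2 hsub]
  rw [h1, ← ones_union_twos, Finset.sum_union (disjoint_ones_twos A)]
  have h2 : ∑ p ∈ ones A, (if p ∈ ones (A.filter (φ · ≠ r)) then (1 : ℝ) else 0) =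
      ∑ p ∈ ones A, (1 - hit r φ (slot A p)) := by
    refine Finset.sum_congr rfl fun p hp => ?_
    rw [mem_ones] at hp
    simp only [mem_ones, Finset.mem_filter, hit, slot]
    rcases hp with ⟨h1, h2⟩ | ⟨h1, h2⟩
    · by_cases h : φ (p, false) = r <;> simp [h1, h2, h]
    · by_cases h : φ (p, true) = r <;> simp [h1, h2, h]
  have h3 : ∑ p ∈ twos A, (if p ∈ ones (A.filter (φ · ≠ r)) then (1 : ℝ) else 0) =
      ∑ p ∈ twos A, (hit r φ (p, false) + hit r φ (p, true) -
        2 * (hit r φ (p, false) * hit r φ (p, true))) := by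
    refine Finset.sum_congr rfl fun p hp => ?_
    rw [mem_twos] at hp
    simp only [mem_ones, Finset.mem_filter, hit]
    by_cases h : φ (p, false) = r <;> by_cases h' : φ (p, true) = r <;> simp [hp, h, h']
    norm_num
  rw [h2, h3, Finset.sum_sub_distrib]
  simp only [Finset.sum_const, nsmul_eq_mul, mul_one]
  ring

theorem card_twos_filter (A : Finset (V × Bool)) (r : V) (φ : V × Bool → V) :
    ((twos (A.filter (φ · ≠ r))).card : ℝ) - (twos A).card =
      ∑ p ∈ twos A, (-hit r φ (p, false) - hit r φ (p, true) +
        hit r φ (p, false) * hit r φ (p, true)) := by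
  have hsub : twos (A.filter (φ · ≠ r)) ⊆ twos A := by
    intro p hp
    simp only [mem_twos, Finset.mem_filter] at hp ⊢
    exact ⟨hp.1.1, hp.2.1⟩
  have h1 : ((twos (A.filter (φ · ≠ r))).card : ℝ) =
      ∑ p ∈ twos A, if p ∈ twos (A.filter (φ · ≠ r)) then 1 else 0 := by
    rw [Finset.sum_boole, Finset.filter_mem_eq_inter, Finset.inter_eq_right.2 hsub]
  have h2 : ((twos A).card : ℝ) = ∑ p ∈ twos A, 1 := by simp
  rw [h1, h2, ← Finset.sum_sub_distrib]
  refine Finset.sum_congr rfl fun p hp => ?_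
  rw [mem_twos] at hp
  simp only [mem_twos, Finset.mem_filter, hit]
  by_cases h : φ (p, false) = r <;> by_cases h' : φ (p, true) = r <;> simp [hp, h, h']

theorem abs_card_ones_filter_le (A : Finset (V × Bool)) (r : V) (φ : V × Bool → V) :
    |((ones (A.filter (φ · ≠ r))).card : ℝ) - (ones A).card| ≤ ∑ s ∈ A, hit r φ s := by
  rw [card_ones_filter, sum_slots]
  refine (abs_add_le _ _).trans (add_le_add ?_ ?_)
  · rw [abs_neg, abs_of_nonneg (Finset.sum_nonneg fun p _ => hit_nonneg _ _ _)]
  · refine (Finset.abs_sum_le_sum_abs _ _).trans (Finset.sum_le_sum fun p _ => ?_)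
    have h1 := hit_nonneg r φ (p, false)
    have h2 := hit_nonneg r φ (p, true)
    have h3 := hit_le_one r φ (p, false)
    have h4 := hit_le_one r φ (p, true)
    rw [abs_le]
    constructor <;> nlinarith

theorem abs_card_twos_filter_le (A : Finset (V × Bool)) (r : V) (φ : V × Bool → V) :
    |((twos (A.filter (φ · ≠ r))).card : ℝ) - (twos A).card| ≤ ∑ s ∈ A, hit r φ s := by
  rw [card_twos_filter, sum_slots]
  have h0 : 0 ≤ ∑ p ∈ ones A, hit r φ (slot A p) :=
    Finset.sum_nonneg fun p _ => hit_nonneg _ _ _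
  refine ((Finset.abs_sum_le_sum_abs _ _).trans (Finset.sum_le_sum fun p _ => ?_)).trans
    (le_add_of_nonneg_left h0)
  have h1 := hit_nonneg r φ (p, false)
  have h2 := hit_nonneg r φ (p, true)
  have h3 := hit_le_one r φ (p, false)
  have h4 := hit_le_one r φ (p, true)
  rw [abs_le]
  constructor <;> nlinarith

variable [Fintype V] {l : List V} {A : Finset (V × Bool)} {T : V × Bool → Finset V}

/-- Under the uniform distribution on `T`, the events that the slots `s ∈ A` have far end `ρ φ`
are pairwise independent and have probabilities `w s`. -/
structure HitMoments (A : Finset (V × Bool)) (T : V × Bool → Finset V)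
    (ρ : (V × Bool → V) → V) (w : V × Bool → ℝ) : Prop where
  first : ∀ s ∈ A, ∑ φ ∈ Fintype.piFinset T, hit (ρ φ) φ s = (Fintype.piFinset T).card * w s
  second : ∀ s ∈ A, ∀ s' ∈ A, s ≠ s' → ∑ φ ∈ Fintype.piFinset T,
    hit (ρ φ) φ s * hit (ρ φ) φ s' = (Fintype.piFinset T).card * (w s * w s')

theorem sum_hit_mul (T : V × Bool → Finset V) {s : V × Bool} {r : V} (hr : r ∈ T s)
    (H : (V × Bool → V) → ℝ) : ∑ φ ∈ Fintype.piFinset T, hit r φ s * H φ =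
      ∑ φ ∈ Fintype.piFinset (Function.update T s {r}), H φ := by
  rw [sum_piFinset_split T s, Finset.sum_eq_single r]
  · refine Finset.sum_congr rfl fun φ hφ => ?_
    rw [mem_piFinset_update, Finset.mem_singleton] at hφ
    simp [hit, hφ.1]
  · intro r' _ hr'
    refine Finset.sum_eq_zero fun φ hφ => ?_
    rw [mem_piFinset_update, Finset.mem_singleton] at hφ
    simp [hit, hφ.1, hr']
  · exact fun h => absurd hr h

theorem sum_hit (T : V × Bool → Finset V) {s : V × Bool} {r : V} (hr : r ∈ T s) :
    ∑ φ ∈ Fintype.piFinset T, hit r φ s = (Fintype.piFinset T).card * (1 / (T s).card) := by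
  have h := sum_hit_mul T hr fun _ => 1
  simp only [mul_one, Finset.sum_const, nsmul_eq_mul] at h
  have hc := card_piFinset_update T s {r}
  rw [Finset.card_singleton, one_mul] at hc
  have hpos : ((T s).card : ℝ) ≠ 0 := by
    have := Finset.card_pos.2 ⟨r, hr⟩
    positivity
  rw [h, mul_one_div, eq_div_iff hpos, mul_comm]
  exact_mod_cast hc

theorem sum_hit_hit (T : V × Bool → Finset V) {s s' : V × Bool} (hss : s ≠ s') {r : V}
    (hr : r ∈ T s) (hr' : r ∈ T s') : ∑ φ ∈ Fintype.piFinset T, hit r φ s * hit r φ s' =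
      (Fintype.piFinset T).card * (1 / (T s).card * (1 / (T s').card)) := by
  have hc := card_piFinset_update T s {r}
  rw [Finset.card_singleton, one_mul] at hc
  have hpos : ((T s).card : ℝ) ≠ 0 := by
    have := Finset.card_pos.2 ⟨r, hr⟩
    positivity
  rw [sum_hit_mul T hr, sum_hit _ (by simpa [hss.symm] using hr'), Function.update_of_ne hss.symm,
    ← mul_assoc, mul_one_div (_ : ℝ) ((T s).card : ℝ)]
  congr 1
  rw [eq_div_iff hpos, mul_comm]
  exact_mod_cast hc

theorem IsState.hitMoments_const (hs : IsState l A T) {u : V} (hu : u ∉ l) :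
    HitMoments A T (fun _ => u) (fun _ => 1 / ((l.toFinsetᶜ).card : ℝ)) := by
  have hm : ∀ s ∈ A, u ∈ T s := fun s h => by rw [hs.active s h]; simpa using hu
  refine ⟨fun s h => ?_, fun s h s' h' hss => ?_⟩
  · rw [sum_hit T (hm s h), hs.active s h]
  · rw [sum_hit_hit T hss (hm s h) (hm s' h'), hs.active s h, hs.active s' h']

theorem IsState.hitMoments_slot (hs : IsState l A T) {s₀ : V × Bool} (hs₀ : s₀ ∈ A)
    (hU : l.toFinsetᶜ.Nonempty) :
    HitMoments A T (fun φ => φ s₀)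
      (fun s => if s = s₀ then 1 else 1 / ((l.toFinsetᶜ).card : ℝ)) := by
  have hk : ((l.toFinsetᶜ).card : ℝ) ≠ 0 := by
    have := hU.card_pos
    positivity
  have hm : ∀ s ∈ A, ∀ r ∈ l.toFinsetᶜ, r ∈ T s := fun s h r hr => by rwa [hs.active s h]
  have hself : ∀ φ : V × Bool → V, hit (φ s₀) φ s₀ = 1 := fun φ => by simp [hit]
  have hcard : ∀ r, ((Fintype.piFinset (Function.update T s₀ {r})).card : ℝ) =
      (Fintype.piFinset T).card * (1 / ((l.toFinsetᶜ).card : ℝ)) := by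
    intro r
    have := card_piFinset_update T s₀ {r}
    rw [Finset.card_singleton, one_mul, hs.active _ hs₀] at this
    rw [mul_one_div, eq_div_iff hk, mul_comm]
    exact_mod_cast this
  have hsplit : ∀ H : V → (V × Bool → V) → ℝ, ∑ φ ∈ Fintype.piFinset T, H (φ s₀) φ =
      ∑ r ∈ l.toFinsetᶜ, ∑ φ ∈ Fintype.piFinset (Function.update T s₀ {r}), H r φ := by
    intro H
    rw [sum_piFinset_split T s₀, hs.active _ hs₀]
    refine Finset.sum_congr rfl fun r _ => Finset.sum_congr rfl fun φ hφ => ?_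
    rw [mem_piFinset_update, Finset.mem_singleton] at hφ
    rw [hφ.1]
  have hone : ∀ s ∈ A, s ≠ s₀ → ∑ φ ∈ Fintype.piFinset T, hit (φ s₀) φ s =
      (Fintype.piFinset T).card * (1 / ((l.toFinsetᶜ).card : ℝ)) := by
    intro s h hss
    rw [hsplit fun r φ => hit r φ s, Finset.sum_congr rfl fun r hr =>
      sum_hit (Function.update T s₀ {r}) (s := s) (by simpa [hss] using hm s h r hr)]
    simp only [hcard, Function.update_of_ne hss, hs.active s h, Finset.sum_const, nsmul_eq_mul]
    field_simp
  refine ⟨fun s h => ?_, fun s h s' h' hss => ?_⟩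
  · by_cases hs0 : s = s₀
    · simp [hs0, hself]
    · simp only [hs0, if_false]; exact hone s h hs0
  · by_cases hs0 : s = s₀
    · have hs0' : s' ≠ s₀ := fun h => hss (hs0.trans h.symm)
      simp only [hs0, hself, hs0', if_true, if_false, one_mul]
      exact hone s' h' hs0'
    · by_cases hs0' : s' = s₀
      · simp only [hs0, hs0', hself, if_true, if_false, mul_one]
        exact hone s h hs0
      · simp only [hs0, hs0', if_false]
        rw [hsplit fun r φ => hit r φ s * hit r φ s', Finset.sum_congr rfl fun r hr =>
          sum_hit_hit (Function.update T s₀ {r}) hss (by simpa [hs0] using hm s h r hr)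
            (by simpa [hs0'] using hm s' h' r hr)]
        simp only [hcard, Function.update_of_ne hs0, Function.update_of_ne hs0', hs.active s h,
          hs.active s' h', Finset.sum_const, nsmul_eq_mul]
        field_simp

variable {ρ : (V × Bool → V) → V} {w : V × Bool → ℝ}

theorem HitMoments.sum_ones (h : HitMoments A T ρ w) :
    ∑ φ ∈ Fintype.piFinset T,
        (((ones (A.filter (φ · ≠ ρ φ))).card : ℝ) - (ones A).card) =
      (Fintype.piFinset T).card * (-∑ p ∈ ones A, w (slot A p) +
        ∑ p ∈ twos A, (w (p, false) + w (p, true) - 2 * (w (p, false) * w (p, true)))) := by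
  simp only [card_ones_filter, Finset.sum_add_distrib, Finset.sum_neg_distrib,
    Finset.sum_sub_distrib, ← Finset.mul_sum]
  rw [Finset.sum_comm, Finset.sum_comm (t := twos A), Finset.sum_comm (t := twos A),
    Finset.sum_comm (t := twos A)]
  rw [Finset.sum_congr rfl fun p hp => h.first (slot A p) (slot_mem_of_mem_ones hp),
    Finset.sum_congr rfl fun p hp => h.first (p, false) (mem_twos.1 hp).1,
    Finset.sum_congr rfl fun p hp => h.first (p, true) (mem_twos.1 hp).2,
    Finset.sum_congr rfl fun p hp => h.second (p, false) (mem_twos.1 hp).1 (p, true)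
      (mem_twos.1 hp).2 (by simp)]
  simp only [← Finset.mul_sum]
  ring

theorem HitMoments.sum_twos (h : HitMoments A T ρ w) :
    ∑ φ ∈ Fintype.piFinset T,
        (((twos (A.filter (φ · ≠ ρ φ))).card : ℝ) - (twos A).card) =
      (Fintype.piFinset T).card *
        ∑ p ∈ twos A, (-w (p, false) - w (p, true) + w (p, false) * w (p, true)) := by
  simp only [card_twos_filter, Finset.sum_add_distrib, Finset.sum_neg_distrib,
    Finset.sum_sub_distrib]
  rw [Finset.sum_comm (t := twos A), Finset.sum_comm (t := twos A),
    Finset.sum_comm (t := twos A)]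
  rw [Finset.sum_congr rfl fun p hp => h.first (p, false) (mem_twos.1 hp).1,
    Finset.sum_congr rfl fun p hp => h.first (p, true) (mem_twos.1 hp).2,
    Finset.sum_congr rfl fun p hp => h.second (p, false) (mem_twos.1 hp).1 (p, true)
      (mem_twos.1 hp).2 (by simp)]
  simp only [← Finset.mul_sum]
  ring

theorem HitMoments.sum_sq_le (h : HitMoments A T ρ w) (hw : ∀ s, 0 ≤ w s) :
    ∑ φ ∈ Fintype.piFinset T, (∑ s ∈ A, hit (ρ φ) φ s) ^ 2 ≤
      (Fintype.piFinset T).card * (∑ s ∈ A, w s + (∑ s ∈ A, w s) ^ 2) := by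
  have e1 : ∑ φ ∈ Fintype.piFinset T, (∑ s ∈ A, hit (ρ φ) φ s) ^ 2 =
      ∑ s ∈ A, ∑ s' ∈ A, ∑ φ ∈ Fintype.piFinset T, hit (ρ φ) φ s * hit (ρ φ) φ s' := by
    simp only [sq, Finset.sum_mul_sum]
    rw [Finset.sum_comm]
    exact Finset.sum_congr rfl fun s _ => Finset.sum_comm
  have e2 : ∀ s ∈ A, ∀ s' ∈ A,
      ∑ φ ∈ Fintype.piFinset T, hit (ρ φ) φ s * hit (ρ φ) φ s' ≤
        (Fintype.piFinset T).card * (w s * w s' + if s' = s then w s else 0) := by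
    intro s hs s' hs'
    by_cases hss : s' = s
    · subst hss
      simp only [hit_mul_self, if_true]
      rw [h.first s' hs]
      have := hw s'
      gcongr
      nlinarith
    · rw [h.second s hs s' hs' (Ne.symm hss), if_neg hss, add_zero]
  rw [e1]
  refine (Finset.sum_le_sum fun s hs => Finset.sum_le_sum (e2 s hs)).trans (le_of_eq ?_)
  simp only [← Finset.mul_sum, Finset.sum_add_distrib]
  have : ∑ s ∈ A, ∑ s' ∈ A, (if s' = s then w s else 0) = ∑ s ∈ A, w s :=
    Finset.sum_congr rfl fun s hs => by rw [Finset.sum_ite_eq' A s]; simp [hs]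
  rw [this, sq, Finset.sum_mul_sum]
  simp only [← Finset.mul_sum]
  ring

end Moments

end SemiRandom
namespace SemiRandom

set_option linter.unusedSectionVars false

section Drift

variable {V : Type*} [DecidableEq V] [Fintype V]

/-- The sum of `g` over the outcomes of one step of the strategy, i.e. over the presented vertices
and the far ends of the slots. -/
noncomputable def stepSum (l : List V) (A : Finset (V × Bool)) (T : V × Bool → Finset V)
    (g : ℕ → ℕ → ℕ → ℝ) : ℝ :=
  ∑ u ∈ l.toFinsetᶜ, ∑ φ ∈ Fintype.piFinset T, afterAbsorb g l A u φ +
    2 * ∑ p ∈ A.image Prod.fst, ∑ φ ∈ Fintype.piFinset T, afterAbsorb g l A (φ (slot A p)) φ +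
    (Fintype.piFinset T).card *
      ((l.length - (5 * (A.image Prod.fst).card + 2) : ℕ) *
          g l.length ((ones A).card + 1) (twos A).card +
        (ones A).card * g l.length ((ones A).card - 1) ((twos A).card + 1) +
        (l.length - 2 * (A.image Prod.fst).card -
          (l.length - (5 * (A.image Prod.fst).card + 2) : ℕ) - (ones A).card) *
          g l.length (ones A).card (twos A).card)

variable {l : List V} {A : Finset (V × Bool)} {T : V × Bool → Finset V}

theorem stepSum_add (g g' : ℕ → ℕ → ℕ → ℝ) :
    stepSum l A T (fun X a b => g X a b + g' X a b) = stepSum l A T g + stepSum l A T g' := by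
  simp only [stepSum, afterAbsorb, Finset.sum_add_distrib]
  ring

theorem stepSum_mul (c : ℝ) (g : ℕ → ℕ → ℕ → ℝ) :
    stepSum l A T (fun X a b => c * g X a b) = c * stepSum l A T g := by
  simp only [stepSum, afterAbsorb, ← Finset.mul_sum]
  ring

theorem IsState.card_add (hs : IsState l A T) :
    (l.length : ℝ) + (l.toFinsetᶜ).card = Fintype.card V := by
  rw [← List.toFinset_card_of_nodup hs.nodup]
  exact_mod_cast Finset.card_add_card_compl _

theorem stepSum_const (hs : IsState l A T) (c : ℝ) :
    stepSum l A T (fun _ _ _ => c) = (Fintype.piFinset T).card * (Fintype.card V * c) := by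
  simp only [stepSum, afterAbsorb, Finset.sum_const, nsmul_eq_mul, ← hs.card_add]
  ring

theorem stepSum_length :
    stepSum l A T (fun X _ _ => (X : ℝ) - l.length) =
      (Fintype.piFinset T).card *
        ((l.toFinsetᶜ).card + 2 * ((ones A).card + (twos A).card : ℝ)) := by
  have : ((A.image Prod.fst).card : ℝ) = (ones A).card + (twos A).card := by
    exact_mod_cast (card_ones_add_card_twos A).symm
  simp only [stepSum, afterAbsorb, Finset.sum_const, nsmul_eq_mul, this]
  push_cast
  ring

theorem stepSum_length_sq :
    stepSum l A T (fun X _ _ => ((X : ℝ) - l.length) ^ 2) =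
      (Fintype.piFinset T).card *
        ((l.toFinsetᶜ).card + 2 * ((ones A).card + (twos A).card : ℝ)) := by
  have : ((A.image Prod.fst).card : ℝ) = (ones A).card + (twos A).card := by
    exact_mod_cast (card_ones_add_card_twos A).symm
  simp only [stepSum, afterAbsorb, Finset.sum_const, nsmul_eq_mul, this]
  push_cast
  ring

theorem slot_injective (A : Finset (V × Bool)) : Function.Injective (slot A) :=
  fun _ _ h => (Prod.mk.injEq _ _ _ _ ▸ h : _ ∧ _).1

theorem sum_ones_slot (p : V) (c : ℝ) :
    ∑ q ∈ ones A, (if slot A q = slot A p then 1 else c) =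
      (ones A).card * c + (1 - c) * (if p ∈ ones A then 1 else 0) := by
  have : ∀ q ∈ ones A, (if slot A q = slot A p then 1 else c) =
      c + if q = p then 1 - c else 0 := by
    intro q _
    simp only [(slot_injective A).eq_iff]
    split_ifs <;> ring
  rw [Finset.sum_congr rfl this, Finset.sum_add_distrib, Finset.sum_ite_eq']
  simp

theorem sum_twos_slot (p : V) (c : ℝ) (f : ℝ → ℝ → ℝ) :
    ∑ q ∈ twos A, f (if (q, false) = slot A p then 1 else c) (if (q, true) = slot A p then 1 else c)
      = (twos A).card * f c c + (f 1 c - f c c) * (if p ∈ twos A then 1 else 0) := by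
  have : ∀ q ∈ twos A,
      f (if (q, false) = slot A p then 1 else c) (if (q, true) = slot A p then 1 else c) =
      f c c + if q = p then f 1 c - f c c else 0 := by
    intro q hq
    have hq' : (q, true) ≠ slot A p := by
      intro h
      have h1 : q = p := by simpa [slot] using congrArg Prod.fst h
      subst h1
      rw [slot_of_mem_twos hq] at h
      simp at h
    simp only [← slot_of_mem_twos hq, (slot_injective A).eq_iff, if_neg hq']
    split_ifs <;> ring
  rw [Finset.sum_congr rfl this, Finset.sum_add_distrib, Finset.sum_ite_eq']
  simp

theorem ones_subset (A : Finset (V × Bool)) : ones A ⊆ A.image Prod.fst := Finset.filter_subset _ _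

theorem twos_subset (A : Finset (V × Bool)) : twos A ⊆ A.image Prod.fst := Finset.filter_subset _ _

theorem sum_image_ite_ones (A : Finset (V × Bool)) (c : ℝ) :
    ∑ p ∈ A.image Prod.fst, c * (if p ∈ ones A then (1 : ℝ) else 0) = c * (ones A).card := by
  rw [← Finset.mul_sum, Finset.sum_boole, Finset.filter_mem_eq_inter,
    Finset.inter_eq_right.2 (ones_subset A)]

theorem sum_image_ite_twos (A : Finset (V × Bool)) (c : ℝ) :
    ∑ p ∈ A.image Prod.fst, c * (if p ∈ twos A then (1 : ℝ) else 0) = c * (twos A).card := by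
  rw [← Finset.mul_sum, Finset.sum_boole, Finset.filter_mem_eq_inter,
    Finset.inter_eq_right.2 (twos_subset A)]

theorem stepSum_ones (hs : IsState l A T) (hU : l.toFinsetᶜ.Nonempty) {a b k : ℝ}
    (ha : a = (ones A).card) (hb : b = (twos A).card) (hk : k = (l.toFinsetᶜ).card) :
    stepSum l A T (fun _ a' _ => (a' : ℝ) - a) =
      (Fintype.piFinset T).card *
        (k * (-(a / k) + b * (2 / k - 2 / k ^ 2)) +
          2 * ((a + b) * (-(a / k) + b * (2 / k - 2 / k ^ 2)) - (1 - 1 / k) * a +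
            (1 - 1 / k) * (1 - 2 / k) * b) +
          ((l.length - (5 * (A.image Prod.fst).card + 2) : ℕ) : ℝ) - a) := by
  have h1 : ∀ u ∈ l.toFinsetᶜ, ∑ φ ∈ Fintype.piFinset T,
      afterAbsorb (fun _ a' _ => (a' : ℝ) - a) l A u φ =
        (Fintype.piFinset T).card * (-(a / k) + b * (2 / k - 2 / k ^ 2)) := by
    intro u hu
    simp only [afterAbsorb, ha]
    rw [(hs.hitMoments_const (by simpa using hu)).sum_ones]
    simp only [Finset.sum_const, nsmul_eq_mul, ← ha, ← hb, ← hk]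
    ring
  have h2 : ∀ p ∈ A.image Prod.fst, ∑ φ ∈ Fintype.piFinset T,
      afterAbsorb (fun _ a' _ => (a' : ℝ) - a) l A (φ (slot A p)) φ =
        (Fintype.piFinset T).card * ((-(a / k) + b * (2 / k - 2 / k ^ 2)) -
          (1 - 1 / k) * (if p ∈ ones A then 1 else 0) +
          (1 - 1 / k) * (1 - 2 / k) * (if p ∈ twos A then 1 else 0)) := by
    intro p hp
    simp only [afterAbsorb, ha]
    rw [(hs.hitMoments_slot (slot_mem hp) hU).sum_ones, sum_ones_slot,
      sum_twos_slot p _ fun x y => x + y - 2 * (x * y)]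
    simp only [← ha, ← hb, ← hk]
    ring
  have hR : ((A.image Prod.fst).card : ℝ) = a + b := by
    rw [ha, hb]; exact_mod_cast (card_ones_add_card_twos A).symm
  have h3 : (ones A).card * ((((ones A).card - 1 : ℕ) : ℝ) - a) = -a := by
    rcases Nat.eq_zero_or_pos (ones A).card with h | h
    · simp [ha, h]
    · rw [Nat.cast_sub h, ← ha]; push_cast; ring
  rw [stepSum, Finset.sum_congr rfl h1, Finset.sum_congr rfl h2,
    ← Finset.mul_sum (s := A.image Prod.fst), Finset.sum_add_distrib, Finset.sum_sub_distrib,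
    sum_image_ite_ones, sum_image_ite_twos]
  simp only [Finset.sum_const, nsmul_eq_mul, hR, ← hk, ← hb]
  rw [h3, ← ha]
  push_cast
  rw [← ha]
  ring

theorem stepSum_twos (hs : IsState l A T) (hU : l.toFinsetᶜ.Nonempty) {a b k : ℝ}
    (ha : a = (ones A).card) (hb : b = (twos A).card) (hk : k = (l.toFinsetᶜ).card) :
    stepSum l A T (fun _ _ b' => (b' : ℝ) - b) =
      (Fintype.piFinset T).card *
        (k * (b * (-(2 / k) + 1 / k ^ 2)) +
          2 * ((a + b) * (b * (-(2 / k) + 1 / k ^ 2)) - (1 - 1 / k) ^ 2 * b) + a) := by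
  have h1 : ∀ u ∈ l.toFinsetᶜ, ∑ φ ∈ Fintype.piFinset T,
      afterAbsorb (fun _ _ b' => (b' : ℝ) - b) l A u φ =
        (Fintype.piFinset T).card * (b * (-(2 / k) + 1 / k ^ 2)) := by
    intro u hu
    simp only [afterAbsorb, hb]
    rw [(hs.hitMoments_const (by simpa using hu)).sum_twos]
    simp only [Finset.sum_const, nsmul_eq_mul, ← hb, ← hk]
    ring
  have h2 : ∀ p ∈ A.image Prod.fst, ∑ φ ∈ Fintype.piFinset T,
      afterAbsorb (fun _ _ b' => (b' : ℝ) - b) l A (φ (slot A p)) φ =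
        (Fintype.piFinset T).card * (b * (-(2 / k) + 1 / k ^ 2) -
          (1 - 1 / k) ^ 2 * (if p ∈ twos A then 1 else 0)) := by
    intro p hp
    simp only [afterAbsorb, hb]
    rw [(hs.hitMoments_slot (slot_mem hp) hU).sum_twos,
      sum_twos_slot p _ fun x y => -x - y + x * y]
    simp only [← hb, ← hk]
    ring
  have hR : ((A.image Prod.fst).card : ℝ) = a + b := by
    rw [ha, hb]; exact_mod_cast (card_ones_add_card_twos A).symm
  rw [stepSum, Finset.sum_congr rfl h1, Finset.sum_congr rfl h2,
    ← Finset.mul_sum (s := A.image Prod.fst), Finset.sum_sub_distrib, sum_image_ite_twos]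
  simp only [Finset.sum_const, nsmul_eq_mul, hR, ← hk, ← hb]
  push_cast
  rw [← ha, ← hb]
  ring

theorem sum_afterAbsorb_sq_le {ρ : (V × Bool → V) → V} {w : V × Bool → ℝ}
    (h : HitMoments A T ρ w) (hw : ∀ s, 0 ≤ w s) {f : ℕ → ℕ → ℕ → ℝ} {m : ℝ}
    (hf : ∀ φ, |afterAbsorb f l A (ρ φ) φ| ≤ ∑ s ∈ A, hit (ρ φ) φ s) (hm : ∑ s ∈ A, w s ≤ m) :
    ∑ φ ∈ Fintype.piFinset T, afterAbsorb (fun X a b => f X a b ^ 2) l A (ρ φ) φ ≤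
      (Fintype.piFinset T).card * (m + m ^ 2) := by
  have h0 : 0 ≤ ∑ s ∈ A, w s := Finset.sum_nonneg fun s _ => hw s
  calc _ ≤ ∑ φ ∈ Fintype.piFinset T, (∑ s ∈ A, hit (ρ φ) φ s) ^ 2 :=
        Finset.sum_le_sum fun φ _ => sq_le_sq' (abs_le.1 (hf φ)).1 (abs_le.1 (hf φ)).2
    _ ≤ _ := h.sum_sq_le hw
    _ ≤ _ := by gcongr

theorem stepSum_sq_le (hs : IsState l A T) (hU : l.toFinsetᶜ.Nonempty) {B : ℝ} (hB1 : 1 ≤ B)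
    (hB : (Fintype.card V : ℝ) ≤ B * (l.toFinsetᶜ).card) {f : ℕ → ℕ → ℕ → ℝ}
    (hf : ∀ r φ, |afterAbsorb f l A r φ| ≤ ∑ s ∈ A, hit r φ s)
    (hf1 : |f l.length ((ones A).card + 1) (twos A).card| ≤ 1)
    (hf2 : 1 ≤ (ones A).card → |f l.length ((ones A).card - 1) ((twos A).card + 1)| ≤ 1)
    (hf3 : f l.length (ones A).card (twos A).card = 0) :
    stepSum l A T (fun X a b => f X a b ^ 2) ≤
      (Fintype.piFinset T).card * (38 * B ^ 2 * Fintype.card V) := by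
  set M : ℝ := ((Fintype.piFinset T).card : ℝ) with hM
  have hM0 : 0 ≤ M := Nat.cast_nonneg _
  set n : ℝ := (Fintype.card V : ℝ) with hn
  set k : ℝ := ((l.toFinsetᶜ).card : ℝ) with hk
  have hk0 : 0 < k := by rw [hk]; exact_mod_cast hU.card_pos
  have hRl : ((A.image Prod.fst).card : ℝ) ≤ l.length := by
    rw [← List.toFinset_card_of_nodup hs.nodup]
    exact_mod_cast Finset.card_le_card fun p hp => List.mem_toFinset.2 (hs.spaced.mem hp)
  have hR := hs.card_add
  have hones : ((ones A).card : ℝ) ≤ (A.image Prod.fst).card := by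
    exact_mod_cast Finset.card_le_card (Finset.filter_subset _ _)
  have hA : (A.card : ℝ) ≤ 2 * n := by
    have h1 : A.card ≤ (A.image Prod.fst).card * 2 := by
      have h2 : A ⊆ A.image Prod.fst ×ˢ (Finset.univ : Finset Bool) := fun s hs =>
        Finset.mem_product.2 ⟨Finset.mem_image_of_mem _ hs, Finset.mem_univ _⟩
      simpa using Finset.card_le_card h2
    have h3 : (A.card : ℝ) ≤ (A.image Prod.fst).card * 2 := by exact_mod_cast h1
    linarith
  have hm : (A.card : ℝ) * (1 / k) + 1 ≤ 3 * B := by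
    have : (A.card : ℝ) * (1 / k) ≤ 2 * B := by
      rw [mul_one_div, div_le_iff₀ hk0]; linarith
    linarith
  have b1 : ∀ u ∈ l.toFinsetᶜ, ∑ φ ∈ Fintype.piFinset T,
      afterAbsorb (fun X a b => f X a b ^ 2) l A u φ ≤ M * (3 * B + (3 * B) ^ 2) := fun u hu =>
    sum_afterAbsorb_sq_le (hs.hitMoments_const (by simpa using hu)) (fun s => by positivity)
      (hf u) (by simp only [Finset.sum_const, nsmul_eq_mul]; linarith)
  have b2 : ∀ p ∈ A.image Prod.fst, ∑ φ ∈ Fintype.piFinset T,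
      afterAbsorb (fun X a b => f X a b ^ 2) l A (φ (slot A p)) φ ≤
        M * (3 * B + (3 * B) ^ 2) := fun p hp => by
    refine sum_afterAbsorb_sq_le (hs.hitMoments_slot (slot_mem hp) hU)
      (fun s => by split_ifs <;> positivity) (fun φ => hf _ φ) (le_trans ?_ hm)
    calc ∑ s ∈ A, (if s = slot A p then 1 else 1 / k)
        ≤ ∑ s ∈ A, (1 / k + if s = slot A p then 1 else 0) := by
          refine Finset.sum_le_sum fun s _ => ?_
          have : 0 ≤ 1 / k := by positivity
          split_ifs <;> linarith
      _ ≤ _ := by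
          rw [Finset.sum_add_distrib, Finset.sum_ite_eq']
          simp [slot_mem hp]
  have hq : ((l.length - (5 * (A.image Prod.fst).card + 2) : ℕ) : ℝ) ≤ l.length := by
    exact_mod_cast Nat.sub_le _ _
  have b3 : (f l.length ((ones A).card + 1) (twos A).card) ^ 2 ≤ 1 := by
    rw [sq_le_one_iff_abs_le_one]; exact hf1
  have b4 : ((ones A).card : ℝ) * (f l.length ((ones A).card - 1) ((twos A).card + 1)) ^ 2 ≤
      (ones A).card := by
    rcases Nat.eq_zero_or_pos (ones A).card with h | h
    · simp [h]
    · refine mul_le_of_le_one_right (Nat.cast_nonneg _) ?_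
      rw [sq_le_one_iff_abs_le_one]; exact hf2 h
  rw [stepSum, hf3]
  have c1 := Finset.sum_le_sum b1
  have c2 := Finset.sum_le_sum b2
  rw [Finset.sum_const, nsmul_eq_mul, ← hk] at c1
  rw [Finset.sum_const, nsmul_eq_mul] at c2
  have c3 : ((l.length - (5 * (A.image Prod.fst).card + 2) : ℕ) : ℝ) *
      (f l.length ((ones A).card + 1) (twos A).card) ^ 2 ≤ l.length :=
    (mul_le_of_le_one_right (Nat.cast_nonneg _) b3).trans hq
  have c4 : k * (M * (3 * B + (3 * B) ^ 2)) +
      2 * ((A.image Prod.fst).card * (M * (3 * B + (3 * B) ^ 2))) ≤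
        M * (36 * B ^ 2 * n) := by
    have e1 : k + 2 * ((A.image Prod.fst).card : ℝ) ≤ 3 * n := by linarith
    have e2 : 3 * B + (3 * B) ^ 2 ≤ 12 * B ^ 2 := by nlinarith
    have e3 : 0 ≤ 3 * B + (3 * B) ^ 2 := by positivity
    calc _ = M * ((k + 2 * ((A.image Prod.fst).card : ℝ)) * (3 * B + (3 * B) ^ 2)) := by ring
      _ ≤ M * ((3 * n) * (12 * B ^ 2)) := by gcongr
      _ = _ := by ring
  have c5 : M * (((l.length - (5 * (A.image Prod.fst).card + 2) : ℕ) : ℝ) *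
      (f l.length ((ones A).card + 1) (twos A).card) ^ 2 + ((ones A).card : ℝ) *
        (f l.length ((ones A).card - 1) ((twos A).card + 1)) ^ 2) ≤ M * (2 * B ^ 2 * n) := by
    gcongr
    have : n ≤ B ^ 2 * n := le_mul_of_one_le_left (Nat.cast_nonneg _) (by nlinarith)
    linarith
  simp only [ne_eq, OfNat.ofNat_ne_zero, not_false_eq_true, zero_pow, mul_zero, add_zero]
  calc _ ≤ k * (M * (3 * B + (3 * B) ^ 2)) +
        2 * ((A.image Prod.fst).card * (M * (3 * B + (3 * B) ^ 2))) + M * (2 * B ^ 2 * n) := by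
        gcongr
    _ ≤ M * (36 * B ^ 2 * n) + M * (2 * B ^ 2 * n) := by gcongr
    _ = _ := by ring

theorem stepSum_ones_sq_le (hs : IsState l A T) (hU : l.toFinsetᶜ.Nonempty) {B : ℝ}
    (hB1 : 1 ≤ B) (hB : (Fintype.card V : ℝ) ≤ B * (l.toFinsetᶜ).card) :
    stepSum l A T (fun _ a _ => ((a : ℝ) - (ones A).card) ^ 2) ≤
      (Fintype.piFinset T).card * (38 * B ^ 2 * Fintype.card V) := by
  refine stepSum_sq_le hs hU hB1 hB (f := fun _ a _ => (a : ℝ) - (ones A).card)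
    (fun r φ => abs_card_ones_filter_le A r φ) (by simp) (fun h => ?_) (by simp)
  rw [Nat.cast_sub h]; simp

theorem stepSum_twos_sq_le (hs : IsState l A T) (hU : l.toFinsetᶜ.Nonempty) {B : ℝ}
    (hB1 : 1 ≤ B) (hB : (Fintype.card V : ℝ) ≤ B * (l.toFinsetᶜ).card) :
    stepSum l A T (fun _ _ b => ((b : ℝ) - (twos A).card) ^ 2) ≤
      (Fintype.piFinset T).card * (38 * B ^ 2 * Fintype.card V) :=
  stepSum_sq_le hs hU hB1 hB (f := fun _ _ b => (b : ℝ) - (twos A).card)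
    (fun r φ => abs_card_twos_filter_le A r φ) (by simp) (fun _ => by simp) (by simp)

theorem abs_ones_drift_le {a b k X q n B : ℝ} (ha : 0 ≤ a) (hb : 0 ≤ b) (hX : 0 ≤ X) (hk : 1 ≤ k)
    (hn : X + k = n) (hab : a + b ≤ n) (hB1 : 1 ≤ B) (hB : n ≤ B * k)
    (hq : |q - (X - 5 * (a + b))| ≤ 2) :
    |(k * (-(a / k) + b * (2 / k - 2 / k ^ 2)) +
          2 * ((a + b) * (-(a / k) + b * (2 / k - 2 / k ^ 2)) - (1 - 1 / k) * a +
            (1 - 1 / k) * (1 - 2 / k) * b) + q - a) -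
      n * rhsL₁ (X / n) (a / n) (b / n)| ≤ 20 * B ^ 2 := by
  have hk0 : k ≠ 0 := by positivity
  have hn0 : n ≠ 0 := by linarith
  have hy : 1 - X / n = k / n := by rw [← hn]; rw [← hn] at hn0; field_simp; ring
  set α := a / k with hα
  set β := b / k with hβ
  set i := 1 / k with hi
  have ea : a = α * k := by rw [hα]; field_simp
  have eb : b = β * k := by rw [hβ]; field_simp
  have hi0 : 0 ≤ i := by positivity
  have hi1 : i ≤ 1 := by rw [hi, div_le_one (by linarith)]; exact hk
  have hα0 : 0 ≤ α := by positivity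
  have hβ0 : 0 ≤ β := by positivity
  have hαβ : α + β ≤ B := by
    rw [hα, hβ, ← add_div, div_le_iff₀ (by linarith)]; linarith
  have key : (k * (-(a / k) + b * (2 / k - 2 / k ^ 2)) +
          2 * ((a + b) * (-(a / k) + b * (2 / k - 2 / k ^ 2)) - (1 - 1 / k) * a +
            (1 - 1 / k) * (1 - 2 / k) * b) + q - a) -
      n * rhsL₁ (X / n) (a / n) (b / n) =
      -2 * β + 2 * (-2 * (α + β) * β + α + β * (-3 + 2 * i)) + (q - (X - 5 * (a + b))) := by
    rw [rhsL₁, hy, hα, hβ, hi]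
    field_simp
    ring
  rw [key]
  rw [abs_le] at hq ⊢
  have hB0 : B ≤ B ^ 2 := by nlinarith
  have e1 : 0 ≤ (α + β) * β := by positivity
  have e2 : (α + β) * β ≤ B ^ 2 := by nlinarith
  have e3 : 0 ≤ β * i := by positivity
  have e4 : β * i ≤ β := mul_le_of_le_one_right hβ0 hi1
  constructor <;> nlinarith

theorem abs_twos_drift_le {a b k X n B : ℝ} (ha : 0 ≤ a) (hb : 0 ≤ b) (hX : 0 ≤ X) (hk : 1 ≤ k)
    (hn : X + k = n) (hab : a + b ≤ n) (hB1 : 1 ≤ B) (hB : n ≤ B * k) :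
    |(k * (b * (-(2 / k) + 1 / k ^ 2)) +
          2 * ((a + b) * (b * (-(2 / k) + 1 / k ^ 2)) - (1 - 1 / k) ^ 2 * b) + a) -
      n * rhsL₂ (X / n) (a / n) (b / n)| ≤ 20 * B ^ 2 := by
  have hk0 : k ≠ 0 := by positivity
  have hn0 : n ≠ 0 := by linarith
  have hy : 1 - X / n = k / n := by rw [← hn]; rw [← hn] at hn0; field_simp; ring
  set α := a / k with hα
  set β := b / k with hβ
  set i := 1 / k with hi
  have hi0 : 0 ≤ i := by positivity
  have hi1 : i ≤ 1 := by rw [hi, div_le_one (by linarith)]; exact hk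
  have hα0 : 0 ≤ α := by positivity
  have hβ0 : 0 ≤ β := by positivity
  have hαβ : α + β ≤ B := by
    rw [hα, hβ, ← add_div, div_le_iff₀ (by linarith)]; linarith
  have key : (k * (b * (-(2 / k) + 1 / k ^ 2)) +
          2 * ((a + b) * (b * (-(2 / k) + 1 / k ^ 2)) - (1 - 1 / k) ^ 2 * b) + a) -
      n * rhsL₂ (X / n) (a / n) (b / n) =
      β + 2 * ((α + β) * β + β * (2 - i)) := by
    rw [rhsL₂, hy, hα, hβ, hi]
    field_simp
    ring
  rw [key]
  rw [abs_le]
  have hB0 : B ≤ B ^ 2 := by nlinarith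
  have e1 : 0 ≤ (α + β) * β := by positivity
  have e2 : (α + β) * β ≤ B ^ 2 := by nlinarith
  have e3 : 0 ≤ β * i := by positivity
  have e4 : β * i ≤ β := mul_le_of_le_one_right hβ0 hi1
  constructor <;> nlinarith

/-- The squared distance to the point `(c₁, c₂, c₃)`. -/
def sqDist (c₁ c₂ c₃ : ℝ) (X a b : ℕ) : ℝ := (X - c₁) ^ 2 + (a - c₂) ^ 2 + (b - c₃) ^ 2

/-- The change of the squared distance to a point in one step. -/
theorem stepSum_sqDist_le (hs : IsState l A T) (hU : l.toFinsetᶜ.Nonempty) {B : ℝ}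
    (hB1 : 1 ≤ B) (hB : (Fintype.card V : ℝ) ≤ B * (l.toFinsetᶜ).card) {n x a b : ℝ}
    (hn : n = Fintype.card V) (hx : x = l.length) (ha : a = (ones A).card)
    (hb : b = (twos A).card) (c₁ c₂ c₃ : ℝ) :
    stepSum l A T (sqDist c₁ c₂ c₃) ≤ (Fintype.piFinset T).card *
      (n * ((x - c₁) ^ 2 + (a - c₂) ^ 2 + (b - c₃) ^ 2) +
        2 * ((x - c₁) * (n * rhsX (x / n) (a / n) (b / n)) +
          (a - c₂) * (n * rhsL₁ (x / n) (a / n) (b / n)) +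
          (b - c₃) * (n * rhsL₂ (x / n) (a / n) (b / n))) +
        40 * B ^ 2 * (|a - c₂| + |b - c₃|) + 79 * B ^ 2 * n) := by
  set M : ℝ := ((Fintype.piFinset T).card : ℝ) with hM
  have hM0 : 0 ≤ M := Nat.cast_nonneg _
  obtain ⟨k, hk⟩ : ∃ k : ℝ, k = (l.toFinsetᶜ).card := ⟨_, rfl⟩
  have hk1 : 1 ≤ k := by rw [hk]; exact_mod_cast hU.card_pos
  have hxk : x + k = n := by rw [hx, hk, hn]; exact hs.card_add
  rw [← hn, ← hk] at hB
  have ha0 : 0 ≤ a := by rw [ha]; positivity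
  have hb0 : 0 ≤ b := by rw [hb]; positivity
  have hx0 : 0 ≤ x := by rw [hx]; positivity
  have hR : ((A.image Prod.fst).card : ℝ) = a + b := by
    rw [ha, hb]; exact_mod_cast (card_ones_add_card_twos A).symm
  have hRl : a + b ≤ x := by
    rw [← hR, hx, ← List.toFinset_card_of_nodup hs.nodup]
    exact_mod_cast Finset.card_le_card fun p hp => List.mem_toFinset.2 (hs.spaced.mem hp)
  have hn0 : 0 < n := by linarith
  have hq : |((l.length - (5 * (A.image Prod.fst).card + 2) : ℕ) : ℝ) - (x - 5 * (a + b))| ≤ 2 := by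
    have h5 := hs.card_le
    rw [← hR, hx]
    rcases le_total (5 * (A.image Prod.fst).card + 2) l.length with h | h
    · rw [Nat.cast_sub h, abs_le]
      push_cast
      constructor <;> linarith
    · rw [Nat.sub_eq_zero_of_le h, abs_le]
      have h5' : (5 * (A.image Prod.fst).card : ℝ) ≤ l.length + 2 := by exact_mod_cast h5
      have h' : (l.length : ℝ) ≤ 5 * (A.image Prod.fst).card + 2 := by exact_mod_cast h
      push_cast
      constructor <;> linarith
  have hdec : sqDist c₁ c₂ c₃ = fun X a' b' : ℕ =>
      ((x - c₁) ^ 2 + (a - c₂) ^ 2 + (b - c₃) ^ 2) +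
      (2 * (x - c₁) * ((X : ℝ) - l.length) + (((X : ℝ) - l.length) ^ 2 +
      (2 * (a - c₂) * ((a' : ℝ) - a) + (((a' : ℝ) - (ones A).card) ^ 2 +
      (2 * (b - c₃) * ((b' : ℝ) - b) + ((b' : ℝ) - (twos A).card) ^ 2))))) := by
    funext X a' b'
    rw [sqDist, ← hx, ← ha, ← hb]
    ring
  have d1 := abs_ones_drift_le ha0 hb0 hx0 hk1 hxk (by linarith) hB1 hB hq
  have d2 := abs_twos_drift_le ha0 hb0 hx0 hk1 hxk (by linarith) hB1 hB
  set S₁ := k * (-(a / k) + b * (2 / k - 2 / k ^ 2)) +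
          2 * ((a + b) * (-(a / k) + b * (2 / k - 2 / k ^ 2)) - (1 - 1 / k) * a +
            (1 - 1 / k) * (1 - 2 / k) * b) +
          ((l.length - (5 * (A.image Prod.fst).card + 2) : ℕ) : ℝ) - a with hS₁
  set S₂ := k * (b * (-(2 / k) + 1 / k ^ 2)) +
          2 * ((a + b) * (b * (-(2 / k) + 1 / k ^ 2)) - (1 - 1 / k) ^ 2 * b) + a with hS₂
  have e2 := stepSum_ones_sq_le hs hU hB1 (by rw [← hn, ← hk]; exact hB)
  have e3 := stepSum_twos_sq_le hs hU hB1 (by rw [← hn, ← hk]; exact hB)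
  rw [hdec, stepSum_add, stepSum_const hs, stepSum_add, stepSum_mul, stepSum_length, stepSum_add,
    stepSum_length_sq, stepSum_add, stepSum_mul, stepSum_ones hs hU ha hb hk, stepSum_add,
    stepSum_add, stepSum_mul, stepSum_twos hs hU ha hb hk, ← hS₁, ← hS₂, ← hM, ← hn, ← hk, ← ha,
    ← hb]
  rw [← hn, ← hM, ← ha] at e2
  rw [← hn, ← hM, ← hb] at e3
  clear_value S₁ S₂
  have f1 : n * rhsX (x / n) (a / n) (b / n) = k + 2 * (a + b) := by
    rw [rhsX, ← hxk]
    rw [← hxk] at hn0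
    field_simp
    ring
  have f2 : (a - c₂) * S₁ ≤ (a - c₂) * (n * rhsL₁ (x / n) (a / n) (b / n)) +
      20 * B ^ 2 * |a - c₂| := by
    have := mul_le_mul_of_nonneg_left d1 (abs_nonneg (a - c₂))
    rw [← abs_mul] at this
    have := (le_abs_self _).trans this
    linarith
  have f3 : (b - c₃) * S₂ ≤ (b - c₃) * (n * rhsL₂ (x / n) (a / n) (b / n)) +
      20 * B ^ 2 * |b - c₃| := by
    have := mul_le_mul_of_nonneg_left d2 (abs_nonneg (b - c₃))
    rw [← abs_mul] at this
    have := (le_abs_self _).trans this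
    linarith
  have f4 : k + 2 * (a + b) ≤ 3 * B ^ 2 * n := by
    have : n ≤ B ^ 2 * n := le_mul_of_one_le_left hn0.le (by nlinarith)
    linarith
  rw [f1]
  clear hB hR hRl hq hdec d1 d2 hS₁ hS₂
  have g2 := mul_le_mul_of_nonneg_left f2 hM0
  have g3 := mul_le_mul_of_nonneg_left f3 hM0
  have g4 := mul_le_mul_of_nonneg_left f4 hM0
  linarith

end Drift

end SemiRandom
namespace SemiRandom

set_option linter.unusedSectionVars false

/-! ## Following a solution of the differential equations -/

/-- The growth constant of the expected squared distance to a solution. -/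
def growthConst (B L C : ℝ) : ℝ :=
  6 * L + 6 * C + 36 * C * L + 12 * C ^ 2 + 200 * B ^ 2 + 160 * B ^ 2 * C

theorem growthConst_pos {B L C : ℝ} (hB : 1 ≤ B) (hL : 0 ≤ L) (hC : 0 ≤ C) :
    0 < growthConst B L C := by
  unfold growthConst; positivity

theorem one_step_real {a₁ a₂ a₃ d₁ d₂ d₃ r₁ r₂ r₃ n B L C : ℝ} (hn : 1 ≤ n) (hL : 0 ≤ L)
    (hC : 0 ≤ C) (hA : |a₁| + |a₂| + |a₃| ≤ 3 * n)
    (h₁ : n * |r₁ - d₁| ≤ L * (|a₁| + |a₂| + |a₃|) + C)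
    (h₂ : n * |r₂ - d₂| ≤ L * (|a₁| + |a₂| + |a₃|) + C)
    (h₃ : n * |r₃ - d₃| ≤ L * (|a₁| + |a₂| + |a₃|) + C)
    (hd₁ : |d₁| ≤ 2 * C) (hd₂ : |d₂| ≤ 2 * C) (hd₃ : |d₃| ≤ 2 * C) :
    n * ((a₁ - d₁) ^ 2 + (a₂ - d₂) ^ 2 + (a₃ - d₃) ^ 2) +
        2 * ((a₁ - d₁) * (n * r₁) + (a₂ - d₂) * (n * r₂) + (a₃ - d₃) * (n * r₃)) +
        40 * B ^ 2 * (|a₂ - d₂| + |a₃ - d₃|) + 79 * B ^ 2 * n ≤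
      n * (a₁ ^ 2 + a₂ ^ 2 + a₃ ^ 2) +
        growthConst B L C * (a₁ ^ 2 + a₂ ^ 2 + a₃ ^ 2 + n) := by
  set A := |a₁| + |a₂| + |a₃| with hAdef
  have hA0 : 0 ≤ A := by positivity
  have key : ∀ a d r : ℝ, n * |r - d| ≤ L * A + C → |d| ≤ 2 * C →
      n * (a - d) ^ 2 + 2 * ((a - d) * (n * r)) ≤
        n * a ^ 2 + 2 * |a| * (L * A + C) + 4 * C * (L * A + C) := by
    intro a d r h hd
    have e1 : n * (a * (r - d)) ≤ |a| * (L * A + C) := by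
      calc n * (a * (r - d)) ≤ n * (|a| * |r - d|) := by
            rw [← abs_mul]; gcongr; exact le_abs_self _
        _ = |a| * (n * |r - d|) := by ring
        _ ≤ _ := by gcongr
    have e2 : -(n * (d * (r - d))) ≤ 2 * C * (L * A + C) := by
      calc -(n * (d * (r - d))) = n * (-(d * (r - d))) := by ring
        _ ≤ n * (|d| * |r - d|) := by
            rw [← abs_mul]; gcongr; exact neg_le_abs _
        _ = |d| * (n * |r - d|) := by ring
        _ ≤ 2 * C * (n * |r - d|) := by gcongr
        _ ≤ _ := by gcongr
    have e3 : 0 ≤ n * d ^ 2 := by positivity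
    nlinarith
  have k₁ := key a₁ d₁ r₁ h₁ hd₁
  have k₂ := key a₂ d₂ r₂ h₂ hd₂
  have k₃ := key a₃ d₃ r₃ h₃ hd₃
  have hsq : A ^ 2 ≤ 3 * (a₁ ^ 2 + a₂ ^ 2 + a₃ ^ 2) := by
    have e1 := sq_abs a₁
    have e2 := sq_abs a₂
    have e3 := sq_abs a₃
    nlinarith [sq_nonneg (|a₁| - |a₂|), sq_nonneg (|a₁| - |a₃|), sq_nonneg (|a₂| - |a₃|)]
  have m₁ : 2 * A * (L * A + C) ≤ 6 * L * (a₁ ^ 2 + a₂ ^ 2 + a₃ ^ 2) + 6 * C * n := by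
    have := mul_le_mul_of_nonneg_left hsq hL
    have := mul_le_mul_of_nonneg_left hA hC
    nlinarith
  have m₂ : 12 * C * (L * A + C) ≤ 36 * C * L * n + 12 * C ^ 2 * n := by
    have := mul_le_mul_of_nonneg_left hA (mul_nonneg hC hL)
    have := mul_le_mul_of_nonneg_left hn (mul_nonneg hC hC)
    nlinarith
  have m₃ : 40 * B ^ 2 * (|a₂ - d₂| + |a₃ - d₃|) ≤ 120 * B ^ 2 * n + 160 * B ^ 2 * C * n := by
    have e1 : |a₂ - d₂| + |a₃ - d₃| ≤ 3 * n + 4 * C * n := by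
      have f1 := abs_sub a₂ d₂
      have f2 := abs_sub a₃ d₃
      have f3 := abs_nonneg a₁
      have f4 : C ≤ C * n := le_mul_of_one_le_right hC hn
      linarith
    have := mul_le_mul_of_nonneg_left e1 (sq_nonneg B)
    linarith
  have hD : 0 ≤ a₁ ^ 2 + a₂ ^ 2 + a₃ ^ 2 := by positivity
  have m₄ : 0 ≤ (6 * C + 36 * C * L + 12 * C ^ 2 + 200 * B ^ 2 + 160 * B ^ 2 * C) *
      (a₁ ^ 2 + a₂ ^ 2 + a₃ ^ 2) := by positivity
  have m₅ : 0 ≤ (6 * L + B ^ 2) * n := by positivity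
  have m₆ : 2 * |a₁| * (L * A + C) + 2 * |a₂| * (L * A + C) + 2 * |a₃| * (L * A + C) =
      2 * A * (L * A + C) := by rw [hAdef]; ring
  clear_value A
  unfold growthConst
  linarith

section Tracking

variable {V : Type*} [DecidableEq V] [Fintype V] [Nonempty V]

/-- The functions `z₁`, `z₂`, `z₃` follow the differential equations along the grid of mesh `1 / n`
up to an error of order `1 / n²` per step, and the right-hand sides are Lipschitz near them. -/
structure FollowsRhs (z₁ z₂ z₃ : ℝ → ℝ) (n : ℝ) (N : ℕ) (δ B L C : ℝ) : Prop where
  zero₁ : z₁ 0 = 0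
  zero₂ : z₂ 0 = 0
  zero₃ : z₃ 0 = 0
  step₁ : ∀ i < N, |n * (z₁ ((i + 1 : ℕ) / n) - z₁ (i / n)) -
    rhsX (z₁ (i / n)) (z₂ (i / n)) (z₃ (i / n))| ≤ C / n
  step₂ : ∀ i < N, |n * (z₂ ((i + 1 : ℕ) / n) - z₂ (i / n)) -
    rhsL₁ (z₁ (i / n)) (z₂ (i / n)) (z₃ (i / n))| ≤ C / n
  step₃ : ∀ i < N, |n * (z₃ ((i + 1 : ℕ) / n) - z₃ (i / n)) -
    rhsL₂ (z₁ (i / n)) (z₂ (i / n)) (z₃ (i / n))| ≤ C / n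
  bound₁ : ∀ i < N, |rhsX (z₁ (i / n)) (z₂ (i / n)) (z₃ (i / n))| ≤ C
  bound₂ : ∀ i < N, |rhsL₁ (z₁ (i / n)) (z₂ (i / n)) (z₃ (i / n))| ≤ C
  bound₃ : ∀ i < N, |rhsL₂ (z₁ (i / n)) (z₂ (i / n)) (z₃ (i / n))| ≤ C
  lip : ∀ i < N, ∀ x a b : ℝ, |x - z₁ (i / n)| ≤ δ → |a - z₂ (i / n)| ≤ δ →
    |b - z₃ (i / n)| ≤ δ → 1 ≤ B * (1 - x) ∧
    |rhsX x a b - rhsX (z₁ (i / n)) (z₂ (i / n)) (z₃ (i / n))| ≤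
      L * (|x - z₁ (i / n)| + |a - z₂ (i / n)| + |b - z₃ (i / n)|) ∧
    |rhsL₁ x a b - rhsL₁ (z₁ (i / n)) (z₂ (i / n)) (z₃ (i / n))| ≤
      L * (|x - z₁ (i / n)| + |a - z₂ (i / n)| + |b - z₃ (i / n)|) ∧
    |rhsL₂ x a b - rhsL₂ (z₁ (i / n)) (z₂ (i / n)) (z₃ (i / n))| ≤
      L * (|x - z₁ (i / n)| + |a - z₂ (i / n)| + |b - z₃ (i / n)|)

variable {P : SimpleGraph V → Prop} {z₁ z₂ z₃ : ℝ → ℝ} {n : ℝ} {N : ℕ} {δ B L C : ℝ}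

theorem FollowsRhs.stepSum_le (hz : FollowsRhs z₁ z₂ z₃ n N δ B L C) (hn : n = Fintype.card V)
    (hδ1 : δ ≤ 1) (hB : 1 ≤ B) (hL : 0 ≤ L) (hC : 0 ≤ C) {i : ℕ} (hi : i < N)
    {l : List V} {A : Finset (V × Bool)} {T : V × Bool → Finset V} (hs : IsState l A T)
    (hδ : sqDist (n * z₁ (i / n)) (n * z₂ (i / n)) (n * z₃ (i / n)) l.length (ones A).card
      (twos A).card ≤ (δ * n) ^ 2) (hδ0 : 0 ≤ δ) :
    l.toFinsetᶜ.Nonempty ∧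
    stepSum l A T (sqDist (n * z₁ ((i + 1 : ℕ) / n)) (n * z₂ ((i + 1 : ℕ) / n))
        (n * z₃ ((i + 1 : ℕ) / n))) ≤
      (Fintype.piFinset T).card * ((n + growthConst B L C) *
        sqDist (n * z₁ (i / n)) (n * z₂ (i / n)) (n * z₃ (i / n)) l.length (ones A).card
          (twos A).card + growthConst B L C * n) := by
  have hn1 : 1 ≤ n := by rw [hn]; exact_mod_cast Fintype.card_pos
  have hn0 : 0 < n := by linarith
  obtain ⟨x, hx⟩ : ∃ x : ℝ, x = l.length := ⟨_, rfl⟩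
  obtain ⟨a, ha⟩ : ∃ a : ℝ, a = (ones A).card := ⟨_, rfl⟩
  obtain ⟨b, hb⟩ : ∃ b : ℝ, b = (twos A).card := ⟨_, rfl⟩
  simp only [sqDist, ← hx, ← ha, ← hb] at hδ ⊢
  have hδn : 0 ≤ δ * n := by positivity
  have q₁ : |x - n * z₁ (i / n)| ≤ δ * n := abs_le_of_sq_le_sq (by nlinarith) hδn
  have q₂ : |a - n * z₂ (i / n)| ≤ δ * n := abs_le_of_sq_le_sq (by nlinarith) hδn
  have q₃ : |b - n * z₃ (i / n)| ≤ δ * n := abs_le_of_sq_le_sq (by nlinarith) hδn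
  have scale : ∀ y w : ℝ, |y - n * w| = n * |y / n - w| := by
    intro y w
    rw [← abs_of_pos hn0, ← abs_mul, abs_of_pos hn0]
    congr 1
    field_simp
  have p : ∀ y w : ℝ, |y - n * w| ≤ δ * n → |y / n - w| ≤ δ := by
    intro y w h
    rw [scale, mul_comm δ] at h
    exact le_of_mul_le_mul_left h hn0
  obtain ⟨g0, g1, g2, g3⟩ := hz.lip i hi (x / n) (a / n) (b / n) (p _ _ q₁) (p _ _ q₂) (p _ _ q₃)
  have hxk := hs.card_add
  rw [← hx, ← hn] at hxk
  have hBk : (Fintype.card V : ℝ) ≤ B * (l.toFinsetᶜ).card := by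
    rw [← hn]
    have h1 : n * 1 ≤ n * (B * (1 - x / n)) := by gcongr
    have h2 : n * (B * (1 - x / n)) = B * (n - x) := by field_simp
    rw [h2, mul_one] at h1
    have h3 : ((l.toFinsetᶜ).card : ℝ) = n - x := by linarith
    rwa [h3]
  have hU : l.toFinsetᶜ.Nonempty := by
    rw [← Finset.card_pos]
    by_contra! h
    have : (l.toFinsetᶜ).card = 0 := by lia
    rw [this, ← hn] at hBk
    simp at hBk
    linarith
  refine ⟨hU, ?_⟩
  refine (stepSum_sqDist_le hs hU hB hBk hn hx ha hb _ _ _).trans ?_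
  refine mul_le_mul_of_nonneg_left ?_ (Nat.cast_nonneg _)
  have conv : ∀ {r ρ d S : ℝ}, |r - ρ| ≤ L * S → |d - ρ| ≤ C / n →
      n * |r - d| ≤ L * (n * S) + C := by
    intro r ρ d S h1 h2
    have h3 : |r - d| ≤ L * S + C / n := by
      calc |r - d| = |(r - ρ) - (d - ρ)| := by ring_nf
        _ ≤ |r - ρ| + |d - ρ| := abs_sub _ _
        _ ≤ _ := add_le_add h1 h2
    calc n * |r - d| ≤ n * (L * S + C / n) := by gcongr
      _ = _ := by field_simp
  have small : ∀ {ρ d : ℝ}, |d - ρ| ≤ C / n → |ρ| ≤ C → |d| ≤ 2 * C := by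
    intro ρ d h1 h2
    have h3 : C / n ≤ C := div_le_self hC hn1
    have h4 := abs_sub_abs_le_abs_sub d ρ
    linarith
  have hS : n * (|x / n - z₁ (i / n)| + |a / n - z₂ (i / n)| + |b / n - z₃ (i / n)|) =
      |x - n * z₁ (i / n)| + |a - n * z₂ (i / n)| + |b - n * z₃ (i / n)| := by
    rw [scale, scale, scale]; ring
  have c₁ := conv g1 (hz.step₁ i hi)
  have c₂ := conv g2 (hz.step₂ i hi)
  have c₃ := conv g3 (hz.step₃ i hi)
  rw [hS] at c₁ c₂ c₃
  have hδn1 : δ * n ≤ n := mul_le_of_le_one_left hn0.le hδ1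
  have := one_step_real (B := B) hn1 hL hC (by linarith) c₁ c₂ c₃
    (small (hz.step₁ i hi) (hz.bound₁ i hi)) (small (hz.step₂ i hi) (hz.bound₂ i hi))
    (small (hz.step₃ i hi) (hz.bound₃ i hi))
  refine le_trans (le_of_eq ?_) (this.trans (le_of_eq ?_))
  · have e : ∀ y w w' : ℝ, y - n * w - n * (w' - w) = y - n * w' := fun y w w' => by ring
    simp only [e]
  · ring

/-- The path-building strategy follows the solution of the differential equations. -/
theorem FollowsRhs.failProb_le (hz : FollowsRhs z₁ z₂ z₃ n N δ B L C) (hn : n = Fintype.card V)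
    (hδ0 : 0 < δ) (hδ1 : δ ≤ 1) (hB : 1 ≤ B) (hL : 0 ≤ L) (hC : 0 ≤ C) {t₀ : ℕ} {η : ℝ}
    (hη : 0 ≤ η) (hfin : ∀ (G : SimpleGraph V) (l : List V), l.Nodup → l.IsChain G.Adj →
      n * (z₁ (N / n) - δ) ≤ l.length → failProb P t₀ G ≤ η) :
    failProb P (t₀ + N) ⊥ ≤ η + growthConst B L C * N *
      (1 + growthConst B L C / n) ^ N / (δ * n) ^ 2 := by
  have hn1 : 1 ≤ n := by rw [hn]; exact_mod_cast Fintype.card_pos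
  have hn0 : 0 < n := by linarith
  set K := growthConst B L C with hKdef
  have hK : 0 < K := growthConst_pos hB hL hC
  have hδn : 0 < (δ * n) ^ 2 := by positivity
  have hbase : 1 ≤ 1 + K / n := by
    have : 0 < K / n := by positivity
    linarith
  let D : ℕ → ℕ → ℕ → ℕ → ℝ := fun i => sqDist (n * z₁ (i / n)) (n * z₂ (i / n)) (n * z₃ (i / n))
  have hD0 : ∀ i X a b, 0 ≤ D i X a b := fun i X a b => by
    simp only [D, sqDist]; positivity
  have key : ∀ t ≤ N, AvgBound P (t₀ + t) (fun X a b =>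
      η + (D (N - t) X a b + K * t) * (1 + K / n) ^ t / (δ * n) ^ 2) := by
    intro t
    induction t with
    | zero =>
      intro _ l A T 𝒢 hs h𝒢
      rw [← nsmul_eq_mul, ← Finset.sum_const]
      refine Finset.sum_le_sum fun φ hφ => ?_
      simp only [Nat.sub_zero, Nat.cast_zero, mul_zero, add_zero, pow_zero, mul_one]
      by_cases hD : D N l.length (ones A).card (twos A).card ≤ (δ * n) ^ 2
      · refine (hfin (𝒢 φ) l hs.nodup (h𝒢 φ hφ).1 ?_).trans
          (le_add_of_nonneg_right (div_nonneg (hD0 _ _ _ _) hδn.le))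
        simp only [D, sqDist] at hD
        have : |(l.length : ℝ) - n * z₁ (N / n)| ≤ δ * n :=
          abs_le_of_sq_le_sq (by nlinarith) (by positivity)
        rw [abs_le] at this
        linarith [this.1]
      · refine (failProb_le_one _ _).trans ?_
        have : 1 ≤ D N l.length (ones A).card (twos A).card / (δ * n) ^ 2 := by
          rw [one_le_div hδn]; exact (not_le.1 hD).le
        linarith
    | succ t ih =>
      intro ht l A T 𝒢 hs h𝒢
      have ih := ih (by lia)
      obtain ⟨i, hi⟩ : ∃ i, i = N - (t + 1) := ⟨_, rfl⟩
      have hi1 : N - t = i + 1 := by lia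
      rw [hi1] at ih
      rw [← hi]
      by_cases hD : D i l.length (ones A).card (twos A).card ≤ (δ * n) ^ 2
      · obtain ⟨hU, hstep⟩ := hz.stepSum_le hn hδ1 hB hL hC (by lia : i < N) hs hD hδ0.le
        have h1 := ih.step hs h𝒢 hU
        rw [← stepSum] at h1
        have hg : (fun X a b => η + (D (i + 1) X a b + K * t) * (1 + K / n) ^ t / (δ * n) ^ 2) =
            fun X a b => (η + K * t * (1 + K / n) ^ t / (δ * n) ^ 2) +
              (1 + K / n) ^ t / (δ * n) ^ 2 * D (i + 1) X a b := by
          funext X a b; ring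
        rw [hg, stepSum_add, stepSum_const hs, stepSum_mul, ← hn] at h1
        have h2 := mul_le_mul_of_nonneg_left hstep
          (show 0 ≤ (1 + K / n) ^ t / (δ * n) ^ 2 by positivity)
        refine le_of_mul_le_mul_left (h1.trans ((add_le_add_right h2 _).trans ?_)) hn0
        rw [← hKdef]
        change _ + _ * (_ * ((n + K) * D i l.length (ones A).card (twos A).card + K * n)) ≤ _
        beta_reduce
        obtain ⟨d, hd⟩ : ∃ d, d = D i l.length (ones A).card (twos A).card := ⟨_, rfl⟩
        rw [← hd]
        obtain ⟨M, hM⟩ : ∃ M : ℝ, M = (Fintype.piFinset T).card := ⟨_, rfl⟩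
        rw [← hM]
        have hM0 : 0 ≤ M := by rw [hM]; positivity
        obtain ⟨p, hp⟩ : ∃ p, p = (1 + K / n) ^ t / (δ * n) ^ 2 := ⟨_, rfl⟩
        have hp0 : 0 ≤ p := by rw [hp]; positivity
        have e1 : K * t * (1 + K / n) ^ t / (δ * n) ^ 2 = K * t * p := by rw [hp]; ring
        have e2 : (d + K * (t + 1 : ℕ)) * (1 + K / n) ^ (t + 1) / (δ * n) ^ 2 =
            (d + K * (t + 1)) * (1 + K / n) * p := by
          rw [hp, pow_succ]; push_cast; ring
        rw [e1, e2, ← hp]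
        have e3 : n * (M * (η + (d + K * (t + 1)) * (1 + K / n) * p)) -
            (M * (n * (η + K * t * p)) + p * (M * ((n + K) * d + K * n))) =
            M * p * K * (K * (t + 1)) := by
          field_simp
          ring
        have e4 : 0 ≤ M * p * K * (K * (t + 1)) := by positivity
        linarith
      · rw [← nsmul_eq_mul, ← Finset.sum_const]
        refine Finset.sum_le_sum fun φ hφ => (failProb_le_one _ _).trans ?_
        have h1 : 1 ≤ D i l.length (ones A).card (twos A).card / (δ * n) ^ 2 := by
          rw [one_le_div hδn]; exact (not_le.1 hD).le
        have h2 : D i l.length (ones A).card (twos A).card ≤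
            (D i l.length (ones A).card (twos A).card + K * (t + 1 : ℕ)) * (1 + K / n) ^ (t + 1) := by
          have h3 : (1 : ℝ) ≤ (1 + K / n) ^ (t + 1) := one_le_pow₀ hbase
          have h4 := hD0 i l.length (ones A).card (twos A).card
          have h5 : 0 ≤ K * (t + 1 : ℕ) := by positivity
          nlinarith
        have h3 := div_le_div_of_nonneg_right h2 hδn.le
        linarith
  obtain ⟨v⟩ := ‹Nonempty V›
  have hst : IsState ([] : List V) ∅ (fun _ => {v}) :=
    ⟨by simp, by simpa using spaced_empty _, by simp, by simp, by simp⟩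
  have := key N le_rfl [] ∅ _ (fun _ => ⊥) hst (fun φ _ => ⟨List.isChain_nil, by simp⟩)
  simp only [Finset.sum_const, nsmul_eq_mul] at this
  have hM : (0 : ℝ) < (Fintype.piFinset fun _ : V × Bool => ({v} : Finset V)).card := by
    rw [Fintype.card_piFinset]; simp
  have := le_of_mul_le_mul_left this hM
  refine this.trans (le_of_eq ?_)
  simp [D, sqDist, ones, twos, hz.zero₁, hz.zero₂, hz.zero₃]

end Tracking

end SemiRandom
namespace SemiRandom

/-! ## Solutions of the differential equations -/

theorem rhsL₁_eq (x a b : ℝ) :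
    rhsL₁ x a b = x - 9 * a - b + 2 * ((a + b) * (2 * b - a) * (1 - x)⁻¹) := by
  rw [rhsL₁]; simp only [div_eq_mul_inv]; ring

theorem rhsL₂_eq (x a b : ℝ) :
    rhsL₂ x a b = a - 4 * b - 4 * ((a + b) * b * (1 - x)⁻¹) := by
  rw [rhsL₂]; simp only [div_eq_mul_inv]; ring

theorem abs_mul_mul_sub_le {u v i u' v' i' U W I : ℝ} (hu' : |u'| ≤ U)
    (hv : |v| ≤ W) (hv' : |v'| ≤ W) (hi : |i| ≤ I) :
    |u * v * i - u' * v' * i'| ≤ |u - u'| * W * I + U * |v - v'| * I + U * W * |i - i'| := by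
  have hU : 0 ≤ U := (abs_nonneg _).trans hu'
  have hW : 0 ≤ W := (abs_nonneg _).trans hv
  have hI : 0 ≤ I := (abs_nonneg _).trans hi
  have e : u * v * i - u' * v' * i' = (u - u') * v * i + u' * (v - v') * i + u' * v' * (i - i') := by
    ring
  rw [e]
  refine (abs_add_three _ _ _).trans ?_
  simp only [abs_mul]
  gcongr

/-- The box in which the right-hand sides are bounded and Lipschitz. -/
def InBox (ε x a b : ℝ) : Prop := -2 ≤ x ∧ x ≤ 1 - ε ∧ |a| ≤ 3 ∧ |b| ≤ 3

section Box

variable {ε x a b x' a' b' : ℝ}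

theorem InBox.abs_inv_le (hε : 0 < ε) (h : InBox ε x a b) : |(1 - x)⁻¹| ≤ 1 / ε := by
  have : ε ≤ 1 - x := by linarith [h.2.1]
  rw [abs_of_pos (inv_pos.2 (by linarith)), ← one_div]
  exact one_div_le_one_div_of_le hε this

theorem InBox.abs_inv_sub_inv_le (hε : 0 < ε) (h : InBox ε x a b) (h' : InBox ε x' a' b') :
    |(1 - x)⁻¹ - (1 - x')⁻¹| ≤ |x - x'| * (1 / ε) * (1 / ε) := by
  have e1 : ε ≤ 1 - x := by linarith [h.2.1]
  have e2 : ε ≤ 1 - x' := by linarith [h'.2.1]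
  have e : (1 - x)⁻¹ - (1 - x')⁻¹ = (x - x') * (1 - x)⁻¹ * (1 - x')⁻¹ := by
    have : 1 - x ≠ 0 := by linarith
    have : 1 - x' ≠ 0 := by linarith
    field_simp
    ring
  rw [e, abs_mul, abs_mul]
  have := h.abs_inv_le hε
  have := h'.abs_inv_le hε
  gcongr

theorem InBox.lipschitz (hε : 0 < ε) (hε1 : ε ≤ 1) (h : InBox ε x a b) (h' : InBox ε x' a' b') :
    |rhsX x a b - rhsX x' a' b'| ≤ 200 / ε ^ 2 * (|x - x'| + |a - a'| + |b - b'|) ∧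
    |rhsL₁ x a b - rhsL₁ x' a' b'| ≤ 200 / ε ^ 2 * (|x - x'| + |a - a'| + |b - b'|) ∧
    |rhsL₂ x a b - rhsL₂ x' a' b'| ≤ 200 / ε ^ 2 * (|x - x'| + |a - a'| + |b - b'|) := by
  set S := |x - x'| + |a - a'| + |b - b'| with hS
  set I := 1 / ε with hI
  have hI1 : 1 ≤ I := by rw [hI, le_div_iff₀ hε]; linarith
  have hL : 200 / ε ^ 2 = 200 * I ^ 2 := by rw [hI]; field_simp
  have i1 := h.abs_inv_le hε
  have i2 := h'.abs_inv_le hε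
  have i3 := h.abs_inv_sub_inv_le hε h'
  rw [← hI] at i1 i2 i3
  have hx0 := abs_nonneg (x - x')
  have ha0 := abs_nonneg (a - a')
  have hb0 := abs_nonneg (b - b')
  have hS0 : 0 ≤ S := by positivity
  have s1 : |x - x'| ≤ S := by linarith
  have hab : |a + b - (a' + b')| ≤ S := by
    calc |a + b - (a' + b')| = |(a - a') + (b - b')| := by ring_nf
      _ ≤ |a - a'| + |b - b'| := abs_add_le _ _
      _ ≤ S := by linarith
  have hba : |2 * b - a - (2 * b' - a')| ≤ 2 * S := by
    calc |2 * b - a - (2 * b' - a')| = |2 * (b - b') - (a - a')| := by ring_nf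
      _ ≤ |2 * (b - b')| + |a - a'| := abs_sub _ _
      _ ≤ 2 * S := by rw [abs_mul, abs_two]; linarith
  have hbb : |b - b'| ≤ S := by linarith
  have b1 : |a' + b'| ≤ 6 := (abs_add_le _ _).trans (by linarith [h'.2.2.1, h'.2.2.2])
  have b2 : |2 * b - a| ≤ 9 := by
    refine (abs_sub _ _).trans ?_
    rw [abs_mul, abs_two]; linarith [h.2.2.1, h.2.2.2]
  have b3 : |2 * b' - a'| ≤ 9 := by
    refine (abs_sub _ _).trans ?_
    rw [abs_mul, abs_two]; linarith [h'.2.2.1, h'.2.2.2]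
  have hI2 : I ≤ I ^ 2 := by nlinarith
  have i4 : |(1 - x)⁻¹ - (1 - x')⁻¹| ≤ S * I ^ 2 := by
    refine i3.trans ?_
    rw [mul_assoc, ← sq]
    gcongr
  have t1 : |(a + b) * (2 * b - a) * (1 - x)⁻¹ - (a' + b') * (2 * b' - a') * (1 - x')⁻¹| ≤
      75 * (I ^ 2 * S) := by
    refine (abs_mul_mul_sub_le b1 b2 b3 i1).trans ?_
    have c1 : |a + b - (a' + b')| * 9 * I ≤ S * 9 * I ^ 2 := by gcongr
    have c2 : 6 * |2 * b - a - (2 * b' - a')| * I ≤ 6 * (2 * S) * I ^ 2 := by gcongr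
    have c3 : 6 * 9 * |(1 - x)⁻¹ - (1 - x')⁻¹| ≤ 6 * 9 * (S * I ^ 2) := by gcongr
    linarith
  have t2 : |(a + b) * b * (1 - x)⁻¹ - (a' + b') * b' * (1 - x')⁻¹| ≤ 27 * (I ^ 2 * S) := by
    refine (abs_mul_mul_sub_le b1 h.2.2.2 h'.2.2.2 i1).trans ?_
    have c1 : |a + b - (a' + b')| * 3 * I ≤ S * 3 * I ^ 2 := by gcongr
    have c2 : 6 * |b - b'| * I ≤ 6 * S * I ^ 2 := by gcongr
    have c3 : 6 * 3 * |(1 - x)⁻¹ - (1 - x')⁻¹| ≤ 6 * 3 * (S * I ^ 2) := by gcongr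
    linarith
  have hS2 : S ≤ I ^ 2 * S := le_mul_of_one_le_left hS0 (by nlinarith)
  rw [hL, rhsL₁_eq, rhsL₁_eq, rhsL₂_eq, rhsL₂_eq, rhsX, rhsX]
  simp only [abs_le] at s1 hab hbb t1 t2 ⊢
  have ha' : -S ≤ a - a' ∧ a - a' ≤ S := abs_le.1 (by linarith)
  refine ⟨⟨?_, ?_⟩, ⟨?_, ?_⟩, ⟨?_, ?_⟩⟩ <;> linarith

theorem InBox.bound (hε : 0 < ε) (hε1 : ε ≤ 1) (h : InBox ε x a b) :
    |rhsX x a b| ≤ 200 / ε ∧ |rhsL₁ x a b| ≤ 200 / ε ∧ |rhsL₂ x a b| ≤ 200 / ε := by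
  set I := 1 / ε with hI
  have hI1 : 1 ≤ I := by rw [hI, le_div_iff₀ hε]; linarith
  have hL : 200 / ε = 200 * I := by rw [hI]; field_simp
  have i1 := h.abs_inv_le hε
  rw [← hI] at i1
  have hx := h.1
  have hx' := h.2.1
  have ha := abs_le.1 h.2.2.1
  have hb := abs_le.1 h.2.2.2
  have b1 : |a + b| ≤ 6 := abs_le.2 ⟨by linarith, by linarith⟩
  have b2 : |2 * b - a| ≤ 9 := abs_le.2 ⟨by linarith, by linarith⟩
  have t1 : |(a + b) * (2 * b - a) * (1 - x)⁻¹| ≤ 6 * 9 * I := by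
    rw [abs_mul, abs_mul]; gcongr
  have t2 : |(a + b) * b * (1 - x)⁻¹| ≤ 6 * 3 * I := by
    rw [abs_mul, abs_mul]; gcongr; exact h.2.2.2
  rw [hL, rhsL₁_eq, rhsL₂_eq, rhsX]
  rw [abs_le] at t1 t2
  simp only [abs_le]
  refine ⟨⟨?_, ?_⟩, ⟨?_, ?_⟩, ⟨?_, ?_⟩⟩ <;> linarith

end Box

/-- The projection of the real line to the interval from `lo` to `hi`. -/
def clamp (lo hi x : ℝ) : ℝ := max lo (min hi x)

theorem abs_clamp_sub_clamp_le (lo hi x y : ℝ) : |clamp lo hi x - clamp lo hi y| ≤ |x - y| := by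
  unfold clamp
  have h1 : |max lo (min hi x) - max lo (min hi y)| ≤ |min hi x - min hi y| := by
    refine (abs_max_sub_max_le_max _ _ _ _).trans ?_
    simp
  refine h1.trans ((abs_min_sub_min_le_max _ _ _ _).trans ?_)
  simp

theorem clamp_of_mem {lo hi x : ℝ} (h1 : lo ≤ x) (h2 : x ≤ hi) : clamp lo hi x = x := by
  rw [clamp, min_eq_right h2, max_eq_right h1]

/-- The vector field of the differential equations, made globally bounded and Lipschitz. -/
noncomputable def clampedField (ε : ℝ) (p : ℝ × ℝ × ℝ) : ℝ × ℝ × ℝ :=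
  (rhsX (clamp (-2) (1 - ε) p.1) (clamp (-3) 3 p.2.1) (clamp (-3) 3 p.2.2),
    rhsL₁ (clamp (-2) (1 - ε) p.1) (clamp (-3) 3 p.2.1) (clamp (-3) 3 p.2.2),
    rhsL₂ (clamp (-2) (1 - ε) p.1) (clamp (-3) 3 p.2.1) (clamp (-3) 3 p.2.2))

theorem inBox_clamp {ε : ℝ} (hε1 : ε ≤ 1) (p : ℝ × ℝ × ℝ) :
    InBox ε (clamp (-2) (1 - ε) p.1) (clamp (-3) 3 p.2.1) (clamp (-3) 3 p.2.2) := by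
  have key : ∀ {lo hi x : ℝ}, lo ≤ hi → lo ≤ clamp lo hi x ∧ clamp lo hi x ≤ hi := by
    intro lo hi x h
    exact ⟨le_max_left _ _, max_le h (min_le_left _ _)⟩
  have h1 := key (lo := -2) (hi := 1 - ε) (x := p.1) (by linarith)
  have h2 := key (lo := -3) (hi := 3) (x := p.2.1) (by norm_num)
  have h3 := key (lo := -3) (hi := 3) (x := p.2.2) (by norm_num)
  exact ⟨h1.1, h1.2, abs_le.2 h2, abs_le.2 h3⟩

theorem lipschitzWith_clampedField {ε : ℝ} (hε : 0 < ε) (hε1 : ε ≤ 1) :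
    LipschitzWith (Real.toNNReal (600 / ε ^ 2)) (clampedField ε) := by
  refine LipschitzWith.of_dist_le_mul fun p q => ?_
  rw [Real.coe_toNNReal _ (by positivity)]
  obtain ⟨h1, h2, h3⟩ := (inBox_clamp hε1 p).lipschitz hε hε1 (inBox_clamp hε1 q)
  have hd : |p.1 - q.1| ≤ dist p q ∧ |p.2.1 - q.2.1| ≤ dist p q ∧ |p.2.2 - q.2.2| ≤ dist p q := by
    simp only [Prod.dist_eq, Real.dist_eq]
    exact ⟨le_max_left _ _, (le_max_left _ _).trans (le_max_right _ _),
      (le_max_right _ _).trans (le_max_right _ _)⟩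
  have hS : |clamp (-2) (1 - ε) p.1 - clamp (-2) (1 - ε) q.1| +
      |clamp (-3) 3 p.2.1 - clamp (-3) 3 q.2.1| + |clamp (-3) 3 p.2.2 - clamp (-3) 3 q.2.2| ≤
        3 * dist p q := by
    linarith [abs_clamp_sub_clamp_le (-2) (1 - ε) p.1 q.1, abs_clamp_sub_clamp_le (-3) 3 p.2.1 q.2.1,
      abs_clamp_sub_clamp_le (-3) 3 p.2.2 q.2.2]
  have hL : 600 / ε ^ 2 * dist p q = 200 / ε ^ 2 * (3 * dist p q) := by ring
  have hm := mul_le_mul_of_nonneg_left hS (show 0 ≤ 200 / ε ^ 2 by positivity)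
  rw [hL, Prod.dist_eq, Prod.dist_eq, Real.dist_eq, Real.dist_eq, Real.dist_eq]
  exact max_le (h1.trans hm) (max_le (h2.trans hm) (h3.trans hm))

theorem norm_clampedField_le {ε : ℝ} (hε : 0 < ε) (hε1 : ε ≤ 1) (p : ℝ × ℝ × ℝ) :
    ‖clampedField ε p‖ ≤ 200 / ε := by
  obtain ⟨h1, h2, h3⟩ := (inBox_clamp hε1 p).bound hε hε1
  rw [Prod.norm_def, Prod.norm_def]
  exact max_le h1 (max_le h2 h3)

theorem exists_clamped_solution {ε : ℝ} (hε : 0 < ε) (hε1 : ε ≤ 1) :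
    ∃ p : ℝ → ℝ × ℝ × ℝ, p 0 = 0 ∧ ∀ s ∈ Set.Icc (0 : ℝ) 3,
      HasDerivWithinAt p (clampedField ε (p s)) (Set.Icc 0 3) s := by
  have hP : IsPicardLindelof (fun _ : ℝ => clampedField ε) (tmin := 0) (tmax := 3)
      ⟨0, by norm_num⟩ (0 : ℝ × ℝ × ℝ) (Real.toNNReal (600 / ε)) 0 (Real.toNNReal (200 / ε))
      (Real.toNNReal (600 / ε ^ 2)) := by
    refine ⟨fun t _ => (lipschitzWith_clampedField hε hε1).lipschitzOnWith, fun x _ =>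
      continuousOn_const, fun t _ x _ => ?_, ?_⟩
    · rw [Real.coe_toNNReal _ (by positivity)]
      exact norm_clampedField_le hε hε1 x
    · rw [Real.coe_toNNReal _ (by positivity), Real.coe_toNNReal _ (by positivity)]
      simp only [sub_zero, sub_self, NNReal.coe_zero]
      rw [max_eq_left (by norm_num)]
      apply le_of_eq
      ring
  exact hP.exists_eq_forall_mem_Icc_hasDerivWithinAt₀

/-- A solution on a closed time interval that stays in the box until it leaves the domain `D_ε`
at the final time. -/
structure IsMaximalSolution (ε T : ℝ) (x a b : ℝ → ℝ) : Prop where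
  nonneg : 0 ≤ T
  x_zero : x 0 = 0
  a_zero : a 0 = 0
  b_zero : b 0 = 0
  deriv_x : ∀ s ∈ Set.Icc 0 T, HasDerivWithinAt x (rhsX (x s) (a s) (b s)) (Set.Icc 0 T) s
  deriv_a : ∀ s ∈ Set.Icc 0 T, HasDerivWithinAt a (rhsL₁ (x s) (a s) (b s)) (Set.Icc 0 T) s
  deriv_b : ∀ s ∈ Set.Icc 0 T, HasDerivWithinAt b (rhsL₂ (x s) (a s) (b s)) (Set.Icc 0 T) s
  mem_domain : ∀ s ∈ Set.Ico 0 T, InDomain ε s (x s) (a s) (b s)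
  mem_closed : ∀ s ∈ Set.Icc 0 T, -1 ≤ x s ∧ x s ≤ 1 - ε ∧ |a s| ≤ 2 ∧ |b s| ≤ 2
  exit : ¬InDomain ε T (x T) (a T) (b T)

theorem IsMaximalSolution.isSolution {ε T : ℝ} {x a b : ℝ → ℝ}
    (h : IsMaximalSolution ε T x a b) : IsSolution ε T x a b :=
  ⟨h.x_zero, h.a_zero, h.b_zero,
    fun s hs => (h.deriv_x s (Set.Ico_subset_Icc_self hs)).mono Set.Ico_subset_Icc_self,
    fun s hs => (h.deriv_a s (Set.Ico_subset_Icc_self hs)).mono Set.Ico_subset_Icc_self,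
    fun s hs => (h.deriv_b s (Set.Ico_subset_Icc_self hs)).mono Set.Ico_subset_Icc_self,
    h.mem_domain⟩

theorem exists_isMaximalSolution {ε : ℝ} (hε : 0 < ε) (hε1 : ε < 1) :
    ∃ T x a b, IsMaximalSolution ε T x a b := by
  obtain ⟨p, hp0, hp⟩ := exists_clamped_solution hε hε1.le
  have hc : ContinuousOn p (Set.Icc 0 3) := fun s hs => (hp s hs).continuousWithinAt
  have hx : ContinuousOn (fun s => (p s).1) (Set.Icc 0 3) := continuous_fst.comp_continuousOn hc
  have ha : ContinuousOn (fun s => (p s).2.1) (Set.Icc 0 3) :=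
    (continuous_fst.comp continuous_snd).comp_continuousOn hc
  have hb : ContinuousOn (fun s => (p s).2.2) (Set.Icc 0 3) :=
    (continuous_snd.comp continuous_snd).comp_continuousOn hc
  -- `m` is positive exactly inside the domain
  let m : ℝ → ℝ := fun s =>
    min (3 - s) (min (1 + (p s).1) (min (1 - ε - (p s).1) (min (2 - |(p s).2.1|) (2 - |(p s).2.2|))))
  have hmc : ContinuousOn m (Set.Icc 0 3) := by
    exact (continuousOn_const.sub continuousOn_id).inf ((continuousOn_const.add hx).inf
      ((continuousOn_const.sub hx).inf ((continuousOn_const.sub ha.abs).inf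
        (continuousOn_const.sub hb.abs))))
  have hm : ∀ s ∈ Set.Icc (0 : ℝ) 3, 0 < m s ↔ InDomain ε s (p s).1 (p s).2.1 (p s).2.2 := by
    intro s hs
    simp only [m, lt_min_iff, InDomain, sub_pos]
    constructor
    · rintro ⟨h1, h2, h3, h4, h5⟩
      exact ⟨⟨by linarith [hs.1], h1⟩, ⟨by linarith, h3⟩, h4, h5⟩
    · rintro ⟨⟨_, h1⟩, ⟨h2, h3⟩, h4, h5⟩
      exact ⟨h1, by linarith, h3, h4, h5⟩
  let E : Set ℝ := Set.Icc 0 3 ∩ m ⁻¹' Set.Iic 0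
  have hEc : IsClosed E := hmc.preimage_isClosed_of_isClosed isClosed_Icc isClosed_Iic
  have hE3 : (3 : ℝ) ∈ E := ⟨by norm_num, by simp [m]⟩
  have hEb : BddBelow E := ⟨0, fun s hs => hs.1.1⟩
  have hT := hEc.csInf_mem ⟨3, hE3⟩ hEb
  set T := sInf E with hTdef
  have hsub : Set.Icc 0 T ⊆ Set.Icc 0 3 := Set.Icc_subset_Icc_right hT.1.2
  have hdom : ∀ s ∈ Set.Ico 0 T, 0 < m s := by
    intro s hs
    by_contra! h
    exact absurd (csInf_le hEb ⟨⟨hs.1, hs.2.le.trans hT.1.2⟩, h⟩) (not_le.2 hs.2)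
  have hnonneg : ∀ s ∈ Set.Icc 0 T, 0 ≤ m s := by
    intro s hs
    rcases hs.2.lt_or_eq with h | h
    · exact (hdom s ⟨hs.1, h⟩).le
    · rcases hT.1.1.lt_or_eq with h0 | h0
      · have hcl : T ∈ closure (Set.Ico 0 T) := by
          rw [closure_Ico h0.ne]; exact ⟨h0.le, le_rfl⟩
        have hcw : ContinuousWithinAt m (Set.Ico 0 T) T :=
          (hmc T hT.1).mono (Set.Ico_subset_Icc_self.trans hsub)
        have := hcw.mem_closure hcl (t := Set.Ici 0) fun y hy => (hdom y hy).le
        rw [h]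
        simpa using this
      · have hs0 : s = 0 := by rw [h, ← h0]
        simp [hs0, m, hp0]
        linarith
  have hbox : ∀ s ∈ Set.Icc 0 T,
      -1 ≤ (p s).1 ∧ (p s).1 ≤ 1 - ε ∧ |(p s).2.1| ≤ 2 ∧ |(p s).2.2| ≤ 2 := by
    intro s hs
    have := hnonneg s hs
    simp only [m, le_min_iff, sub_nonneg] at this
    exact ⟨by linarith, this.2.2.1, this.2.2.2.1, this.2.2.2.2⟩
  have hfield : ∀ s ∈ Set.Icc 0 T, HasDerivWithinAt p
      (rhsX (p s).1 (p s).2.1 (p s).2.2, rhsL₁ (p s).1 (p s).2.1 (p s).2.2,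
        rhsL₂ (p s).1 (p s).2.1 (p s).2.2) (Set.Icc 0 T) s := by
    intro s hs
    have h := (hp s (hsub hs)).mono hsub
    obtain ⟨h1, h2, h3, h4⟩ := hbox s hs
    rw [abs_le] at h3 h4
    rwa [clampedField, clamp_of_mem (by linarith) h2, clamp_of_mem (by linarith) (by linarith),
      clamp_of_mem (by linarith) (by linarith)] at h
  refine ⟨T, fun s => (p s).1, fun s => (p s).2.1, fun s => (p s).2.2, hT.1.1, by simp [hp0],
    by simp [hp0], by simp [hp0], fun s hs => (hfield s hs).fst,
    fun s hs => (hfield s hs).snd.fst, fun s hs => (hfield s hs).snd.snd,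
    fun s hs => (hm s (hsub (Set.Ico_subset_Icc_self hs))).1 (hdom s hs), hbox, fun h => ?_⟩
  exact absurd ((hm T hT.1).2 h) (not_lt.2 hT.2)

theorem IsMaximalSolution.followsRhs {ε T : ℝ} {x a b : ℝ → ℝ} (hε : 0 < ε) (hε1 : ε < 1)
    (h : IsMaximalSolution ε T x a b) : ∃ C, 0 ≤ C ∧ ∀ (n : ℝ) (N : ℕ), 0 < n → N / n ≤ T →
      FollowsRhs x a b n N (ε / 2) (2 / ε) (200 / (ε / 2) ^ 2) C := by
  set ε' := ε / 2 with hε'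
  have hε'0 : 0 < ε' := by positivity
  have hε'1 : ε' ≤ 1 := by linarith
  set L := 200 / ε' ^ 2 with hL
  set M := 200 / ε' with hM
  have hL0 : 0 ≤ L := by positivity
  have hM0 : 0 ≤ M := by positivity
  have hbox : ∀ s ∈ Set.Icc 0 T, InBox ε' (x s) (a s) (b s) := by
    intro s hs
    obtain ⟨h1, h2, h3, h4⟩ := h.mem_closed s hs
    exact ⟨by linarith, by linarith, by linarith, by linarith⟩
  have hcont : ∀ (z f : ℝ → ℝ), (∀ s ∈ Set.Icc 0 T, HasDerivWithinAt z (f s) (Set.Icc 0 T) s) →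
      (∀ s ∈ Set.Icc 0 T, |f s| ≤ M) → ∀ s ∈ Set.Icc 0 T, ∀ t ∈ Set.Icc 0 T,
        |z t - z s| ≤ M * |t - s| := by
    intro z f hz hf s hs t ht
    exact (convex_Icc 0 T).norm_image_sub_le_of_norm_hasDerivWithin_le hz hf hs ht
  have hx := hcont x _ h.deriv_x fun s hs => ((hbox s hs).bound hε'0 hε'1).1
  have ha := hcont a _ h.deriv_a fun s hs => ((hbox s hs).bound hε'0 hε'1).2.1
  have hb := hcont b _ h.deriv_b fun s hs => ((hbox s hs).bound hε'0 hε'1).2.2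
  have hsum : ∀ s ∈ Set.Icc 0 T, ∀ t ∈ Set.Icc 0 T,
      L * (|x t - x s| + |a t - a s| + |b t - b s|) ≤ 3 * L * M * |t - s| := by
    intro s hs t ht
    have := mul_le_mul_of_nonneg_left (add_le_add (add_le_add (hx s hs t ht) (ha s hs t ht))
      (hb s hs t ht)) hL0
    linarith
  have hstep : ∀ (z f : ℝ → ℝ), (∀ s ∈ Set.Icc 0 T, HasDerivWithinAt z (f s) (Set.Icc 0 T) s) →
      (∀ s ∈ Set.Icc 0 T, ∀ t ∈ Set.Icc 0 T, |f t - f s| ≤ 3 * L * M * |t - s|) →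
      ∀ (n : ℝ) (i : ℕ), 0 < n → ((i + 1 : ℕ) : ℝ) / n ≤ T →
        |n * (z ((i + 1 : ℕ) / n) - z (i / n)) - f (i / n)| ≤ 3 * L * M / n := by
    intro z f hz hf n i hn hi
    set s := (i : ℝ) / n with hs
    set t := ((i + 1 : ℕ) : ℝ) / n with ht
    have hst : t = s + 1 / n := by rw [hs, ht]; push_cast; ring
    have hn' : 0 < 1 / n := by positivity
    have hs0 : 0 ≤ s := by positivity
    have hsub : Set.Icc s t ⊆ Set.Icc 0 T := Set.Icc_subset_Icc hs0 hi
    have hsm : s ∈ Set.Icc s t := ⟨le_rfl, by linarith⟩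
    have htm : t ∈ Set.Icc s t := ⟨by linarith, le_rfl⟩
    have hd : ∀ r ∈ Set.Icc s t, HasDerivWithinAt (fun r => z r - r * f s) (f r - f s)
        (Set.Icc s t) r := by
      intro r hr
      have := ((hz r (hsub hr)).mono hsub).fun_sub
        ((hasDerivWithinAt_id r (Set.Icc s t)).mul_const (f s))
      simpa only [one_mul, id] using this
    have hbd : ∀ r ∈ Set.Icc s t, ‖f r - f s‖ ≤ 3 * L * M * (1 / n) := by
      intro r hr
      refine (hf s (hsub hsm) r (hsub hr)).trans ?_
      have : |r - s| ≤ 1 / n := by rw [abs_of_nonneg (by linarith [hr.1])]; linarith [hr.2]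
      gcongr
    have := (convex_Icc s t).norm_image_sub_le_of_norm_hasDerivWithin_le hd hbd hsm htm
    have e : n * (z t - z s) - f s = n * (z t - t * f s - (z s - s * f s)) := by
      rw [hst]; field_simp; ring
    have hts : t - s = 1 / n := by rw [hst]; ring
    rw [e, abs_mul, abs_of_pos hn]
    rw [Real.norm_eq_abs, Real.norm_eq_abs, hts, abs_of_pos hn'] at this
    calc n * _ ≤ n * (3 * L * M * (1 / n) * (1 / n)) := by gcongr
      _ = _ := by field_simp
  refine ⟨M + 3 * L * M, by positivity, fun n N hn hN => ?_⟩
  have hi : ∀ i < N, ((i + 1 : ℕ) : ℝ) / n ≤ T := fun i hi => by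
    refine le_trans ?_ hN
    gcongr
    exact_mod_cast hi
  have hi' : ∀ i < N, (i : ℝ) / n ∈ Set.Icc 0 T := fun i hi₀ => by
    refine ⟨by positivity, le_trans ?_ (hi i hi₀)⟩
    gcongr
    simp
  have hC : 3 * L * M / n ≤ (M + 3 * L * M) / n := by gcongr; linarith
  have hC' : M ≤ M + 3 * L * M := le_add_of_nonneg_right (by positivity)
  have hlip := fun s hs t ht => (hbox t ht).lipschitz hε'0 hε'1 (hbox s hs)
  refine ⟨h.x_zero, h.a_zero, h.b_zero,
    fun i h0 => (hstep x _ h.deriv_x (fun s hs t ht => ((hlip s hs t ht).1).trans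
      (hsum s hs t ht)) n i hn (hi i h0)).trans hC,
    fun i h0 => (hstep a _ h.deriv_a (fun s hs t ht => ((hlip s hs t ht).2.1).trans
      (hsum s hs t ht)) n i hn (hi i h0)).trans hC,
    fun i h0 => (hstep b _ h.deriv_b (fun s hs t ht => ((hlip s hs t ht).2.2).trans
      (hsum s hs t ht)) n i hn (hi i h0)).trans hC,
    fun i h0 => ((hbox _ (hi' i h0)).bound hε'0 hε'1).1.trans hC',
    fun i h0 => ((hbox _ (hi' i h0)).bound hε'0 hε'1).2.1.trans hC',
    fun i h0 => ((hbox _ (hi' i h0)).bound hε'0 hε'1).2.2.trans hC', ?_⟩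
  intro i h0 x' a' b' hx' ha' hb'
  obtain ⟨h1, h2, h3, h4⟩ := h.mem_closed _ (hi' i h0)
  rw [abs_le] at hx' ha' hb' h3 h4
  have hb2 : InBox ε' x' a' b' := ⟨by linarith, by linarith, abs_le.2 ⟨by linarith, by linarith⟩,
    abs_le.2 ⟨by linarith, by linarith⟩⟩
  refine ⟨?_, hb2.lipschitz hε'0 hε'1 (hbox _ (hi' i h0))⟩
  have : ε / 2 ≤ 1 - x' := by linarith
  rw [div_mul_eq_mul_div, le_div_iff₀ hε]
  linarith

end SemiRandom
namespace SemiRandom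

/-! ## Polynomials with integer coefficients, as lists -/

/-- Evaluation of the polynomial with the given coefficients, constant term first. -/
noncomputable def polyEval : List ℤ → ℝ → ℝ
  | [], _ => 0
  | c :: p, u => c + u * polyEval p u

/-- Evaluation at an integer. -/
def polyEvalInt : List ℤ → ℤ → ℤ
  | [], _ => 0
  | c :: p, u => c + u * polyEvalInt p u

/-- Sum of two coefficient lists. -/
def polyAdd : List ℤ → List ℤ → List ℤ
  | [], q => q
  | p, [] => p
  | a :: p, b :: q => (a + b) :: polyAdd p q

/-- Multiple of a coefficient list. -/
def polyScale (k : ℤ) : List ℤ → List ℤ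
  | [] => []
  | a :: p => (k * a) :: polyScale k p

/-- Product of two coefficient lists. -/
def polyMul : List ℤ → List ℤ → List ℤ
  | [], _ => []
  | a :: p, q => polyAdd (polyScale a q) (0 :: polyMul p q)

/-- Derivative of a coefficient list. -/
def polyDeriv : List ℤ → List ℤ
  | [] => []
  | _ :: p => polyAdd p (0 :: polyDeriv p)

/-- The sum of the absolute values of the coefficients. -/
def polyNorm : List ℤ → ℤ
  | [] => 0
  | c :: p => |c| + polyNorm p

/-- An upper bound for the values on the interval from `-1` to `1`. -/
def polyUpper : List ℤ → ℤ
  | [] => 0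
  | c :: p => c + polyNorm p

theorem polyEval_intCast (p : List ℤ) (k : ℤ) : polyEval p k = (polyEvalInt p k : ℤ) := by
  induction p with
  | nil => simp [polyEval, polyEvalInt]
  | cons c p ih => simp [polyEval, polyEvalInt, ih]

@[simp] theorem polyEval_add (p q : List ℤ) (u : ℝ) :
    polyEval (polyAdd p q) u = polyEval p u + polyEval q u := by
  induction p generalizing q with
  | nil => simp [polyAdd, polyEval]
  | cons a p ih =>
    cases q with
    | nil => simp [polyAdd, polyEval]
    | cons b q => simp only [polyAdd, polyEval, ih]; push_cast; ring

@[simp] theorem polyEval_scale (k : ℤ) (p : List ℤ) (u : ℝ) :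
    polyEval (polyScale k p) u = k * polyEval p u := by
  induction p with
  | nil => simp [polyScale, polyEval]
  | cons a p ih => simp only [polyScale, polyEval, ih]; push_cast; ring

@[simp] theorem polyEval_mul (p q : List ℤ) (u : ℝ) :
    polyEval (polyMul p q) u = polyEval p u * polyEval q u := by
  induction p with
  | nil => simp [polyMul, polyEval]
  | cons a p ih => simp only [polyMul, polyEval, polyEval_add, polyEval_scale, ih]; push_cast; ring

theorem hasDerivAt_polyEval (p : List ℤ) (u : ℝ) :
    HasDerivAt (polyEval p) (polyEval (polyDeriv p) u) u := by
  induction p with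
  | nil => exact hasDerivAt_const u (0 : ℝ)
  | cons c p ih =>
    have h := ((hasDerivAt_id u).mul ih).const_add (c : ℝ)
    refine h.congr_deriv ?_
    simp [polyDeriv, polyEval]

theorem continuous_polyEval (p : List ℤ) : Continuous (polyEval p) :=
  continuous_iff_continuousAt.2 fun u => (hasDerivAt_polyEval p u).continuousAt

theorem abs_polyEval_le (p : List ℤ) {u : ℝ} (hu : |u| ≤ 1) : |polyEval p u| ≤ polyNorm p := by
  induction p with
  | nil => simp [polyEval, polyNorm]
  | cons c p ih =>
    simp only [polyEval, polyNorm]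
    push_cast
    refine (abs_add_le _ _).trans ?_
    rw [abs_mul]
    have := mul_le_mul hu ih (abs_nonneg _) zero_le_one
    linarith

theorem polyEval_le_upper (p : List ℤ) {u : ℝ} (hu : |u| ≤ 1) : polyEval p u ≤ polyUpper p := by
  cases p with
  | nil => simp [polyEval, polyUpper]
  | cons c p =>
    simp only [polyEval, polyUpper]
    push_cast
    have h1 := abs_polyEval_le p hu
    have h2 : u * polyEval p u ≤ |u| * |polyEval p u| := by
      rw [← abs_mul]; exact le_abs_self _
    have := mul_le_mul hu h1 (abs_nonneg _) zero_le_one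
    linarith

/-! ## Tubes around the trajectory

With `w = √(1 - x)` and `mᵢ = ℓᵢ / w` the system becomes `w' = -(w / 2 + m₁ + m₂)`,
`w m₁' = slopeOne w m₁ m₂ / 2`, `w m₂' = slopeTwo w m₁ m₂ / 2` with quadratic forms. -/

/-- Twice `w m₁'`. -/
def slopeOne (w m₁ m₂ : ℝ) : ℝ :=
  2 - 2 * w ^ 2 - 17 * w * m₁ - 2 * w * m₂ - 2 * m₁ ^ 2 + 6 * m₁ * m₂ + 8 * m₂ ^ 2

/-- Twice `w m₂'`. -/
def slopeTwo (w m₁ m₂ : ℝ) : ℝ :=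
  2 * w * m₁ - 7 * w * m₂ - 6 * m₁ * m₂ - 6 * m₂ ^ 2

/-- The common denominator of the numerical data. -/
def den : ℤ := 1000000000000

/-- A piece of a tube: over the interval of `w` with centre `c` and half-width `h`, the values of
`m₁` and `m₂` are within `r₁` and `r₂` of polynomials, and the time is at most a polynomial; the
polynomials are in the variable `(w - c) / h`. Everything is scaled by `den`. -/
structure TubePiece where
  c : ℤ
  h : ℤ
  M₁ : List ℤ
  M₂ : List ℤ
  S : List ℤ
  r₁ : ℤ
  r₂ : ℤ

namespace TubePiece

variable (p : TubePiece)

/-- The polynomial `w`. -/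
def W : List ℤ := [p.c, p.h]

/-- The polynomial `w + 2 m₁ + 2 m₂`. -/
def speed : List ℤ := polyAdd p.W (polyScale 2 (polyAdd p.M₁ p.M₂))

/-- The defect of the polynomials in the equation for `m₁`. -/
def resOne : List ℤ :=
  polyAdd (polyScale p.h (polyAdd [2 * den ^ 2] (polyAdd
    (polyMul p.W (polyAdd (polyScale (-2) p.W) (polyAdd (polyScale (-17) p.M₁)
      (polyScale (-2) p.M₂))))
    (polyAdd (polyMul p.M₁ (polyAdd (polyScale (-2) p.M₁) (polyScale 6 p.M₂)))
      (polyScale 8 (polyMul p.M₂ p.M₂))))))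
    (polyMul (polyMul p.W p.speed) (polyDeriv p.M₁))

/-- The defect of the polynomials in the equation for `m₂`. -/
def resTwo : List ℤ :=
  polyAdd (polyScale p.h (polyAdd
    (polyMul p.W (polyAdd (polyScale 2 p.M₁) (polyScale (-7) p.M₂)))
    (polyMul p.M₂ (polyAdd (polyScale (-6) p.M₁) (polyScale (-6) p.M₂)))))
    (polyMul (polyMul p.W p.speed) (polyDeriv p.M₂))

/-- Linearisation of the equation for `m₁`, in `m₁`. -/
def linOneOne : List ℤ :=
  polyAdd (polyScale p.h (polyAdd (polyScale (-17) p.W) (polyAdd (polyScale (-4) p.M₁)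
    (polyScale 6 p.M₂)))) (polyScale 2 (polyMul p.W (polyDeriv p.M₁)))

/-- Linearisation of the equation for `m₁`, in `m₂`. -/
def linOneTwo : List ℤ :=
  polyAdd (polyScale p.h (polyAdd (polyScale (-2) p.W) (polyAdd (polyScale 6 p.M₁)
    (polyScale 16 p.M₂)))) (polyScale 2 (polyMul p.W (polyDeriv p.M₁)))

/-- Linearisation of the equation for `m₂`, in `m₁`. -/
def linTwoOne : List ℤ :=
  polyAdd (polyScale p.h (polyAdd (polyScale 2 p.W) (polyScale (-6) p.M₂)))
    (polyScale 2 (polyMul p.W (polyDeriv p.M₂)))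

/-- Linearisation of the equation for `m₂`, in `m₂`. -/
def linTwoTwo : List ℤ :=
  polyAdd (polyScale p.h (polyAdd (polyScale (-7) p.W) (polyAdd (polyScale (-6) p.M₁)
    (polyScale (-12) p.M₂)))) (polyScale 2 (polyMul p.W (polyDeriv p.M₂)))

/-- The inequalities that make a piece of a tube forward invariant. -/
structure Valid : Prop where
  h_pos : 0 < p.h
  r₁_nonneg : 0 ≤ p.r₁
  r₂_nonneg : 0 ≤ p.r₂
  one : polyNorm p.resOne + polyNorm p.linOneTwo * p.r₂ +
    p.h * (2 * p.r₁ * p.r₁ + 6 * p.r₁ * p.r₂ + 8 * p.r₂ * p.r₂) + polyUpper p.linOneOne * p.r₁ < 0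
  two : polyNorm p.resTwo + polyNorm p.linTwoOne * p.r₁ +
    p.h * (6 * p.r₁ * p.r₂ + 6 * p.r₂ * p.r₂) + polyUpper p.linTwoTwo * p.r₂ < 0
  time : polyUpper (polyAdd [2 * den * p.h] (polyMul (polyDeriv p.S) p.speed)) +
    2 * polyNorm (polyDeriv p.S) * (p.r₁ + p.r₂) < 0
  speed_pos : polyUpper (polyScale (-1) p.speed) + 2 * (p.r₁ + p.r₂) < 0
  bound₁ : 2 * (polyNorm p.M₁ + p.r₁) ≤ 3 * den
  bound₂ : 2 * (polyNorm p.M₂ + p.r₂) ≤ 3 * den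
  final : 100000 * polyEvalInt p.S (-1) ≤ 207721 * den

theorem valid_iff : p.Valid ↔ 0 < p.h ∧ 0 ≤ p.r₁ ∧ 0 ≤ p.r₂ ∧
    polyNorm p.resOne + polyNorm p.linOneTwo * p.r₂ +
      p.h * (2 * p.r₁ * p.r₁ + 6 * p.r₁ * p.r₂ + 8 * p.r₂ * p.r₂) +
        polyUpper p.linOneOne * p.r₁ < 0 ∧
    polyNorm p.resTwo + polyNorm p.linTwoOne * p.r₁ +
      p.h * (6 * p.r₁ * p.r₂ + 6 * p.r₂ * p.r₂) + polyUpper p.linTwoTwo * p.r₂ < 0 ∧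
    polyUpper (polyAdd [2 * den * p.h] (polyMul (polyDeriv p.S) p.speed)) +
      2 * polyNorm (polyDeriv p.S) * (p.r₁ + p.r₂) < 0 ∧
    polyUpper (polyScale (-1) p.speed) + 2 * (p.r₁ + p.r₂) < 0 ∧
    2 * (polyNorm p.M₁ + p.r₁) ≤ 3 * den ∧ 2 * (polyNorm p.M₂ + p.r₂) ≤ 3 * den ∧
    100000 * polyEvalInt p.S (-1) ≤ 207721 * den :=
  ⟨fun ⟨a, b, c, d, e, f, g, h, i, j⟩ => ⟨a, b, c, d, e, f, g, h, i, j⟩,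
    fun ⟨a, b, c, d, e, f, g, h, i, j⟩ => ⟨a, b, c, d, e, f, g, h, i, j⟩⟩

instance : Decidable p.Valid := decidable_of_iff _ p.valid_iff.symm

/-- The left end of `p` lies in the right end of `q`. -/
def Linked (p q : TubePiece) : Prop :=
  p.c - p.h = q.c + q.h ∧
  |polyEvalInt p.M₁ (-1) - polyEvalInt q.M₁ 1| + p.r₁ ≤ q.r₁ ∧
  |polyEvalInt p.M₂ (-1) - polyEvalInt q.M₂ 1| + p.r₂ ≤ q.r₂ ∧
  polyEvalInt p.S (-1) ≤ polyEvalInt q.S 1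

instance (p q : TubePiece) : Decidable (Linked p q) := by unfold Linked; infer_instance

/-- The starting point `w = 1`, `m₁ = m₂ = 0` at time `0` lies in the right end of `p`. -/
def Starts : Prop :=
  p.c + p.h = den ∧ |polyEvalInt p.M₁ 1| ≤ p.r₁ ∧ |polyEvalInt p.M₂ 1| ≤ p.r₂ ∧
    0 ≤ polyEvalInt p.S 1

instance : Decidable p.Starts := by unfold Starts; infer_instance

/-- The coordinate of `w` on the piece. -/
noncomputable def coord (w : ℝ) : ℝ := (den * w - p.c) / p.h

/-- The points of a piece of a tube. -/
def Mem (w m₁ m₂ s : ℝ) : Prop :=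
  |p.coord w| ≤ 1 ∧ |den * m₁ - polyEval p.M₁ (p.coord w)| ≤ p.r₁ ∧
    |den * m₂ - polyEval p.M₂ (p.coord w)| ≤ p.r₂ ∧ den * s ≤ polyEval p.S (p.coord w)

end TubePiece

/-- A tube: a list of pieces, each linked to the next, the last one ending at `w = 0`. -/
def IsTube : List TubePiece → Prop
  | [] => False
  | [p] => p.Valid ∧ p.c = p.h
  | p :: q :: l => p.Valid ∧ p.Linked q ∧ IsTube (q :: l)

instance decidableIsTube : (l : List TubePiece) → Decidable (IsTube l)
  | [] => isFalse not_false
  | [p] => by unfold IsTube; infer_instance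
  | p :: q :: l => by
    unfold IsTube
    have := decidableIsTube (q :: l)
    infer_instance

theorem IsTube.valid {l : List TubePiece} (hl : IsTube l) : ∀ p ∈ l, p.Valid := by
  induction l with
  | nil => simp
  | cons p l ih =>
    cases l with
    | nil => simpa using hl.1
    | cons q l =>
      intro r hr
      rcases List.mem_cons.1 hr with rfl | hr
      · exact hl.1
      · exact ih hl.2.2 r hr

theorem IsTube.exists_linked {l : List TubePiece} (hl : IsTube l) :
    ∀ p ∈ l, p.c = p.h ∨ ∃ q ∈ l, p.Linked q := by
  induction l with
  | nil => simp
  | cons p l ih =>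
    cases l with
    | nil =>
      intro r hr
      rw [List.mem_singleton.1 hr]
      exact Or.inl hl.2
    | cons q l =>
      intro r hr
      rcases List.mem_cons.1 hr with rfl | hr
      · exact Or.inr ⟨q, by simp, hl.2.1⟩
      · exact (ih hl.2.2 r hr).imp_right fun ⟨q, hq, h⟩ => ⟨q, List.mem_cons_of_mem _ hq, h⟩

namespace TubePiece

theorem den_pos : (0 : ℝ) < den := by norm_num [den]

theorem linear_lt_zero {R A B ρ a b q r s e : ℝ} (hR : |R| ≤ ρ) (hB : |B| ≤ b) (hA : A ≤ a)
    (hr : 0 ≤ r) (he : |e| ≤ s) {Q : ℝ} (hQ : |Q| ≤ q) (h : ρ + b * s + q + a * r < 0) :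
    R + A * r + B * e + Q < 0 ∧ 0 < R - A * r + B * e + Q := by
  have h1 : |B * e| ≤ b * s := by
    rw [abs_mul]
    exact mul_le_mul hB he (abs_nonneg _) ((abs_nonneg _).trans hB)
  have h2 : A * r ≤ a * r := mul_le_mul_of_nonneg_right hA hr
  rw [abs_le] at *
  constructor <;> linarith

variable {p : TubePiece} {w m₁ m₂ s : ℝ}

theorem Valid.coord_eq (hp : p.Valid) : den * w = p.c + p.h * p.coord w := by
  have : (p.h : ℝ) ≠ 0 := by exact_mod_cast hp.h_pos.ne'
  rw [coord]; field_simp; ring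

theorem eval_W (u : ℝ) : polyEval p.W u = p.c + p.h * u := by
  simp only [W, polyEval]; ring

theorem Valid.one_eq (hp : p.Valid) (w m₁ m₂ : ℝ) :
    den ^ 2 * (p.h * slopeOne w m₁ m₂ + w * (w + 2 * (m₁ + m₂)) *
        polyEval (polyDeriv p.M₁) (p.coord w)) =
      polyEval p.resOne (p.coord w) +
      polyEval p.linOneOne (p.coord w) * (den * m₁ - polyEval p.M₁ (p.coord w)) +
      polyEval p.linOneTwo (p.coord w) * (den * m₂ - polyEval p.M₂ (p.coord w)) +
      p.h * (-2 * (den * m₁ - polyEval p.M₁ (p.coord w)) ^ 2 +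
        6 * (den * m₁ - polyEval p.M₁ (p.coord w)) * (den * m₂ - polyEval p.M₂ (p.coord w)) +
        8 * (den * m₂ - polyEval p.M₂ (p.coord w)) ^ 2) := by
  have hw : polyEval p.W (p.coord w) = den * w := by rw [eval_W, hp.coord_eq]
  simp only [resOne, linOneOne, linOneTwo, speed, polyEval_add, polyEval_scale, polyEval_mul, hw,
    slopeOne, show ∀ (k : ℤ) u, polyEval [k] u = k from fun k u => by simp [polyEval]]
  push_cast
  ring

theorem Valid.two_eq (hp : p.Valid) (w m₁ m₂ : ℝ) :
    den ^ 2 * (p.h * slopeTwo w m₁ m₂ + w * (w + 2 * (m₁ + m₂)) *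
        polyEval (polyDeriv p.M₂) (p.coord w)) =
      polyEval p.resTwo (p.coord w) +
      polyEval p.linTwoTwo (p.coord w) * (den * m₂ - polyEval p.M₂ (p.coord w)) +
      polyEval p.linTwoOne (p.coord w) * (den * m₁ - polyEval p.M₁ (p.coord w)) +
      p.h * (-6 * (den * m₁ - polyEval p.M₁ (p.coord w)) *
        (den * m₂ - polyEval p.M₂ (p.coord w)) -
        6 * (den * m₂ - polyEval p.M₂ (p.coord w)) ^ 2) := by
  have hw : polyEval p.W (p.coord w) = den * w := by rw [eval_W, hp.coord_eq]
  simp only [resTwo, linTwoOne, linTwoTwo, speed, polyEval_add, polyEval_scale, polyEval_mul, hw,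
    slopeTwo]
  push_cast
  ring

theorem Valid.one_sign (hp : p.Valid) (hm : p.Mem w m₁ m₂ s) :
    (den * m₁ - polyEval p.M₁ (p.coord w) = p.r₁ → p.h * slopeOne w m₁ m₂ +
      w * (w + 2 * (m₁ + m₂)) * polyEval (polyDeriv p.M₁) (p.coord w) < 0) ∧
    (den * m₁ - polyEval p.M₁ (p.coord w) = -p.r₁ → 0 < p.h * slopeOne w m₁ m₂ +
      w * (w + 2 * (m₁ + m₂)) * polyEval (polyDeriv p.M₁) (p.coord w)) := by
  obtain ⟨hu, h1, h2, -⟩ := hm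
  have e := hp.one_eq w m₁ m₂
  have hd : (0 : ℝ) < (den : ℝ) ^ 2 := pow_pos den_pos 2
  have hr1 : (0 : ℝ) ≤ p.r₁ := by exact_mod_cast hp.r₁_nonneg
  have hr2 : (0 : ℝ) ≤ p.r₂ := by exact_mod_cast hp.r₂_nonneg
  have hh : (0 : ℝ) ≤ p.h := by exact_mod_cast hp.h_pos.le
  have hv : (polyNorm p.resOne : ℝ) + polyNorm p.linOneTwo * p.r₂ +
    p.h * (2 * p.r₁ * p.r₁ + 6 * p.r₁ * p.r₂ + 8 * p.r₂ * p.r₂) +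
      polyUpper p.linOneOne * p.r₁ < 0 := by exact_mod_cast hp.one
  set e₁ := den * m₁ - polyEval p.M₁ (p.coord w)
  set e₂ := den * m₂ - polyEval p.M₂ (p.coord w)
  have hQ : |p.h * (-2 * e₁ ^ 2 + 6 * e₁ * e₂ + 8 * e₂ ^ 2)| ≤
      (p.h : ℝ) * (2 * p.r₁ * p.r₁ + 6 * p.r₁ * p.r₂ + 8 * p.r₂ * p.r₂) := by
    rw [abs_mul, abs_of_nonneg hh]
    refine mul_le_mul_of_nonneg_left ?_ hh
    refine (abs_add_three _ _ _).trans ?_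
    simp only [abs_mul, abs_neg, abs_pow, Nat.abs_ofNat]
    have a1 : |e₁| ^ 2 ≤ p.r₁ ^ 2 := by gcongr
    have a2 : |e₂| ^ 2 ≤ p.r₂ ^ 2 := by gcongr
    have a3 : |e₁| * |e₂| ≤ p.r₁ * p.r₂ := by gcongr
    nlinarith
  have := linear_lt_zero (abs_polyEval_le p.resOne hu) (abs_polyEval_le p.linOneTwo hu)
    (polyEval_le_upper p.linOneOne hu) hr1 h2 hQ hv
  constructor
  · intro h
    rw [h] at e this
    nlinarith [this.1]
  · intro h
    rw [h] at e this
    nlinarith [this.2]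

theorem Valid.two_sign (hp : p.Valid) (hm : p.Mem w m₁ m₂ s) :
    (den * m₂ - polyEval p.M₂ (p.coord w) = p.r₂ → p.h * slopeTwo w m₁ m₂ +
      w * (w + 2 * (m₁ + m₂)) * polyEval (polyDeriv p.M₂) (p.coord w) < 0) ∧
    (den * m₂ - polyEval p.M₂ (p.coord w) = -p.r₂ → 0 < p.h * slopeTwo w m₁ m₂ +
      w * (w + 2 * (m₁ + m₂)) * polyEval (polyDeriv p.M₂) (p.coord w)) := by
  obtain ⟨hu, h1, h2, -⟩ := hm
  have e := hp.two_eq w m₁ m₂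
  have hd : (0 : ℝ) < (den : ℝ) ^ 2 := pow_pos den_pos 2
  have hr1 : (0 : ℝ) ≤ p.r₁ := by exact_mod_cast hp.r₁_nonneg
  have hr2 : (0 : ℝ) ≤ p.r₂ := by exact_mod_cast hp.r₂_nonneg
  have hh : (0 : ℝ) ≤ p.h := by exact_mod_cast hp.h_pos.le
  have hv : (polyNorm p.resTwo : ℝ) + polyNorm p.linTwoOne * p.r₁ +
    p.h * (6 * p.r₁ * p.r₂ + 6 * p.r₂ * p.r₂) +
      polyUpper p.linTwoTwo * p.r₂ < 0 := by exact_mod_cast hp.two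
  set e₁ := den * m₁ - polyEval p.M₁ (p.coord w)
  set e₂ := den * m₂ - polyEval p.M₂ (p.coord w)
  have hQ : |p.h * (-6 * e₁ * e₂ - 6 * e₂ ^ 2)| ≤
      (p.h : ℝ) * (6 * p.r₁ * p.r₂ + 6 * p.r₂ * p.r₂) := by
    rw [abs_mul, abs_of_nonneg hh]
    refine mul_le_mul_of_nonneg_left ?_ hh
    refine (abs_sub _ _).trans ?_
    simp only [abs_mul, abs_neg, abs_pow, Nat.abs_ofNat]
    have a2 : |e₂| ^ 2 ≤ p.r₂ ^ 2 := by gcongr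
    have a3 : |e₁| * |e₂| ≤ p.r₁ * p.r₂ := by gcongr
    nlinarith
  have := linear_lt_zero (abs_polyEval_le p.resTwo hu) (abs_polyEval_le p.linTwoOne hu)
    (polyEval_le_upper p.linTwoTwo hu) hr2 h1 hQ hv
  constructor
  · intro h
    rw [h] at e this
    nlinarith [this.1]
  · intro h
    rw [h] at e this
    nlinarith [this.2]

theorem Valid.speed_pos' (hp : p.Valid) {u : ℝ} (hu : |u| ≤ 1) :
    2 * ((p.r₁ : ℝ) + p.r₂) < polyEval p.speed u := by
  have h : (polyUpper (polyScale (-1) p.speed) : ℝ) + 2 * (p.r₁ + p.r₂) < 0 := by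
    exact_mod_cast hp.speed_pos
  have := polyEval_le_upper (polyScale (-1) p.speed) hu
  rw [polyEval_scale] at this
  push_cast at this
  linarith

theorem Valid.eval_speed (hp : p.Valid) (w m₁ m₂ : ℝ) : den * (w + 2 * (m₁ + m₂)) =
    polyEval p.speed (p.coord w) + 2 * ((den * m₁ - polyEval p.M₁ (p.coord w)) +
      (den * m₂ - polyEval p.M₂ (p.coord w))) := by
  have hw : polyEval p.W (p.coord w) = den * w := by rw [eval_W, hp.coord_eq]
  simp only [speed, polyEval_add, polyEval_scale, hw]
  push_cast
  ring

theorem Valid.speed_mem (hp : p.Valid) (hm : p.Mem w m₁ m₂ s) : 0 < w + 2 * (m₁ + m₂) := by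
  obtain ⟨hu, h1, h2, -⟩ := hm
  have h := hp.speed_pos' hu
  have e := hp.eval_speed w m₁ m₂
  rw [abs_le] at h1 h2
  have hd := den_pos
  by_contra! hn
  nlinarith

theorem Valid.time_lt (hp : p.Valid) {u e : ℝ} (hu : |u| ≤ 1) (he : |e| ≤ p.r₁ + p.r₂) :
    2 * den * p.h + polyEval (polyDeriv p.S) u * (polyEval p.speed u + 2 * e) < 0 := by
  have h : (polyUpper (polyAdd [2 * den * p.h] (polyMul (polyDeriv p.S) p.speed)) : ℝ) +
    2 * polyNorm (polyDeriv p.S) * (p.r₁ + p.r₂) < 0 := by exact_mod_cast hp.time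
  have h1 := polyEval_le_upper (polyAdd [2 * den * p.h] (polyMul (polyDeriv p.S) p.speed)) hu
  have h2 := abs_polyEval_le (polyDeriv p.S) hu
  have h3 : |polyEval (polyDeriv p.S) u * e| ≤ polyNorm (polyDeriv p.S) * (p.r₁ + p.r₂) := by
    rw [abs_mul]
    exact mul_le_mul h2 he (abs_nonneg _) ((abs_nonneg _).trans h2)
  rw [polyEval_add, polyEval_mul] at h1
  simp only [polyEval] at h1
  push_cast at h1
  have := (abs_le.1 h3).2
  linarith

theorem Valid.time_sign (hp : p.Valid) (hm : p.Mem w m₁ m₂ s) :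
    2 * p.h + polyEval (polyDeriv p.S) (p.coord w) * (w + 2 * (m₁ + m₂)) < 0 := by
  obtain ⟨hu, h1, h2, -⟩ := hm
  have he := (abs_add_le _ _).trans (add_le_add h1 h2)
  have h := hp.time_lt hu he
  rw [← hp.eval_speed w m₁ m₂] at h
  have hd := den_pos
  have : (den : ℝ) * (2 * p.h + polyEval (polyDeriv p.S) (p.coord w) * (w + 2 * (m₁ + m₂))) < 0 := by
    linarith
  exact (pos_iff_neg_of_mul_neg this).1 hd

theorem Valid.time_le (hp : p.Valid) (hm : p.Mem w m₁ m₂ s) : s ≤ 2.07721 := by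
  obtain ⟨hu, -, -, hs⟩ := hm
  rw [abs_le] at hu
  have hanti : AntitoneOn (polyEval p.S) (Set.Icc (-1) 1) := by
    refine antitoneOn_of_deriv_nonpos (convex_Icc _ _) (continuous_polyEval _).continuousOn
      (fun u _ => (hasDerivAt_polyEval _ u).differentiableAt.differentiableWithinAt) fun u hu' => ?_
    rw [(hasDerivAt_polyEval _ u).deriv]
    rw [interior_Icc] at hu'
    have hu1 : |u| ≤ 1 := abs_le.2 ⟨hu'.1.le, hu'.2.le⟩
    have hr1 : (0 : ℝ) ≤ p.r₁ := by exact_mod_cast hp.r₁_nonneg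
    have hr2 : (0 : ℝ) ≤ p.r₂ := by exact_mod_cast hp.r₂_nonneg
    have hh : (0 : ℝ) < p.h := by exact_mod_cast hp.h_pos
    have h1 := hp.speed_pos' hu1
    have h2 := hp.time_lt hu1 (e := 0) (by simpa using add_nonneg hr1 hr2)
    have h3 : 0 < 2 * den * (p.h : ℝ) := by have := den_pos; positivity
    by_contra! h4
    have : 0 ≤ polyEval (polyDeriv p.S) u * (polyEval p.speed u + 2 * 0) :=
      mul_nonneg h4.le (by linarith)
    linarith
  have h1 := hanti (by norm_num) hu hu.1
  have h2 := polyEval_intCast p.S (-1)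
  push_cast at h2
  rw [h2] at h1
  have h3 : (100000 : ℝ) * (polyEvalInt p.S (-1) : ℤ) ≤ 207721 * den := by exact_mod_cast hp.final
  have hd := den_pos
  have : (den : ℝ) * s ≤ den * 2.07721 := by norm_num at *; linarith
  exact le_of_mul_le_mul_left this hd

theorem Valid.abs_le_of_mem (hp : p.Valid) (hm : p.Mem w m₁ m₂ s) : |m₁| ≤ 3 / 2 ∧ |m₂| ≤ 3 / 2 := by
  obtain ⟨hu, h1, h2, -⟩ := hm
  have b1 : 2 * ((polyNorm p.M₁ : ℝ) + p.r₁) ≤ 3 * den := by exact_mod_cast hp.bound₁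
  have b2 : 2 * ((polyNorm p.M₂ : ℝ) + p.r₂) ≤ 3 * den := by exact_mod_cast hp.bound₂
  have n1 := abs_polyEval_le p.M₁ hu
  have n2 := abs_polyEval_le p.M₂ hu
  have hd := den_pos
  simp only [abs_le] at *
  refine ⟨⟨?_, ?_⟩, ⟨?_, ?_⟩⟩ <;> refine le_of_mul_le_mul_left ?_ hd <;> linarith

theorem Starts.mem (hs : p.Starts) (hp : p.Valid) : p.Mem 1 0 0 0 := by
  obtain ⟨h1, h2, h3, h4⟩ := hs
  have hh : (p.h : ℝ) ≠ 0 := by exact_mod_cast hp.h_pos.ne'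
  have hu : p.coord 1 = ((1 : ℤ) : ℝ) := by
    rw [coord, ← h1]; push_cast; field_simp; ring
  refine ⟨by simp [hu], ?_, ?_, ?_⟩ <;> rw [hu, polyEval_intCast]
  · simpa using (by exact_mod_cast h2 : |((polyEvalInt p.M₁ 1 : ℤ) : ℝ)| ≤ p.r₁)
  · simpa using (by exact_mod_cast h3 : |((polyEvalInt p.M₂ 1 : ℤ) : ℝ)| ≤ p.r₂)
  · simpa using h4

theorem Linked.mem {q : TubePiece} (h : p.Linked q) (hp : p.Valid) (hq : q.Valid)
    (hm : p.Mem w m₁ m₂ s) (hw : p.coord w = -1) : q.Mem w m₁ m₂ s ∧ q.coord w = 1 := by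
  obtain ⟨h1, h2, h3, h4⟩ := h
  have hh : (q.h : ℝ) ≠ 0 := by exact_mod_cast hq.h_pos.ne'
  have hu : q.coord w = 1 := by
    rw [coord, hp.coord_eq, hw]
    have : (p.c : ℝ) - p.h = q.c + q.h := by exact_mod_cast h1
    rw [div_eq_one_iff_eq hh]
    linarith
  obtain ⟨-, g1, g2, g3⟩ := hm
  have ep : ∀ l : List ℤ, polyEval l (p.coord w) = (polyEvalInt l (-1) : ℤ) := fun l => by
    rw [hw, ← polyEval_intCast]; norm_num
  have eq : ∀ l : List ℤ, polyEval l (q.coord w) = (polyEvalInt l 1 : ℤ) := fun l => by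
    rw [hu, ← polyEval_intCast]; norm_num
  rw [ep] at g1 g2 g3
  have h2' : |((polyEvalInt p.M₁ (-1) : ℤ) : ℝ) - (polyEvalInt q.M₁ 1 : ℤ)| + p.r₁ ≤ q.r₁ := by
    exact_mod_cast h2
  have h3' : |((polyEvalInt p.M₂ (-1) : ℤ) : ℝ) - (polyEvalInt q.M₂ 1 : ℤ)| + p.r₂ ≤ q.r₂ := by
    exact_mod_cast h3
  have h4' : ((polyEvalInt p.S (-1) : ℤ) : ℝ) ≤ (polyEvalInt q.S 1 : ℤ) := by exact_mod_cast h4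
  refine ⟨⟨by simp [hu], ?_, ?_, ?_⟩, hu⟩ <;> rw [eq]
  · linarith [abs_sub_le (den * m₁) ((polyEvalInt p.M₁ (-1) : ℤ) : ℝ) (polyEvalInt q.M₁ 1 : ℤ)]
  · linarith [abs_sub_le (den * m₂) ((polyEvalInt p.M₂ (-1) : ℤ) : ℝ) (polyEvalInt q.M₂ 1 : ℤ)]
  · linarith

end TubePiece

end SemiRandom
namespace SemiRandom

/-! ## The tube that encloses the trajectory -/

/-- Taylor approximations of the trajectory, computed numerically. -/
def tube : List TubePiece := [
  ⟨940000000000, 60000000000,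
    [5521213137, -9667238590, 3040489518, 869247249, 204230094, 30211717, 2232596, -250212,
      -114839, -19666, -1371, 247, 101],
    [219472961, -598944367, 488680292, -66595299, -35047545, -6890362, -711473, 10834, 20272, 4297,
      433, -22, -18],
    [123222832236, -126119127230, 2615723072, 239527838, 36042064, 4942664, 169190, -82488, -23994,
      -3340, -106, 73, 21],
    310, 310⟩,
  ⟨810000000000, 70000000000,
    [35205537621, -18976067877, 1157678844, 77144093, 56999708, 12118193, 2338412, 319316, 30359,
      505, -528, -143],
    [3975520788, -3264437925, 574784404, 61812507, -506512, -1785362, -474818, -74505, -8364, -459,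
      62, 25],
    [406909699585, -157593393106, 2263504873, 161542538, 4430716, 3245596, 400562, 50910, 3706,
      -244, -140, -30],
    322, 310⟩,
  ⟨650000000000, 90000000000,
    [84756219459, -31828640765, 2667740461, -329004301, 43058926, -1687135, 1203264, 136247, 38389,
      4979, 721],
    [13750680414, -6455483094, 370394990, 81874000, 4923815, 1581412, -139681, -21279, -7988,
      -1122, -166],
    [776981539300, -212511296285, 1684977908, 490354778, -42877606, 3642086, 227525, 16500, 8503,
      825, 104],
    514, 420⟩,
  ⟨455000000000, 105000000000,
    [170726444909, -58636071293, 8895718728, -1581286233, 257272446, -39697172, 5764510, -799014,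
      119038, -16355, 2951, -460],
    [28663909850, -8047824695, -307155104, 222929361, -41934791, 8862142, -1004926, 129947, -10586,
      293, 13, -21],
    [1239249631919, -245964799251, -4086223871, 1559000766, -115709028, -2281227, 1695149, -158928,
      -121, 2730, -335, 27],
    826, 436⟩,
  ⟨275000000000, 75000000000,
    [308356891932, -79062455835, 12594422308, -2002009343, 292506054, -41394226, 6063450, -979319,
      177118, -34862, 7202, -1528, 331],
    [39909078521, -2632432230, -1437693273, 335444173, -49870773, 5601739, -440353, 18446, 1603,
      -497, 85, -14, 3],
    [1640124949714, -154395336191, -7023427933, 756020915, -183290, -4646191, 220763, 38700, -7599,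
      790, -98, 21, -5],
    999, 437⟩,
  ⟨155000000000, 45000000000,
    [477789014262, -84866877720, 10564155673, -1263909894, 152567351, -20868864, 3384858, -625280,
      124638, -26026, 5622, -1248, 283, -66],
    [38673157424, 3344572379, -1472094572, 180626247, -14554480, 744673, -3010, -5407, 1118, -209,
      41, -9, 2, 0],
    [1866130635809, -75762400887, -3764273009, 137205277, 4492014, -128387, -67619, 11847, -1816,
      334, -67, 14, -3, 1],
    1080, 438⟩,
  ⟨85000000000, 25000000000,
    [641275743247, -72276718973, 6162033222, -552787277, 60657225, -8587078, 1446079, -268769,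
      53227, -11047, 2378, -528, 120],
    [29136624841, 5264391224, -787923520, 49264612, -1791000, -5834, 10091, -1837, 322, -59, 11,
      -2, 0],
    [1974384362718, -35067423712, -1340702570, 19771736, -4793, 110624, -19489, 3041, -527, 98,
      -19, 4, -1],
    1121, 438⟩,
  ⟨46500000000, 13500000000,
    [769657543184, -52072412889, 2944410403, -210660244, 22078951, -3075475, 500598, -89620, 17158,
      -3455, 724, -157, 35],
    [18971059320, 4356142176, -303095471, 9256997, -76417, -16260, 2642, -400, 65, -11, 2, 0, 0],
    [2025135042268, -16628101798, -419515501, 3920160, -200469, 32755, -4466, 673, -111, 20, -4, 1,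
      0],
    1164, 440⟩,
  ⟨25500000000, 7500000000,
    [858743978214, -35125252770, 1369249444, -84864243, 8712277, -1192486, 190931, -33840, 6449,
      -1298, 272, -59],
    [11426328061, 2981543660, -106927042, 1543526, 23838, -4966, 642, -92, 15, -3, 0, 0],
    [2049969543217, -8494537931, -136587321, 1119921, -75754, 8744, -1110, 162, -26, 5, -1, 0],
    1166, 440⟩,
  ⟨14000000000, 4000000000,
    [916189604956, -21384441115, 555031295, -29176607, 2772884, -355214, 53802, -9094, 1661, -321,
      65],
    [6597850607, 1770567947, -32265740, 182794, 8643, -958, 109, -14, 2, 0, 0],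
    [2062668820430, -4302058492, -40749051, 291633, -17939, 1695, -196, 27, -4, 1, 0],
    1195, 441⟩,
  ⟨7750000000, 2250000000,
    [951090061856, -13156819484, 238465374, -11170482, 1021768, -128613, 19393, -3287, 605, -118],
    [3751929566, 1053319867, -10424173, 16411, 2375, -212, 23, -3, 0, 0],
    [2069290062978, -2346886551, -13437382, 83494, -4511, 386, -43, 6, -1, 0],
    1197, 443⟩,
  ⟨4250000000, 1250000000,
    [972182830520, -7778055366, 96604397, -4002014, 351469, -43615, 6565, -1117, 207, -41],
    [2088162547, 603236740, -3226987, -1066, 533, -42, 4, -1, 0, 0],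
    [2072907915270, -1280218293, -4293953, 21608, -998, 79, -8, 1, 0, 0],
    1222, 443⟩,
  ⟨2250000000, 750000000,
    [984894332579, -4875435829, 44659934, -1812780, 171711, -23655, 3995, -766, 160],
    [1114731072, 368126654, -1156079, -1325, 155, -13, 1, 0, 0],
    [2074945175966, -759775228, -1590273, 6723, -293, 24, -3, 0, 0],
    1260, 444⟩,
  ⟨750000000, 750000000,
    [994842906503, -5081046105, 65314225, -10733167],
    [373867197, 372729386, -1142280, -4469],
    [2076458316142, -753332335, -1639416, 11428, -1941],
    14542307, 2263⟩]

theorem isTube_tube : IsTube tube := by decide +kernel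

theorem exists_starts_tube : ∃ p ∈ tube, p.Starts := by
  refine ⟨tube.head (by decide), List.head_mem _, ?_⟩
  decide +kernel

theorem tube_le_one : ∀ p ∈ tube, p.c + p.h ≤ den := by decide +kernel

end SemiRandom
namespace SemiRandom

/-! ## Forward invariance of the tube -/

theorem eventually_nonpos_of_hasDerivWithinAt {g : ℝ → ℝ} {g' s : ℝ}
    (hg : HasDerivWithinAt g g' (Set.Ioi s) s) (h0 : g s ≤ 0) (h : g s = 0 → g' < 0) :
    ∀ᶠ t in 𝓝[>] s, g t ≤ 0 := by
  rcases h0.lt_or_eq with h0 | h0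
  · filter_upwards [hg.continuousWithinAt.eventually_lt_const h0] with t ht using ht.le
  · have := hasDerivWithinAt_iff_tendsto_slope' (by simp) |>.1 hg
    filter_upwards [this.eventually_lt_const (h h0), self_mem_nhdsWithin] with t ht hts
    rw [slope_def_field, h0, sub_zero] at ht
    exact (neg_of_div_neg_left ht (sub_nonneg.2 (le_of_lt hts))).le

namespace TubePiece

variable {p : TubePiece} {w m₁ m₂ : ℝ → ℝ} {s : ℝ}

theorem Valid.eventually_mem (hp : p.Valid) (hw : 0 < w s)
    (dw : HasDerivWithinAt w (-((w s + 2 * (m₁ s + m₂ s)) / 2)) (Set.Ioi s) s)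
    (d₁ : HasDerivWithinAt m₁ (slopeOne (w s) (m₁ s) (m₂ s) / (2 * w s)) (Set.Ioi s) s)
    (d₂ : HasDerivWithinAt m₂ (slopeTwo (w s) (m₁ s) (m₂ s) / (2 * w s)) (Set.Ioi s) s)
    (hm : p.Mem (w s) (m₁ s) (m₂ s) s) (hu : p.coord (w s) ≠ -1) :
    ∀ᶠ t in 𝓝[>] s, p.Mem (w t) (m₁ t) (m₂ t) t := by
  have hh : (0 : ℝ) < p.h := by exact_mod_cast hp.h_pos
  have hd := den_pos
  have hv := hp.speed_mem hm
  set v := w s + 2 * (m₁ s + m₂ s) with hv_def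
  have hc : HasDerivWithinAt (fun t => p.coord (w t)) (-(den * v / (2 * p.h))) (Set.Ioi s) s := by
    have := ((dw.const_mul (den : ℝ)).sub_const (p.c : ℝ)).div_const (p.h : ℝ)
    refine this.congr_deriv ?_
    field_simp
  have hpoly : ∀ P : List ℤ, HasDerivWithinAt (fun t => polyEval P (p.coord (w t)))
      (polyEval (polyDeriv P) (p.coord (w s)) * (-(den * v / (2 * p.h)))) (Set.Ioi s) s :=
    fun P => (hasDerivAt_polyEval P _).comp_hasDerivWithinAt s hc
  have h1s := hp.one_sign hm
  have h2s := hp.two_sign hm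
  have hts := hp.time_sign hm
  obtain ⟨hu1, h1, h2, h3⟩ := hm
  rw [abs_le] at hu1 h1 h2
  have k : 0 < den / (2 * w s * p.h) := by positivity
  have g1 : HasDerivWithinAt (fun t => den * m₁ t - polyEval p.M₁ (p.coord (w t)))
      (den / (2 * w s * p.h) * (p.h * slopeOne (w s) (m₁ s) (m₂ s) +
        w s * v * polyEval (polyDeriv p.M₁) (p.coord (w s)))) (Set.Ioi s) s := by
    refine ((d₁.const_mul (den : ℝ)).sub (hpoly p.M₁)).congr_deriv ?_
    field_simp
    ring
  have g2 : HasDerivWithinAt (fun t => den * m₂ t - polyEval p.M₂ (p.coord (w t)))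
      (den / (2 * w s * p.h) * (p.h * slopeTwo (w s) (m₁ s) (m₂ s) +
        w s * v * polyEval (polyDeriv p.M₂) (p.coord (w s)))) (Set.Ioi s) s := by
    refine ((d₂.const_mul (den : ℝ)).sub (hpoly p.M₂)).congr_deriv ?_
    field_simp
    ring
  have g3 : HasDerivWithinAt (fun t => den * t - polyEval p.S (p.coord (w t)))
      (den / (2 * p.h) * (2 * p.h + polyEval (polyDeriv p.S) (p.coord (w s)) * v))
      (Set.Ioi s) s := by
    refine (((hasDerivWithinAt_id s _).const_mul (den : ℝ)).sub (hpoly p.S)).congr_deriv ?_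
    field_simp
    ring
  have e1 := eventually_nonpos_of_hasDerivWithinAt (hc.sub_const 1) (by linarith [hu1.2])
    fun _ => neg_lt_zero.2 (by positivity)
  have e2 := eventually_nonpos_of_hasDerivWithinAt (hc.const_sub (-1)) (by linarith [hu1.1])
    fun h => absurd (by linarith) hu
  have e3 := eventually_nonpos_of_hasDerivWithinAt (g1.sub_const (p.r₁ : ℝ)) (by linarith [h1.2])
    fun h => mul_neg_of_pos_of_neg k (h1s.1 (by linarith))
  have e4 := eventually_nonpos_of_hasDerivWithinAt (g1.const_sub (-(p.r₁ : ℝ)))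
    (by linarith [h1.1]) fun h => neg_lt_zero.2 (mul_pos k (h1s.2 (by linarith)))
  have e5 := eventually_nonpos_of_hasDerivWithinAt (g2.sub_const (p.r₂ : ℝ)) (by linarith [h2.2])
    fun h => mul_neg_of_pos_of_neg k (h2s.1 (by linarith))
  have e6 := eventually_nonpos_of_hasDerivWithinAt (g2.const_sub (-(p.r₂ : ℝ)))
    (by linarith [h2.1]) fun h => neg_lt_zero.2 (mul_pos k (h2s.2 (by linarith)))
  have e7 := eventually_nonpos_of_hasDerivWithinAt g3 (by linarith)
    fun h => mul_neg_of_pos_of_neg (by positivity) hts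
  filter_upwards [e1, e2, e3, e4, e5, e6, e7] with t t1 t2 t3 t4 t5 t6 t7
  exact ⟨abs_le.2 ⟨by linarith, by linarith⟩, abs_le.2 ⟨by linarith, by linarith⟩,
    abs_le.2 ⟨by linarith, by linarith⟩, by linarith⟩

theorem continuous_coord (p : TubePiece) : Continuous p.coord := by
  unfold coord; fun_prop

theorem isClosed_mem (p : TubePiece) {a b : ℝ} (hw : ContinuousOn w (Set.Icc a b))
    (h₁ : ContinuousOn m₁ (Set.Icc a b)) (h₂ : ContinuousOn m₂ (Set.Icc a b)) :
    IsClosed {s ∈ Set.Icc a b | p.Mem (w s) (m₁ s) (m₂ s) s} := by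
  have hc := p.continuous_coord.comp_continuousOn hw
  have hp : ∀ P : List ℤ, ContinuousOn (fun t => polyEval P (p.coord (w t))) (Set.Icc a b) :=
    fun P => (continuous_polyEval P).comp_continuousOn hc
  have i1 := hc.abs.preimage_isClosed_of_isClosed isClosed_Icc (isClosed_Iic (a := (1 : ℝ)))
  have i2 := ((continuousOn_const.mul h₁).sub (hp p.M₁)).abs.preimage_isClosed_of_isClosed
    isClosed_Icc (isClosed_Iic (a := (p.r₁ : ℝ))) (f := fun t => |(den : ℝ) * m₁ t - _|)
  have i3 := ((continuousOn_const.mul h₂).sub (hp p.M₂)).abs.preimage_isClosed_of_isClosed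
    isClosed_Icc (isClosed_Iic (a := (p.r₂ : ℝ))) (f := fun t => |(den : ℝ) * m₂ t - _|)
  have i4 := ((continuousOn_const.mul continuousOn_id).sub (hp p.S)).preimage_isClosed_of_isClosed
    isClosed_Icc (isClosed_Iic (a := (0 : ℝ))) (f := fun t => (den : ℝ) * t - _)
  convert (i1.inter i2).inter (i3.inter i4) using 1
  ext t
  simp only [Mem, Set.mem_ofPred_eq, Set.mem_inter_iff, Set.mem_preimage, Set.mem_Iic,
    Function.comp, sub_nonpos]
  tauto

end TubePiece

/-- A trajectory that starts at the beginning of a tube stays in the tube. -/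
theorem exists_mem_tube {L : List TubePiece} (hL : IsTube L) (hs : ∃ p ∈ L, p.Starts)
    {w m₁ m₂ : ℝ → ℝ} {T : ℝ} (w0 : w 0 = 1) (m₁0 : m₁ 0 = 0) (m₂0 : m₂ 0 = 0)
    (hw : ∀ s ∈ Set.Ico 0 T, 0 < w s)
    (dw : ∀ s ∈ Set.Ico 0 T,
      HasDerivWithinAt w (-((w s + 2 * (m₁ s + m₂ s)) / 2)) (Set.Ico 0 T) s)
    (d₁ : ∀ s ∈ Set.Ico 0 T,
      HasDerivWithinAt m₁ (slopeOne (w s) (m₁ s) (m₂ s) / (2 * w s)) (Set.Ico 0 T) s)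
    (d₂ : ∀ s ∈ Set.Ico 0 T,
      HasDerivWithinAt m₂ (slopeTwo (w s) (m₁ s) (m₂ s) / (2 * w s)) (Set.Ico 0 T) s)
    {s : ℝ} (h : s ∈ Set.Ico 0 T) : ∃ p ∈ L, p.Mem (w s) (m₁ s) (m₂ s) s := by
  have hsub : Set.Icc 0 s ⊆ Set.Ico 0 T := fun t ht => ⟨ht.1, ht.2.trans_lt h.2⟩
  have cw : ContinuousOn w (Set.Icc 0 s) := fun t ht =>
    ((dw t (hsub ht)).mono hsub).continuousWithinAt
  have c₁ : ContinuousOn m₁ (Set.Icc 0 s) := fun t ht =>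
    ((d₁ t (hsub ht)).mono hsub).continuousWithinAt
  have c₂ : ContinuousOn m₂ (Set.Icc 0 s) := fun t ht =>
    ((d₂ t (hsub ht)).mono hsub).continuousWithinAt
  let A : Set ℝ := {t | ∃ p ∈ L, p.Mem (w t) (m₁ t) (m₂ t) t}
  have hA : IsClosed (A ∩ Set.Icc 0 s) := by
    have := (List.finite_toSet L).isClosed_biUnion (f := fun p : TubePiece =>
      {t ∈ Set.Icc 0 s | p.Mem (w t) (m₁ t) (m₂ t) t}) fun p _ => p.isClosed_mem cw c₁ c₂
    convert this using 1
    ext t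
    simp only [A, Set.mem_inter_iff, Set.mem_ofPred_eq, Set.mem_iUnion, exists_prop]
    tauto
  have h0 : (0 : ℝ) ∈ A := by
    obtain ⟨p, hpL, hp⟩ := hs
    exact ⟨p, hpL, by rw [w0, m₁0, m₂0]; exact hp.mem (hL.valid p hpL)⟩
  refine hA.Icc_subset_of_forall_exists_gt h0 ?_ ⟨h.1, le_rfl⟩
  rintro t ⟨⟨p, hpL, hp⟩, ht⟩ y hy
  have htT : t ∈ Set.Ico 0 T := hsub ⟨ht.1, ht.2.le⟩
  have hnhds : Set.Ico 0 T ∈ 𝓝[>] t :=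
    mem_of_superset (Ioo_mem_nhdsGT htT.2) fun r hr => ⟨htT.1.trans hr.1.le, hr.2⟩
  have key : ∀ q ∈ L, q.Mem (w t) (m₁ t) (m₂ t) t → q.coord (w t) ≠ -1 →
      (A ∩ Set.Ioc t y).Nonempty := by
    intro q hqL hq hu
    have hev := (hL.valid q hqL).eventually_mem (hw t htT) ((dw t htT).mono_of_mem_nhdsWithin hnhds)
      ((d₁ t htT).mono_of_mem_nhdsWithin hnhds) ((d₂ t htT).mono_of_mem_nhdsWithin hnhds) hq hu
    obtain ⟨r, hr, hr'⟩ := (hev.and (Ioc_mem_nhdsGT hy)).exists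
    exact ⟨r, ⟨q, hqL, hr⟩, hr'⟩
  by_cases hu : p.coord (w t) = -1
  · rcases hL.exists_linked p hpL with hc | ⟨q, hqL, hq⟩
    · have e := (hL.valid p hpL).coord_eq (w := w t)
      rw [hu, hc] at e
      have := mul_pos TubePiece.den_pos (hw t htT)
      linarith
    · obtain ⟨h1, h2⟩ := hq.mem (hL.valid p hpL) (hL.valid q hqL) hp hu
      exact key q hqL h1 (by rw [h2]; norm_num)
  · exact key p hpL hp hu

namespace IsSolution

variable {ε T : ℝ} {x a b : ℝ → ℝ}

theorem exists_mem_tube (hε : 0 < ε) (h : IsSolution ε T x a b) {s : ℝ} (hs : s ∈ Set.Ico 0 T) :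
    ∃ p ∈ tube, p.Mem √(1 - x s) (a s / √(1 - x s)) (b s / √(1 - x s)) s := by
  have hpos : ∀ t ∈ Set.Ico 0 T, 0 < 1 - x t := fun t ht => by
    linarith [(h.mem_domain t ht).2.1.2]
  have hw : ∀ t ∈ Set.Ico 0 T, 0 < √(1 - x t) := fun t ht => Real.sqrt_pos.2 (hpos t ht)
  have hx : ∀ t ∈ Set.Ico 0 T, x t = 1 - √(1 - x t) ^ 2 := fun t ht => by
    rw [Real.sq_sqrt (hpos t ht).le]; ring
  have dw : ∀ t ∈ Set.Ico 0 T, HasDerivWithinAt (fun t => √(1 - x t))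
      (-((√(1 - x t) + 2 * (a t / √(1 - x t) + b t / √(1 - x t))) / 2)) (Set.Ico 0 T) t := by
    intro t ht
    refine (((h.deriv_x t ht).const_sub 1).sqrt (hpos t ht).ne').congr_deriv ?_
    have h1 := hw t ht
    have h2 := hx t ht
    set w := √(1 - x t)
    rw [rhsX, h2]
    field_simp
    ring
  refine SemiRandom.exists_mem_tube isTube_tube exists_starts_tube (w := fun t => √(1 - x t))
    (m₁ := fun t => a t / √(1 - x t)) (m₂ := fun t => b t / √(1 - x t)) (by simp [h.x_zero])
    (by simp [h.l₁_zero]) (by simp [h.l₂_zero]) hw dw (fun t ht => ?_) (fun t ht => ?_) hs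
  · refine ((h.deriv_l₁ t ht).div (dw t ht) (hw t ht).ne').congr_deriv ?_
    have h1 := hw t ht
    have h2 := hx t ht
    set w := √(1 - x t)
    rw [rhsL₁_eq, h2, slopeOne, sub_sub_cancel]
    field_simp
    ring
  · refine ((h.deriv_l₂ t ht).div (dw t ht) (hw t ht).ne').congr_deriv ?_
    have h1 := hw t ht
    have h2 := hx t ht
    set w := √(1 - x t)
    rw [rhsL₂_eq, h2, slopeTwo, sub_sub_cancel]
    field_simp
    ring

theorem bounds (hε : 0 < ε) (h : IsSolution ε T x a b) {s : ℝ} (hs : s ∈ Set.Ico 0 T) :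
    s ≤ 2.07721 ∧ 0 ≤ x s ∧ |a s| ≤ 3 / 2 ∧ |b s| ≤ 3 / 2 := by
  obtain ⟨p, hp, hm⟩ := h.exists_mem_tube hε hs
  have hv := isTube_tube.valid p hp
  have hpos : 0 < 1 - x s := by linarith [(h.mem_domain s hs).2.1.2]
  have hw : 0 < √(1 - x s) := Real.sqrt_pos.2 hpos
  have hw1 : √(1 - x s) ≤ 1 := by
    have hv' := tube_le_one p hp
    have e := hv.coord_eq (w := √(1 - x s))
    have hh : (0 : ℝ) < p.h := by exact_mod_cast hv.h_pos
    have hc : p.h * p.coord √(1 - x s) ≤ p.h * 1 :=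
      mul_le_mul_of_nonneg_left (le_of_abs_le hm.1) hh.le
    have : (p.c : ℝ) + p.h ≤ den := by exact_mod_cast hv'
    refine le_of_mul_le_mul_left (a := (den : ℝ)) ?_ TubePiece.den_pos
    linarith
  obtain ⟨h1, h2⟩ := hv.abs_le_of_mem hm
  rw [abs_div, abs_of_pos hw, div_le_iff₀ hw] at h1 h2
  refine ⟨hv.time_le hm, ?_, by linarith, by linarith⟩
  nlinarith [Real.sq_sqrt hpos.le]

theorem le (hε : 0 < ε) (h : IsSolution ε T x a b) : T ≤ 2.07721 := by
  by_contra! hT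
  obtain ⟨s, hs1, hs2⟩ := exists_between hT
  exact absurd (h.bounds hε ⟨by linarith, hs2⟩).1 (not_le.2 hs1)

end IsSolution

theorem sigma_le {ε : ℝ} (hε : 0 < ε) : sigma ε ≤ 2.07721 :=
  csSup_le (solutionTimes_nonempty ε) fun _ ⟨_, _, _, _, h⟩ => h.le hε

theorem alphaHat_le : alphaHat ≤ 2.07721 :=
  le_of_tendsto tendsto_alphaHat (eventually_mem_nhdsWithin.mono fun _ hε => sigma_le hε)

theorem sigma_le_alphaHat {ε : ℝ} (hε : 0 < ε) : sigma ε ≤ alphaHat := by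
  refine ge_of_tendsto tendsto_alphaHat ?_
  filter_upwards [Ioc_mem_nhdsGT hε] with ε' h using sigma_antitone h.2

theorem IsMaximalSolution.le_alphaHat {ε T : ℝ} {x a b : ℝ → ℝ} (hε : 0 < ε)
    (h : IsMaximalSolution ε T x a b) : T ≤ alphaHat :=
  (le_csSup (solutionTimes_bddAbove ε) ⟨h.nonneg, x, a, b, h.isSolution⟩).trans
    (sigma_le_alphaHat hε)

theorem IsMaximalSolution.pos {ε T : ℝ} {x a b : ℝ → ℝ} (hε1 : ε < 1)
    (h : IsMaximalSolution ε T x a b) : 0 < T := by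
  rcases h.nonneg.lt_or_eq with h0 | h0
  · exact h0
  · refine absurd ?_ h.exit
    rw [← h0, h.x_zero, h.a_zero, h.b_zero]
    norm_num [InDomain]
    exact hε1

/-- The maximal solution leaves the domain through the face `x = 1 - ε`. -/
theorem IsMaximalSolution.x_end {ε T : ℝ} {x a b : ℝ → ℝ} (hε : 0 < ε) (hε1 : ε < 1)
    (h : IsMaximalSolution ε T x a b) : x T = 1 - ε := by
  have h0 := h.pos hε1
  have hT : T ≤ 2.07721 := h.isSolution.le hε
  have hTm : T ∈ Set.Icc 0 T := ⟨h0.le, le_rfl⟩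
  have hcl : T ∈ closure (Set.Ico 0 T) := by
    rw [closure_Ico h0.ne]; exact hTm
  have lim : ∀ z : ℝ → ℝ, ContinuousWithinAt z (Set.Icc 0 T) T → ∀ K : Set ℝ, IsClosed K →
      (∀ s ∈ Set.Ico 0 T, z s ∈ K) → z T ∈ K := by
    intro z hz K hK hzK
    have := (hz.mono Set.Ico_subset_Icc_self).mem_closure (t := K) hcl hzK
    rwa [hK.closure_eq] at this
  have hb := fun s (hs : s ∈ Set.Ico 0 T) => h.isSolution.bounds hε hs
  have e1 := lim x (h.deriv_x T hTm).continuousWithinAt _ isClosed_Ici fun s hs => (hb s hs).2.1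
  have e2 := lim _ (h.deriv_a T hTm).continuousWithinAt.abs _ isClosed_Iic
    fun s hs => (hb s hs).2.2.1
  have e3 := lim _ (h.deriv_b T hTm).continuousWithinAt.abs _ isClosed_Iic
    fun s hs => (hb s hs).2.2.2
  simp only [Set.mem_Ici, Set.mem_Iic] at e1 e2 e3
  by_contra hne
  refine h.exit ⟨⟨by linarith, by norm_num at hT ⊢; linarith⟩, ⟨by linarith,
    lt_of_le_of_ne (h.mem_closed T hTm).2.1 hne⟩, by linarith, by linarith⟩

end SemiRandom
namespace SemiRandom

/-! ## The upper bound for the threshold -/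

section Final

variable {V : Type*} [DecidableEq V] [Fintype V] [Nonempty V]

theorem failProb_le_of_long_path {ε δ : ℝ} (hε0 : 0 < ε) (hε : ε ≤ 1 / 800) (hδ : 0 < δ)
    (h400 : 400 ≤ Fintype.card V) {G : SimpleGraph V} {l : List V} (hl : l.Nodup)
    (hc : l.IsChain G.Adj) (hlen : (Fintype.card V : ℝ) * (1 - 2 * ε) ≤ l.length) {t : ℕ}
    (ht : δ * Fintype.card V ≤ t) :
    failProb (fun G : SimpleGraph V => G.IsHamiltonian) t G ≤
      6 / δ * (1 / √(Fintype.card V)) + 14 / δ * √(2 * ε) := by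
  set n := Fintype.card V with hn
  have hn0 : (0 : ℝ) < n := by exact_mod_cast (by lia : 0 < n)
  have hle : l.length ≤ n := hl.length_le_card
  have hk : ((n - l.length : ℕ) : ℝ) ≤ 2 * ε * n := by
    rw [Nat.cast_sub hle]; linarith
  have h400k : 400 * (n - l.length) ≤ n := by
    have : 400 * ((n - l.length : ℕ) : ℝ) ≤ n := by nlinarith
    exact_mod_cast this
  have hb := hitBound_hasPath h400 (n - l.length) h400k G
    ⟨l, hl, hc, Nat.add_sub_cancel' hle⟩ t
  rw [← hn] at hb
  set f := failProb (fun G : SimpleGraph V => G.IsHamiltonian) t G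
  have hf : 0 ≤ f := failProb_nonneg t G
  have h1 : √(((n - l.length : ℕ) : ℝ) * n) ≤ √(2 * ε) * n := by
    calc √(((n - l.length : ℕ) : ℝ) * n) ≤ √(2 * ε * n * n) := by gcongr
      _ = √(2 * ε) * n := by
        rw [mul_assoc, Real.sqrt_mul (by positivity), Real.sqrt_mul_self hn0.le]
  have h2 : δ * n * f ≤ 6 * √n + 14 * (√(2 * ε) * n) := by
    calc δ * n * f ≤ t * f := by gcongr
      _ ≤ _ := by linarith
  have h3 : (6 / δ * (1 / √n) + 14 / δ * √(2 * ε)) * (δ * n) =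
      6 * √n + 14 * (√(2 * ε) * n) := by
    have hs : √(n : ℝ) ≠ 0 := (Real.sqrt_pos.2 hn0).ne'
    have : (n : ℝ) = √n * √n := (Real.mul_self_sqrt hn0.le).symm
    field_simp
    linear_combination 6 * this
  refine le_of_mul_le_mul_right (a := δ * n) ?_ (by positivity)
  rw [h3]
  linarith

end Final

theorem eventually_failProb_le {δ η : ℝ} (hδ : 0 < δ) (hη : 0 < η) :
    ∀ᶠ m : ℕ in atTop, ∃ t : ℕ, (t : ℝ) ≤ (alphaHat + δ) * (m + 1 : ℕ) ∧
      failProb (V := Fin (m + 1)) (fun G => G.IsHamiltonian) t ⊥ ≤ η := by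
  set δ' := δ / 2 with hδ'
  have hδ'0 : 0 < δ' := by positivity
  set ε := min (1 / 800) ((η * δ' / 42) ^ 2 / 2) with hε
  have hε0 : 0 < ε := by positivity
  have hε8 : ε ≤ 1 / 800 := min_le_left _ _
  have hε1 : ε < 1 := by linarith
  have hεη : 14 / δ' * √(2 * ε) ≤ η / 3 := by
    have : √(2 * ε) ≤ η * δ' / 42 := by
      rw [Real.sqrt_le_left (by positivity)]
      linarith [min_le_right (1 / 800) ((η * δ' / 42) ^ 2 / 2)]
    calc 14 / δ' * √(2 * ε) ≤ 14 / δ' * (η * δ' / 42) := by gcongr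
      _ = η / 3 := by field_simp; norm_num
  obtain ⟨T, x, a, b, h⟩ := exists_isMaximalSolution hε0 hε1
  have hT0 := h.pos hε1
  have hTα := h.le_alphaHat hε0
  obtain ⟨C, hC, hfollow⟩ := h.followsRhs hε0 hε1
  set K := growthConst (2 / ε) (200 / (ε / 2) ^ 2) C with hK
  have hB : 1 ≤ 2 / ε := by rw [le_div_iff₀ hε0]; linarith
  have hK0 : 0 < K := growthConst_pos hB (by positivity) hC
  have hcast : Tendsto (fun m : ℕ => ((m + 1 : ℕ) : ℝ)) atTop atTop :=
    tendsto_natCast_atTop_atTop.comp (tendsto_add_atTop_nat 1)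
  have lim1 : Tendsto (fun m : ℕ => 6 / δ' * (1 / √((m + 1 : ℕ) : ℝ))) atTop (𝓝 0) := by
    have := ((Real.tendsto_sqrt_atTop.comp hcast).const_div_atTop 1).const_mul (6 / δ')
    simpa using this
  have lim2 : Tendsto (fun m : ℕ => K * T * Real.exp (K * T) / (ε / 2) ^ 2 / ((m + 1 : ℕ) : ℝ))
      atTop (𝓝 0) := hcast.const_div_atTop _
  have limN : Tendsto (fun m : ℕ => (⌊T * ((m + 1 : ℕ) : ℝ)⌋₊ : ℝ) / ((m + 1 : ℕ) : ℝ)) atTop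
      (𝓝 T) := (tendsto_nat_floor_mul_div_atTop hT0.le).comp hcast
  have hNle : ∀ m : ℕ, (⌊T * ((m + 1 : ℕ) : ℝ)⌋₊ : ℝ) / ((m + 1 : ℕ) : ℝ) ≤ T := fun m => by
    rw [div_le_iff₀ (by positivity)]
    exact Nat.floor_le (by positivity)
  have limx : Tendsto (fun m : ℕ => x ((⌊T * ((m + 1 : ℕ) : ℝ)⌋₊ : ℝ) / ((m + 1 : ℕ) : ℝ))) atTop
      (𝓝 (1 - ε)) := by
    rw [← h.x_end hε0 hε1]
    refine Tendsto.comp (h.deriv_x T ⟨hT0.le, le_rfl⟩).continuousWithinAt.tendsto ?_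
    exact tendsto_nhdsWithin_iff.2
      ⟨limN, Eventually.of_forall fun m => ⟨by positivity, hNle m⟩⟩
  have hη3 : 0 < η / 3 := by positivity
  filter_upwards [eventually_ge_atTop 400, lim1.eventually_lt_const hη3,
    lim2.eventually_lt_const hη3, limx.eventually_const_lt (show 1 - ε - ε / 2 < 1 - ε by linarith),
    hcast.eventually_ge_atTop (1 / δ')] with m hm400 hm1 hm2 hmx hmδ
  set n : ℝ := ((m + 1 : ℕ) : ℝ) with hn
  have hn0 : 0 < n := by positivity
  set N := ⌊T * n⌋₊ with hN
  have hcard : Fintype.card (Fin (m + 1)) = m + 1 := Fintype.card_fin _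
  have hcardR : n = (Fintype.card (Fin (m + 1)) : ℝ) := by rw [hcard]
  have hNT : (N : ℝ) ≤ T * n := Nat.floor_le (by positivity)
  refine ⟨⌈δ' * n⌉₊ + N, ?_, ?_⟩
  · have h1 := (Nat.ceil_lt_add_one (show 0 ≤ δ' * n by positivity)).le
    have h2 : 1 ≤ δ' * n := by rw [div_le_iff₀ hδ'0] at hmδ; linarith
    have h3 : T * n ≤ alphaHat * n := by gcongr
    push_cast
    have : (alphaHat + δ) * n = alphaHat * n + δ' * n + δ' * n := by rw [hδ']; ring
    linarith
  · have hmain := (hfollow n N hn0 (hNle m)).failProb_le (V := Fin (m + 1))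
      (P := fun G => G.IsHamiltonian) hcardR (by positivity) (by linarith) hB (by positivity) hC
      (t₀ := ⌈δ' * n⌉₊) (η := η / 3 + η / 3) (by positivity) fun G l hl hc hlen => by
        refine (failProb_le_of_long_path hε0 hε8 hδ'0 (by lia) hl hc ?_ (t := ⌈δ' * n⌉₊) ?_).trans ?_
        · rw [← hcardR]
          exact (mul_le_mul_of_nonneg_left (by linarith) hn0.le).trans hlen
        · rw [← hcardR]; exact Nat.le_ceil _
        · rw [← hcardR]
          linarith
    refine hmain.trans ?_
    rw [← hK]
    have hpow : (1 + K / n) ^ N ≤ Real.exp (K * T) := by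
      calc (1 + K / n) ^ N ≤ Real.exp (K / n) ^ N := by
            gcongr
            linarith [Real.add_one_le_exp (K / n)]
        _ = Real.exp (N * (K / n)) := (Real.exp_nat_mul _ _).symm
        _ ≤ Real.exp (K * T) := by
            refine Real.exp_le_exp.2 ?_
            calc N * (K / n) ≤ T * n * (K / n) := by gcongr
              _ = K * T := by field_simp
    have : K * N * (1 + K / n) ^ N / (ε / 2 * n) ^ 2 ≤
        K * T * Real.exp (K * T) / (ε / 2) ^ 2 / n := by
      calc K * N * (1 + K / n) ^ N / (ε / 2 * n) ^ 2
          ≤ K * (T * n) * Real.exp (K * T) / (ε / 2 * n) ^ 2 := by gcongr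
        _ = _ := by field_simp
    linarith

theorem alphaHat_nonneg : 0 ≤ alphaHat := by
  refine ge_of_tendsto tendsto_alphaHat (Eventually.of_forall fun ε => ?_)
  exact le_csSup (solutionTimes_bddAbove ε) ⟨le_rfl, fun _ => 0, fun _ => 0, fun _ => 0,
    ⟨rfl, rfl, rfl, by simp, by simp, by simp, by simp⟩⟩

theorem limsupTauHam_le {q : ℝ≥0∞} (hq : q < 1) {δ : ℝ} (hδ : 0 < δ) :
    limsupTauHam q ≤ ENNReal.ofReal (alphaHat + δ) := by
  have hη : 0 < (1 - q).toReal := by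
    refine ENNReal.toReal_pos (tsub_pos_of_lt hq).ne' ?_
    exact (tsub_le_self.trans_lt ENNReal.one_lt_top).ne
  refine limsup_le_of_le (by isBoundedDefault) ?_
  filter_upwards [eventually_failProb_le hδ hη] with m hm
  obtain ⟨t, ht, hf⟩ := hm
  refine ENNReal.div_le_of_le_mul ?_
  refine (tauFinite_le (T := t) (ENNReal.ofReal_le_of_le_toReal hf) hq.le).trans ?_
  rw [← ENNReal.ofReal_natCast (m + 1), ← ENNReal.ofReal_mul (by linarith [alphaHat_nonneg]),
    ← ENNReal.ofReal_natCast t]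
  exact ENNReal.ofReal_le_ofReal ht

theorem tauHam_le : tauHam ≤ ENNReal.ofReal alphaHat := by
  have h : ∀ δ : ℝ, 0 < δ → tauHam ≤ ENNReal.ofReal (alphaHat + δ) := fun δ hδ =>
    le_of_tendsto tendsto_tauHam
      (eventually_mem_nhdsWithin.mono fun _ hq => limsupTauHam_le hq hδ)
  have hlim : Tendsto (fun δ : ℝ => ENNReal.ofReal (alphaHat + δ)) (𝓝[>] 0)
      (𝓝 (ENNReal.ofReal alphaHat)) := by
    have : Tendsto (fun δ : ℝ => alphaHat + δ) (𝓝[>] 0) (𝓝 (alphaHat + 0)) :=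
      (tendsto_nhdsWithin_of_tendsto_nhds tendsto_id).const_add _
    rw [add_zero] at this
    exact ENNReal.tendsto_ofReal this
  exact ge_of_tendsto hlim (eventually_mem_nhdsWithin.mono fun δ hδ => h δ hδ)

end SemiRandom

theorem theorem3 :
    SemiRandom.tauHam ≤ ENNReal.ofReal SemiRandom.alphaHat ∧
      SemiRandom.alphaHat ≤ 2.07721 :=
  ⟨SemiRandom.tauHam_le, SemiRandom.alphaHat_le⟩
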